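/- **Setting.** Write $\mathbb R^4=P_1\times P_2$ with $P_1\perp P_2$ planes. Let $a_1,a_2,a_3\in P_1$ be unit vectors at mutual angles $2\pi/3$, let $x_i\in P_1$ be the unit vector obtained from $a_i$ by the rotation by $\pi/2$ (same sense for all $i$), and let $b_j,y_j\in P_2$ be defined in the same way. Let $H_{ij}=\{sa_i+tb_j:s,t\ge 0\}$ and $Z=Y\times Y=\bigcup_{1\le i,j\le 3}H_{ij}$. Let $Q_{ij}$ be the plane spanned by $x_i,y_j$, and $q_{ij}$ the orthogonal projection onto $Q_{ij}$. For $0<\eta<1$ let $B$ be the open unit ball and $$\mathcal U=\{p\in B:\ \langle p,w\rangle<1-\eta\ \ \forall w\in Z\cap\partial B,\ \ \langle p,a_i\rangle<1-\sqrt\eta,\ \langle p,b_j\rangle<1-\sqrt\eta\ \ \forall i,j\},$$ $R_1=\sqrt{1-(1-\eta)^2}$, $R_3=\sqrt{(1-\eta)^2-(1-\sqrt\eta)^2}$. Let $l_{ij}=H_{ij}\cap\partial\mathcal U$, a curve from $(1-\sqrt\eta)a_i$ to $(1-\sqrt\eta)b_j$. Let $l_{ij}^\nu$ be $l_{ij}$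 minus the open balls of radius $\nu$ about its two end points, and $L_{ij}^\nu=\{z+v: z\in l_{ij}^\nu,\ v\in Q_{ij},\ |v|<R_1\}$. A family $\varphi_t:\overline{\mathcal U}\to\overline{\mathcal U}$ $(0\le t\le 1)$ is called a $\delta$-sliding deformation of $Z\cap\partial\mathcal U$ if $\varphi_0=\mathrm{id}$, $(t,p)\mapsto\varphi_t(p)$ is continuous, $\varphi_1$ is Lipschitz, $\varphi_t(\partial\mathcal U)\subset\partial\mathcal U$ for all $t$, and $|\varphi_t(p)-p|<\delta$ for all $p\in Z\cap\partial\mathcal U$ and all $t$. A closed set $G\subset\partial\mathcal U$ is an $(\eta,\delta,\nu,L)$-sliding boundary for $Z$ if $G=\varphi_1(Z\cap\partial\mathcal U)$ for some such family and if, for all $i,j$, $G\cap L_{ij}^\nu$ is the graph $\{z+\xi(z):z\in l^\nu_{ij}\}$ of an $L$-Lipschitz map $\xi$ from $l_{ij}^\nu$ to $\{v\in Q_{ij}:|v|<R_1\}$. Let $z_{ij}=\sum_{k\ne i,\,m\ne j}l_{km}$, a $1$-cycle with coefficients in $\mathbb Z_2$, where each $l_{km}$ is regarded as a path. For a $\mathbb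 Z_2$-$1$-cycle $\sigma$ in a plane let $|\sigma|_2$ be the area of the support of the $\mathbb Z_2$-$2$-chain in that plane with boundary $\sigma$, that is, of the set of points that lie in the carrier of every singular $\mathbb Z_2$-$2$-chain with boundary $\sigma$. **Theorem 6.1.** Let $0<\eta<1$, $0<\delta<R_1$, $0<\nu<R_3$ and $L>0$ satisfy $$\arctan\frac{R_3}{1-\sqrt\eta}<\frac{\pi}{16},\qquad \delta<\min\Big\{\nu,\frac{R_3-\nu}{6}\Big\},\qquad L<\frac{\delta^2R_3}{(1-\sqrt\eta)(1-\eta)^2}.$$ Let $G$ be an $(\eta,\delta,\nu,L)$-sliding boundary for $Z$, let $(\varphi_t)$ be any $\delta$-sliding deformation of $Z\cap\partial\mathcal U$ with $\varphi_1(Z\cap\partial\mathcal U)=G$, and let $\sigma_{ij}=\varphi_{1*}(z_{ij})$. Then $$\sum_{i=1}^3\sum_{j=1}^3|q_{ij*}(\sigma_{ij})|_2\ \ge\ \sum_{i=1}^3\sum_{j=1}^3|q_{ij*}(z_{ij})|_2 .$$ -/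

import Mathlib

open scoped BigOperators

namespace YProd

/-! ### Singular chains with coefficients in `ℤ/2` -/

/-- One-dimensional chains with `ℤ/2` coefficients. A path is recorded as a map on `[0,1]`;
only continuous paths occur as faces of singular 2-simplices. -/
abbrev OneChain (X : Type*) := (unitInterval → X) →₀ ZMod 2

/-- Singular 2-chains with `ℤ/2` coefficients. -/
abbrev TwoChain (X : Type*) [TopologicalSpace X] := C(stdSimplex ℝ (Fin 3), X) →₀ ZMod 2

/-- The edge of the standard 2-simplex from vertex `i` to vertex `j`. -/
noncomputable def edge (i j : Fin 3) (t : unitInterval) : stdSimplex ℝ (Fin 3) :=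
  ⟨(1 - (t : ℝ)) • Pi.single i 1 + (t : ℝ) • Pi.single j 1,
    convex_stdSimplex ℝ (Fin 3) (single_mem_stdSimplex ℝ i) (single_mem_stdSimplex ℝ j)
      (sub_nonneg.2 t.2.2) t.2.1 (sub_add_cancel _ _)⟩

/-- The boundary of a 2-chain (signs are irrelevant modulo 2). -/
noncomputable def bdry {X : Type*} [TopologicalSpace X] (c : TwoChain X) : OneChain X :=
  c.sum fun s r => Finsupp.single (fun t => s (edge 1 2 t)) r
    + Finsupp.single (fun t => s (edge 0 2 t)) r + Finsupp.single (fun t => s (edge 0 1 t)) r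

/-- The union of the images of the simplices of a 2-chain. -/
def carrier {X : Type*} [TopologicalSpace X] (c : TwoChain X) : Set X :=
  ⋃ s ∈ c.support, Set.range s

/-- Push-forward `f_*` of a 1-chain. -/
noncomputable def push {X Y : Type*} (f : X → Y) (σ : OneChain X) : OneChain Y :=
  Finsupp.mapDomain (fun γ => f ∘ γ) σ

/-- The support of the 2-chain filling the 1-cycle `σ`: the points which no 2-chain with
boundary `σ` can avoid. In the plane a point `p` off the cycle belongs to this set if and only
if `σ` represents a nonzero class in the first homology group of the complement of `p` with
`ℤ/2` coefficients, that is, if and only if the filling of `σ` has multiplicity 1 at `p`. -/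
def fillSupport {X : Type*} [TopologicalSpace X] (σ : OneChain X) : Set X :=
  {p | ∀ c : TwoChain X, bdry c = σ → p ∈ carrier c}

/-- The area enclosed (modulo 2) by a 1-cycle in a Euclidean plane, identified with `ℂ`. -/
noncomputable def enclosedArea (σ : OneChain ℂ) : ENNReal :=
  MeasureTheory.volume (fillSupport σ)

/-! ### The cone `Y × Y` -/

/-- Euclidean 4-space. -/
abbrev E4 := EuclideanSpace ℝ (Fin 4)

/-- An orthonormal frame `(a₁, x₁, b₁, y₁)` of `ℝ⁴`, listed as `e 0, e 1, e 2, e 3`. The plane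
`P₁` is spanned by `e 0, e 1`, and `P₂` by `e 2, e 3`. -/
abbrev Frame := OrthonormalBasis (Fin 4) ℝ E4

/-- Cosines of `0, 2π/3, 4π/3`. -/
noncomputable def cs : Fin 3 → ℝ := ![1, -1 / 2, -1 / 2]

/-- Sines of `0, 2π/3, 4π/3`. -/
noncomputable def sn : Fin 3 → ℝ := ![0, √3 / 2, -(√3 / 2)]

/-- The three unit vectors of `Y₁`. -/
noncomputable def a (e : Frame) (i : Fin 3) : E4 := cs i • e 0 + sn i • e 1

/-- The unit normal of `a i` in `P₁`; the pairs `(a i, x i)` are equally oriented. -/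
noncomputable def x (e : Frame) (i : Fin 3) : E4 := (-sn i) • e 0 + cs i • e 1

/-- The three unit vectors of `Y₂`. -/
noncomputable def b (e : Frame) (j : Fin 3) : E4 := cs j • e 2 + sn j • e 3

/-- The unit normal of `b j` in `P₂`; the pairs `(b j, y j)` are equally oriented. -/
noncomputable def y (e : Frame) (j : Fin 3) : E4 := (-sn j) • e 2 + cs j • e 3

/-- The product of the rays spanned by `a i` and `b j`. -/
def quadrant (e : Frame) (i j : Fin 3) : Set E4 :=
  {p | ∃ s t : ℝ, 0 ≤ s ∧ 0 ≤ t ∧ p = s • a e i + t • b e j}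

/-- The cone `Z = Y₁ × Y₂`. -/
def Z (e : Frame) : Set E4 := ⋃ (i : Fin 3) (j : Fin 3), quadrant e i j

/-! ### The convex domain -/

/-- The convex domain associated with `Z` and `η`; the singular points of `Z` in the unit sphere
are the `a i` and the `b j`. -/
def U (e : Frame) (η : ℝ) : Set E4 :=
  {p | p ∈ Metric.ball (0 : E4) 1 ∧
    (∀ w ∈ Z e ∩ Metric.sphere (0 : E4) 1, inner ℝ p w < 1 - η) ∧
    (∀ i, inner ℝ p (a e i) < 1 - √η) ∧ (∀ j, inner ℝ p (b e j) < 1 - √η)}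

noncomputable def R1 (η : ℝ) : ℝ := √(1 - (1 - η) ^ 2)

noncomputable def R3 (η : ℝ) : ℝ := √((1 - η) ^ 2 - (1 - √η) ^ 2)

/-- The plane `Q i j` spanned by `x i` and `y j`. -/
noncomputable def Q (e : Frame) (i j : Fin 3) : Submodule ℝ E4 :=
  Submodule.span ℝ {x e i, y e j}

/-- The curve `l i j`, the part of the boundary of the domain in `quadrant i j`, with the open
balls of radius `ν` about its two end points removed. -/
def l (e : Frame) (η ν : ℝ) (i j : Fin 3) : Set E4 :=
  {z | z ∈ quadrant e i j ∩ frontier (U e η) ∧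
    ν ≤ dist z ((1 - √η) • a e i) ∧ ν ≤ dist z ((1 - √η) • b e j)}

/-- The tube `l i j × B(0, R₁)`, where `B(0, R₁)` is the open ball of `Q i j`. -/
def tube (e : Frame) (η ν : ℝ) (i j : Fin 3) : Set E4 :=
  {p | ∃ z ∈ l e η ν i j, ∃ v ∈ Q e i j, ‖v‖ < R1 η ∧ p = z + v}

/-! ### Sliding deformations and sliding boundaries -/

/-- `φ t`, `0 ≤ t ≤ 1`, is a family of maps of the closure of `V` into itself which defines a
`δ`-sliding deformation of `A` in the closure of `V`. Values outside are irrelevant. -/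
structure IsSlidingDeformation (V A : Set E4) (δ : ℝ) (φ : ℝ → E4 → E4) : Prop where
  mapsTo : ∀ t ∈ Set.Icc (0 : ℝ) 1, Set.MapsTo (φ t) (closure V) (closure V)
  zero : ∀ p ∈ closure V, φ 0 p = p
  cont : ContinuousOn (fun q : ℝ × E4 => φ q.1 q.2) (Set.Icc (0 : ℝ) 1 ×ˢ closure V)
  lip : ∃ K : NNReal, LipschitzOnWith K (φ 1) (closure V)
  slide : ∀ t ∈ Set.Icc (0 : ℝ) 1, Set.MapsTo (φ t) (frontier V) (frontier V)
  close : ∀ t ∈ Set.Icc (0 : ℝ) 1, ∀ p ∈ A ∩ frontier V, dist (φ t p) p < δ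

/-- `G` is an `(η, δ, ν, L)`-sliding boundary of `Z`. -/
structure IsSlidingBoundary (e : Frame) (η δ ν L : ℝ) (G : Set E4) : Prop where
  closed : IsClosed G
  subset : G ⊆ frontier (U e η)
  deform : ∃ φ : ℝ → E4 → E4, IsSlidingDeformation (U e η) (frontier (U e η) ∩ Z e) δ φ ∧
    G = φ 1 '' (frontier (U e η) ∩ Z e)
  graph : ∀ i j : Fin 3, ∃ ξ : E4 → E4,
    (∀ z ∈ l e η ν i j, ξ z ∈ Q e i j ∧ ‖ξ z‖ < R1 η) ∧
    (∀ z ∈ l e η ν i j, ∀ w ∈ l e η ν i j, ‖ξ z - ξ w‖ ≤ L * ‖z - w‖) ∧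
    G ∩ tube e η ν i j = (fun z => z + ξ z) '' l e η ν i j

/-! ### The cycles and their projections -/

/-- The curve `l i j` (with `ν = 0`) as a path from `(1 - √η) a i` to `(1 - √η) b j`, parametrized
by the angle `θ ∈ [0, π/2]`: the point in the direction `cos θ a i + sin θ b j` at distance
`min (1 - η) ((1 - √η) / max (cos θ) (sin θ))` from the origin. -/
noncomputable def arc (e : Frame) (η : ℝ) (i j : Fin 3) (t : unitInterval) : E4 :=
  let θ : ℝ := Real.pi / 2 * t
  (min (1 - η) ((1 - √η) / max (Real.cos θ) (Real.sin θ))) •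
    (Real.cos θ • a e i + Real.sin θ • b e j)

/-- The cycle `z i j`, the sum of the curves `l k m` over `k ≠ i` and `m ≠ j`. -/
noncomputable def z (e : Frame) (η : ℝ) (i j : Fin 3) : OneChain E4 :=
  ∑ k ∈ Finset.univ.erase i, ∑ m ∈ Finset.univ.erase j, Finsupp.single (arc e η k m) 1

/-- The orthogonal projection to `Q i j`, in coordinates with respect to the orthonormal basis
`(x i, y j)` of `Q i j`. -/
noncomputable def q (e : Frame) (i j : Fin 3) (p : E4) : ℂ :=
  ⟨inner ℝ (x e i) p, inner ℝ (y e j) p⟩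

end YProd

/-!
The proof compares, in each plane `Q i j`, the filling of the projected deformed cycle with a union
of triangles with vertex `0`.

In `Q i j` the four curves `l k m`, `k ≠ i`, `m ≠ j`, project to the four quadrants; they join the
images of the points `c a k` (on the first axis) to those of the points `c b m` (on the second
axis), where `c = 1 - √η`. Away from the faces `⟨p, a k⟩ = c` and `⟨p, b m⟩ = c` of the domain the
deformed curve `k m` is a piece of the graph of `ξ k m` over `l k m`, so that it can be replaced by
a fine polygon from `c a k` to `c b m` with its other vertices on that graph. Because `ξ` has a
small Lipschitz constant, the vertices of the polygon follow each other in the order of their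
arguments (`SlidingFamily.isFan`), and the open triangles spanned by `0` and its edges are
disjoint. Off small boxes around the images of the parts of the curves in the faces, and off a
small neighbourhood of the graphs, the winding parity of the deformed cycle around a point is the
number of these triangles which contain the point (`SlidingFamily.sumPar_eq_triPar`), and a point
with odd winding parity lies in the filling (`mem_fillSupport_of_winding`).

Inside the boxes nothing is known about a deformed curve, except that it stays in the face. But the
two planes `Q i j` with `i ≠ k` see the face of `a k` from opposite sides: on the face, the two
projections differ by a translation by `√3 c` along the first axis, and its image is at the right
end of the projected domain in one plane and at the left end in the other one. Hence the two winding
parities add up to one (`SlidingFamily.sumPar_add`), and the two fillings together cover at least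
the area of the box. The parts of the two unions of triangles in the box lie, after the translation,
on opposite sides of the line through the images of `c a k` and of the next vertex
(`SlidingFamily.region_disjoint`), so that their total area is at most that of the box.

It follows that the total area of the triangles is at most that of the fillings, up to the area of
a neighbourhood of the graphs, which becomes arbitrarily small
(`SlidingFamily.sum_volume_region_le`).
On the other hand, this total area does not depend on `ξ`: a polygon is projected to four planes,
with the four choices of the signs of its coordinates, and in the sum of the determinants the terms
with components of `ξ` cancel (`sum_cross_q`, `SlidingFamily.sum_volume_region_congr`). For `ξ = 0`
the triangles fill the projections of the original cycles up to a small neighbourhood of the curves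
(`enclosedArea_le`).
-/

open scoped BigOperators

namespace YProd

open Set MeasureTheory

/-! ### The parity of the winding of a path around a point -/

/-- `g` is a branch of the argument of `γ - p` on `S`. -/
def IsArgLift {X : Type*} [TopologicalSpace X] (p : ℂ) (γ : X → ℂ) (S : Set X) (g : X → ℝ) :
    Prop :=
  ContinuousOn g S ∧ ∀ x ∈ S, ∃ m : ℤ, g x = (γ x - p).arg + 2 * Real.pi * m

/-- The parity of the integer `n` for which the argument of `γ - p` grows along `γ`, from time `s`
to time `t`, by the difference of its principal values at the two end points plus `2πn`. The
value is `0` if the argument has no continuous branch. -/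
noncomputable def par (p : ℂ) (γ : ℝ → ℂ) (s t : ℝ) : ZMod 2 :=
  open Classical in
  if h : ∃ g : ℝ → ℝ, IsArgLift p γ (uIcc s t) g then
    ((round ((h.choose t - h.choose s - ((γ t - p).arg - (γ s - p).arg)) / (2 * Real.pi)) : ℤ) :
      ZMod 2)
  else 0

theorem exists_argLift {X : Type*} [TopologicalSpace X] [SimplyConnectedSpace X]
    [LocallyPathConnectedSpace X] {p : ℂ} {γ : X → ℂ} (hγ : Continuous γ) (hp : ∀ x, γ x ≠ p) :
    ∃ g : X → ℝ, Continuous g ∧ ∀ x, ∃ m : ℤ, g x = (γ x - p).arg + 2 * Real.pi * m := by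
  have hne : ∀ x, γ x - p ≠ 0 := fun x => sub_ne_zero.2 (hp x)
  have hn : ∀ x, (‖γ x - p‖ : ℝ) ≠ 0 := fun x => norm_ne_zero_iff.2 (hne x)
  have hmem : ∀ x, ‖(γ x - p) / (‖γ x - p‖ : ℂ)‖ = 1 := fun x => by
    simp [sub_eq_zero, hp x]
  let f : C(X, Circle) := ⟨fun x => ⟨(γ x - p) / (‖γ x - p‖ : ℂ), by
      simpa [Submonoid.unitSphere] using hmem x⟩, by
    refine Continuous.subtype_mk ?_ _
    refine (hγ.sub continuous_const).div
      (Complex.continuous_ofReal.comp (hγ.sub continuous_const).norm) fun x => ?_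
    exact_mod_cast hn x⟩
  have harg : ∀ x, ((f x : Circle) : ℂ).arg = (γ x - p).arg := by
    intro x
    have h1 : ((f x : Circle) : ℂ) = ((‖γ x - p‖⁻¹ : ℝ) : ℂ) * (γ x - p) := by
      change (γ x - p) / (‖γ x - p‖ : ℂ) = _
      rw [div_eq_inv_mul]; push_cast; rfl
    rw [h1, Complex.arg_real_mul _ (by have := hne x; positivity)]
  obtain ⟨x₀⟩ : Nonempty X := inferInstance
  obtain ⟨F, ⟨-, hF⟩, -⟩ := Circle.isCoveringMap_exp.existsUnique_continuousMap_lifts f x₀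
    ((f x₀ : Circle) : ℂ).arg (Circle.exp_arg _)
  refine ⟨F, F.continuous, fun x => ?_⟩
  have h1 : Circle.exp (F x) = f x := congrFun hF x
  rw [← Circle.exp_arg (f x), Circle.exp_eq_exp] at h1
  obtain ⟨m, hm⟩ := h1
  exact ⟨m, by rw [hm, harg x]; ring⟩

theorem exists_argLift_Icc {p : ℂ} {γ : ℝ → ℂ} {a b : ℝ} (hab : a ≤ b)
    (hγ : ContinuousOn γ (Icc a b)) (hp : ∀ x ∈ Icc a b, γ x ≠ p) :
    ∃ g : ℝ → ℝ, IsArgLift p γ (Icc a b) g := by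
  have hc : Continuous fun x : ℝ => γ (projIcc a b hab x) :=
    (continuousOn_iff_continuous_domRestrict.1 hγ).comp continuous_projIcc
  obtain ⟨g, hg, hg'⟩ := exists_argLift (p := p) hc fun x => hp _ (projIcc a b hab x).2
  refine ⟨g, hg.continuousOn, fun x hx => ?_⟩
  obtain ⟨m, hm⟩ := hg' x
  exact ⟨m, by rw [hm, projIcc_of_mem hab hx]⟩

theorem IsArgLift.mono {X : Type*} [TopologicalSpace X] {p : ℂ} {γ : X → ℂ} {S S' : Set X}
    {g : X → ℝ} (h : IsArgLift p γ S g) (hS : S' ⊆ S) : IsArgLift p γ S' g :=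
  ⟨h.1.mono hS, fun x hx => h.2 x (hS hx)⟩

/-- Two branches of the argument differ by a constant. -/
theorem IsArgLift.sub_eq {p : ℂ} {γ : ℝ → ℂ} {s t : ℝ} {g g' : ℝ → ℝ}
    (h : IsArgLift p γ (uIcc s t) g) (h' : IsArgLift p γ (uIcc s t) g') :
    g t - g s = g' t - g' s := by
  have hpi : (2 * Real.pi) ≠ 0 := by positivity
  have hmaps : MapsTo (fun x => (g x - g' x) / (2 * Real.pi)) (uIcc s t)
      (range ((↑) : ℤ → ℝ)) := by
    intro x hx
    obtain ⟨m, hm⟩ := h.2 x hx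
    obtain ⟨m', hm'⟩ := h'.2 x hx
    refine ⟨m - m', ?_⟩
    simp only [hm, hm']; push_cast; field_simp; ring
  have hd : IsDiscrete (range ((↑) : ℤ → ℝ)) :=
    Int.isClosedEmbedding_coe_real.isEmbedding.isDiscrete_range
  obtain ⟨y, -, hy⟩ := isPreconnected_uIcc.eqOn_const_of_mapsTo hd
    ((h.1.sub h'.1).div_const _) hmaps ⟨(g s - g' s) / (2 * Real.pi), hmaps left_mem_uIcc⟩
  have h1 := hy (left_mem_uIcc : s ∈ uIcc s t)
  have h2 := hy (right_mem_uIcc : t ∈ uIcc s t)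
  simp only [Function.const] at h1 h2
  have h3 := h1.trans h2.symm
  rw [div_left_inj' hpi] at h3
  simp only [Pi.sub_apply] at h3
  linarith

theorem par_eq {p : ℂ} {γ : ℝ → ℂ} {s t : ℝ} {g : ℝ → ℝ} (h : IsArgLift p γ (uIcc s t) g) {n : ℤ}
    (hn : g t - g s = (γ t - p).arg - (γ s - p).arg + 2 * Real.pi * n) :
    par p γ s t = (n : ZMod 2) := by
  have hex : ∃ g : ℝ → ℝ, IsArgLift p γ (uIcc s t) g := ⟨g, h⟩
  have hpi : (2 * Real.pi) ≠ 0 := by positivity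
  rw [par, dif_pos hex, hex.choose_spec.sub_eq h, hn]
  congr 1
  rw [add_sub_cancel_left, mul_div_cancel_left₀ _ hpi, round_intCast]

theorem IsArgLift.exists_int {p : ℂ} {γ : ℝ → ℂ} {s t : ℝ} {g : ℝ → ℝ}
    (h : IsArgLift p γ (uIcc s t) g) :
    ∃ n : ℤ, g t - g s = (γ t - p).arg - (γ s - p).arg + 2 * Real.pi * n := by
  obtain ⟨m, hm⟩ := h.2 t right_mem_uIcc
  obtain ⟨m', hm'⟩ := h.2 s left_mem_uIcc
  exact ⟨m - m', by rw [hm, hm']; push_cast; ring⟩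

theorem par_congr_sub {p p' : ℂ} {γ γ' : ℝ → ℂ} {s t : ℝ}
    (h : ∀ x ∈ uIcc s t, γ x - p = γ' x - p') : par p γ s t = par p' γ' s t := by
  have key : ∀ g, IsArgLift p γ (uIcc s t) g ↔ IsArgLift p' γ' (uIcc s t) g := fun g =>
    and_congr_right fun _ => forall₂_congr fun x hx => by rw [h x hx]
  by_cases hex : ∃ g : ℝ → ℝ, IsArgLift p γ (uIcc s t) g
  · obtain ⟨g, hg⟩ := hex
    obtain ⟨n, hn⟩ := hg.exists_int
    rw [par_eq hg hn, par_eq ((key g).1 hg) (n := n)]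
    rw [hn, h s left_mem_uIcc, h t right_mem_uIcc]
  · rw [par, dif_neg hex, par, dif_neg]
    rintro ⟨g, hg⟩
    exact hex ⟨g, (key g).2 hg⟩

theorem par_congr {p : ℂ} {γ γ' : ℝ → ℂ} {s t : ℝ} (h : EqOn γ γ' (uIcc s t)) :
    par p γ s t = par p γ' s t :=
  par_congr_sub fun x hx => by rw [h hx]

theorem par_add {p : ℂ} {γ : ℝ → ℂ} {a b : ℝ} (hγ : ContinuousOn γ (Icc a b))
    (hp : ∀ x ∈ Icc a b, γ x ≠ p) {s t u : ℝ} (hs : s ∈ Icc a b) (ht : t ∈ Icc a b)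
    (hu : u ∈ Icc a b) : par p γ s t + par p γ t u = par p γ s u := by
  obtain ⟨g, hg⟩ := exists_argLift_Icc (hs.1.trans hs.2) hγ hp
  have h1 := hg.mono (uIcc_subset_Icc hs ht)
  have h2 := hg.mono (uIcc_subset_Icc ht hu)
  have h3 := hg.mono (uIcc_subset_Icc hs hu)
  obtain ⟨n, hn⟩ := h1.exists_int
  obtain ⟨m, hm⟩ := h2.exists_int
  rw [par_eq h1 hn, par_eq h2 hm, par_eq h3 (n := n + m)]
  · push_cast; rfl
  · push_cast; linarith

theorem par_comp {p : ℂ} {γ f : _} {a b A B : ℝ} (hf : ContinuousOn f (uIcc a b))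
    (hfm : MapsTo f (uIcc a b) (Icc A B)) (hγ : ContinuousOn γ (Icc A B))
    (hp : ∀ x ∈ Icc A B, γ x ≠ p) :
    par p (fun x : ℝ => γ (f x)) a b = par p γ (f a) (f b) := by
  have ha := hfm left_mem_uIcc
  have hb := hfm right_mem_uIcc
  obtain ⟨g, hg⟩ := exists_argLift_Icc (ha.1.trans ha.2) hγ hp
  have h1 : IsArgLift p (fun x : ℝ => γ (f x)) (uIcc a b) fun x => g (f x) :=
    ⟨hg.1.comp hf hfm, fun x hx => hg.2 _ (hfm hx)⟩
  have h2 := hg.mono (uIcc_subset_Icc ha hb)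
  obtain ⟨n, hn⟩ := h2.exists_int
  rw [par_eq h1 hn, par_eq h2 hn]

/-- `1` if `z` lies below the horizontal line through `p`, and `0` otherwise. This is the parity of
the number of jumps of the principal argument of `· - p` on the way from `z` to the left of `p`,
with the convention `arg = π` on the ray to the left of `p`. -/
noncomputable def side (p z : ℂ) : ZMod 2 := if (z - p).im < 0 then 1 else 0

theorem par_of_avoid_left {p : ℂ} {γ : ℝ → ℂ} {s t : ℝ} (hγ : ContinuousOn γ (uIcc s t))
    (h : ∀ x ∈ uIcc s t, (γ x).im = p.im → p.re < (γ x).re) : par p γ s t = 0 := by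
  have h1 : IsArgLift p γ (uIcc s t) fun x => (γ x - p).arg := by
    refine ⟨fun x hx => ?_, fun x _ => ⟨0, by simp⟩⟩
    refine (Complex.continuousAt_arg ?_).comp_continuousWithinAt ((hγ x hx).sub
      continuousWithinAt_const)
    rw [Complex.mem_slitPlane_iff]
    by_cases him : (γ x).im = p.im
    · left; simpa using h x hx him
    · right; simpa [sub_eq_zero] using him
  rw [par_eq h1 (n := 0) (by simp)]; simp

theorem par_of_avoid_right {p : ℂ} {γ : ℝ → ℂ} {s t : ℝ} (hγ : ContinuousOn γ (uIcc s t))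
    (h : ∀ x ∈ uIcc s t, (γ x).im = p.im → (γ x).re < p.re) :
    par p γ s t = side p (γ s) + side p (γ t) := by
  have hne : ∀ x ∈ uIcc s t, γ x - p ≠ 0 := by
    intro x hx h0
    rw [sub_eq_zero] at h0
    have := h x hx (by rw [h0]); rw [h0] at this; exact lt_irrefl _ this
  have harg : ∀ x ∈ uIcc s t, (-(γ x - p)).arg + Real.pi =
      (γ x - p).arg + 2 * Real.pi * (if (γ x - p).im < 0 then 1 else 0 : ℤ) := by
    intro x hx
    by_cases him : (γ x - p).im < 0
    · rw [Complex.arg_neg_eq_arg_add_pi_of_im_neg him, if_pos him]; push_cast; ring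
    · rw [if_neg him, Complex.arg_neg_eq_arg_sub_pi_iff.2]
      · push_cast; ring
      · rcases (not_lt.1 him).lt_or_eq with h1 | h1
        · exact Or.inl h1
        · refine Or.inr ⟨h1.symm, ?_⟩
          have := h x hx (by simpa [sub_eq_zero] using h1.symm)
          simpa using this
  have h1 : IsArgLift p γ (uIcc s t) fun x => (-(γ x - p)).arg + Real.pi := by
    refine ⟨fun x hx => ?_, fun x hx => ⟨_, harg x hx⟩⟩
    refine ContinuousWithinAt.add ?_ continuousWithinAt_const
    refine (Complex.continuousAt_arg ?_).comp_continuousWithinAt ((hγ x hx).sub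
      continuousWithinAt_const).neg
    rw [Complex.mem_slitPlane_iff]
    by_cases him : (γ x).im = p.im
    · left; simpa using h x hx him
    · right; simpa [sub_eq_zero, eq_comm] using him
  rw [par_eq h1 (n := (if (γ t - p).im < 0 then 1 else 0) - (if (γ s - p).im < 0 then 1 else 0))]
  · simp only [side]; split_ifs <;> decide
  · rw [harg t right_mem_uIcc, harg s left_mem_uIcc]; push_cast; ring

/-- Around a point outside a convex set, the parity of a path in this set depends on the end
points of the path only, and in an additive way: the set misses one of the two horizontal rays
which start at the point. -/
theorem exists_par_eq_of_convex {p : ℂ} {K : Set ℂ} (hK : Convex ℝ K) (hp : p ∉ K) :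
    ∃ e : ℂ → ZMod 2, ∀ (γ : ℝ → ℂ) (s t : ℝ), ContinuousOn γ (uIcc s t) →
      MapsTo γ (uIcc s t) K → par p γ s t = e (γ s) + e (γ t) := by
  by_cases h : ∀ z ∈ K, z.im = p.im → p.re < z.re
  · exact ⟨0, fun γ s t hγ hm => by
      simpa using par_of_avoid_left hγ fun x hx => h _ (hm hx)⟩
  · push Not at h
    obtain ⟨z, hz, hzi, hzr⟩ := h
    refine ⟨side p, fun γ s t hγ hm => par_of_avoid_right hγ fun x hx him => ?_⟩
    by_contra hlt
    push Not at hlt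
    apply hp
    have hseg : p ∈ segment ℝ z (γ x) := by
      rcases eq_or_lt_of_le (hzr.trans hlt) with heq | hlt'
      · have h1 : z = p := Complex.ext (le_antisymm hzr (hlt.trans heq.ge)) hzi
        rw [h1]; exact left_mem_segment _ _ _
      · have h0 : 0 < (γ x).re - z.re := by linarith
        refine ⟨((γ x).re - p.re) / ((γ x).re - z.re), (p.re - z.re) / ((γ x).re - z.re),
          div_nonneg (by linarith) h0.le, div_nonneg (by linarith) h0.le, by field_simp; ring, ?_⟩
        apply Complex.ext
        · rw [Complex.add_re, Complex.real_smul, Complex.real_smul, Complex.re_ofReal_mul,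
            Complex.re_ofReal_mul]
          field_simp; ring
        · rw [Complex.add_im, Complex.real_smul, Complex.real_smul, Complex.im_ofReal_mul,
            Complex.im_ofReal_mul, hzi, him]
          field_simp; ring
    exact hK.segment_subset hz (hm hx) hseg

/-- The reflection of the plane in the diagonal. -/
noncomputable def swap (z : ℂ) : ℂ := ⟨z.im, z.re⟩

theorem par_swap (p : ℂ) : ∃ e : ℂ → ZMod 2, ∀ (γ : ℝ → ℂ) (s t : ℝ),
    ContinuousOn γ (uIcc s t) → (∀ x ∈ uIcc s t, γ x ≠ p) →
      par (swap p) (fun x => swap (γ x)) s t = par p γ s t + e (γ s) + e (γ t) := by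
  have hpi : (0:ℝ) < Real.pi := Real.pi_pos
  have hsw : ∀ z : ℂ, z ≠ 0 → ∃ m : ℤ, (swap z).arg = Real.pi / 2 - z.arg + 2 * Real.pi * m := by
    intro z hz
    have h1 : swap z = Complex.I * (starRingEnd ℂ) z := by
      apply Complex.ext <;> simp [swap]
    have h2 : ((swap z).arg : Real.Angle) = ((Real.pi / 2 - z.arg : ℝ) : Real.Angle) := by
      rw [h1, Complex.arg_mul_coe_angle Complex.I_ne_zero (by simpa using hz), Complex.arg_I,
        Complex.arg_conj_coe_angle, Real.Angle.coe_sub, sub_eq_add_neg]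
    obtain ⟨k, hk⟩ := Real.Angle.angle_eq_iff_two_pi_dvd_sub.1 h2
    exact ⟨k, by linarith⟩
  choose! m hm using hsw
  have hsub : ∀ z, swap z - swap p = swap (z - p) := fun z => by
    apply Complex.ext <;> simp [swap]
  refine ⟨fun z => (m (z - p) : ZMod 2), fun γ s t hγ hp => ?_⟩
  have hne : ∀ x ∈ uIcc s t, γ x - p ≠ 0 := fun x hx => sub_ne_zero.2 (hp x hx)
  obtain ⟨g, hg⟩ := exists_argLift_Icc min_le_max hγ hp
  replace hg : IsArgLift p γ (uIcc s t) g := hg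
  obtain ⟨n, hn⟩ := hg.exists_int
  have h1 : IsArgLift (swap p) (fun x => swap (γ x)) (uIcc s t) fun x => Real.pi / 2 - g x := by
    refine ⟨continuousOn_const.sub hg.1, fun x hx => ?_⟩
    obtain ⟨k, hk⟩ := hg.2 x hx
    refine ⟨-k - m (γ x - p), ?_⟩
    rw [hsub, hm _ (hne x hx)]; simp only [hk]; push_cast; ring
  rw [par_eq hg hn, par_eq h1 (n := -n - m (γ t - p) + m (γ s - p))]
  · push_cast
    have : ∀ a b c : ZMod 2, -a - b + c = a + c + b := by decide
    exact this _ _ _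
  · rw [hsub, hsub, hm _ (hne t right_mem_uIcc), hm _ (hne s left_mem_uIcc)]
    push_cast; linarith

/-! ### The winding parity of singular chains -/

/-- The winding parity around `p` of a path parametrized by the unit interval. -/
noncomputable def unitPar (p : ℂ) (γ : unitInterval → ℂ) : ZMod 2 :=
  par p (fun t => γ (projIcc 0 1 zero_le_one t)) 0 1

/-- The sum of the winding parities around `p` of the paths of a 1-chain. It does not depend on
the branch of the argument if the chain is a cycle. -/
noncomputable def winding (p : ℂ) : OneChain ℂ →ₗ[ZMod 2] ZMod 2 :=
  Finsupp.linearCombination (ZMod 2) (unitPar p)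

theorem winding_single (p : ℂ) (γ : unitInterval → ℂ) (r : ZMod 2) :
    winding p (Finsupp.single γ r) = r * unitPar p γ := by
  simp [winding]

/-- A parametrization of the standard 2-simplex by the unit square which collapses one side. -/
noncomputable def squareToSimplex (v : ℝ × ℝ) : stdSimplex ℝ (Fin 3) :=
  ⟨![1 - (projIcc (0:ℝ) 1 zero_le_one v.1 : ℝ),
      (projIcc (0:ℝ) 1 zero_le_one v.1 : ℝ) * (1 - (projIcc (0:ℝ) 1 zero_le_one v.2 : ℝ)),
      (projIcc (0:ℝ) 1 zero_le_one v.1 : ℝ) * (projIcc (0:ℝ) 1 zero_le_one v.2 : ℝ)], by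
    have h1 := (projIcc (0:ℝ) 1 zero_le_one v.1).2
    have h2 := (projIcc (0:ℝ) 1 zero_le_one v.2).2
    constructor
    · intro i
      fin_cases i
      · exact sub_nonneg.2 h1.2
      · exact mul_nonneg h1.1 (sub_nonneg.2 h2.2)
      · exact mul_nonneg h1.1 h2.1
    · simp [Fin.sum_univ_three]; ring⟩

theorem continuous_squareToSimplex : Continuous squareToSimplex := by
  have h1 : Continuous fun v : ℝ × ℝ => (projIcc (0:ℝ) 1 zero_le_one v.1 : ℝ) :=
    continuous_subtype_val.comp (continuous_projIcc.comp continuous_fst)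
  have h2 : Continuous fun v : ℝ × ℝ => (projIcc (0:ℝ) 1 zero_le_one v.2 : ℝ) :=
    continuous_subtype_val.comp (continuous_projIcc.comp continuous_snd)
  refine Continuous.subtype_mk (continuous_pi fun i => ?_) _
  fin_cases i
  · exact continuous_const.sub h1
  · exact h1.mul (continuous_const.sub h2)
  · exact h1.mul h2

theorem edge_eq_squareToSimplex (t : unitInterval) :
    edge 0 1 t = squareToSimplex (t, 0) ∧ edge 1 2 t = squareToSimplex (1, t) ∧
      edge 0 2 t = squareToSimplex (t, 1) := by
  refine ⟨?_, ?_, ?_⟩ <;> apply Subtype.ext <;> funext i <;> fin_cases i <;>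
    simp [edge, squareToSimplex]

/-- The boundary of a singular simplex does not wind around a point which the simplex misses. -/
theorem unitPar_simplex {p : ℂ} (s : C(stdSimplex ℝ (Fin 3), ℂ)) (hp : p ∉ range s) :
    unitPar p (fun t => s (edge 1 2 t)) + unitPar p (fun t => s (edge 0 2 t)) +
      unitPar p (fun t => s (edge 0 1 t)) = 0 := by
  obtain ⟨g, hg, hg'⟩ := exists_argLift (p := p) (s.continuous.comp continuous_squareToSimplex)
    fun v h => hp ⟨_, h⟩
  have key : ∀ (ε : unitInterval → stdSimplex ℝ (Fin 3)) (f : ℝ → ℝ × ℝ), Continuous f →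
      (∀ t : unitInterval, ε t = squareToSimplex (f t)) → ∀ n : ℤ,
      (g (f 1) - g (f 0) = (s (squareToSimplex (f 1)) - p).arg -
        (s (squareToSimplex (f 0)) - p).arg + 2 * Real.pi * n) →
      unitPar p (fun t => s (ε t)) = n := by
    intro ε f hf hε n hn
    have h1 : IsArgLift p (fun t => s (ε (projIcc 0 1 zero_le_one t))) (uIcc 0 1)
        fun t => g (f t) := by
      refine ⟨(hg.comp hf).continuousOn, fun x hx => ?_⟩
      rw [uIcc_of_le zero_le_one] at hx
      beta_reduce
      rw [projIcc_of_mem zero_le_one hx, hε]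
      exact hg' _
    refine par_eq h1 ?_
    simp only [projIcc_left, projIcc_right, hε]
    exact hn
  obtain ⟨a, ha⟩ := hg' (0, 0)
  obtain ⟨b, hb⟩ := hg' (1, 0)
  obtain ⟨c, hc⟩ := hg' (1, 1)
  have h01 : squareToSimplex (0, 1) = squareToSimplex (0, 0) := by
    apply Subtype.ext; funext i; fin_cases i <;> simp [squareToSimplex]
  obtain ⟨d, hd⟩ := hg' (0, 1)
  have hconst : g (0, 1) = g (0, 0) := by
    have h1 : IsArgLift (s (squareToSimplex (0, 0)) - 1) (fun _ : ℝ => s (squareToSimplex (0, 0)))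
        (uIcc 0 1) fun _ => 0 :=
      ⟨continuousOn_const, fun x _ => ⟨0, by simp⟩⟩
    have hcol : ∀ t : ℝ, squareToSimplex (0, t) = squareToSimplex (0, 0) := fun t => by
      apply Subtype.ext; funext i; fin_cases i <;> simp [squareToSimplex]
    have h2 : IsArgLift p (fun _ : ℝ => s (squareToSimplex (0, 0))) (uIcc 0 1)
        fun t => g (0, t) := by
      refine ⟨(hg.comp (by fun_prop)).continuousOn, fun x _ => ?_⟩
      have := hg' (0, x)
      simp only [Function.comp, hcol x] at this
      exact this
    have h3 : IsArgLift p (fun _ : ℝ => s (squareToSimplex (0, 0))) (uIcc 0 1)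
        fun _ => (s (squareToSimplex (0, 0)) - p).arg :=
      ⟨continuousOn_const, fun x _ => ⟨0, by simp⟩⟩
    have := h2.sub_eq h3
    simp only [sub_self] at this
    linarith
  simp only [Function.comp] at ha hb hc
  rw [key (edge 1 2) (fun t => (1, t)) (by fun_prop)
      (fun t => (edge_eq_squareToSimplex t).2.1) (c - b) (by
        simp only [hb, hc]; push_cast; ring),
    key (edge 0 2) (fun t => (t, 1)) (by fun_prop)
      (fun t => (edge_eq_squareToSimplex t).2.2) (c - a) (by
        simp only [hc, hconst, ha, h01]; push_cast; ring),
    key (edge 0 1) (fun t => (t, 0)) (by fun_prop)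
      (fun t => (edge_eq_squareToSimplex t).1) (b - a) (by
        simp only [hb, ha]; push_cast; ring)]
  push_cast
  have : ∀ a b c : ZMod 2, c - b + (c - a) + (b - a) = 0 := by decide
  exact this _ _ _

theorem winding_bdry {p : ℂ} (c : TwoChain ℂ) (hp : p ∉ carrier c) : winding p (bdry c) = 0 := by
  rw [bdry, Finsupp.sum, map_sum]
  refine Finset.sum_eq_zero fun s hs => ?_
  rw [map_add, map_add, winding_single, winding_single, winding_single, ← mul_add, ← mul_add,
    unitPar_simplex s, mul_zero]
  exact fun h => hp (mem_iUnion₂.2 ⟨s, hs, h⟩)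

/-- A point around which a 1-chain winds an odd number of times is met by each filling. -/
theorem mem_fillSupport_of_winding {p : ℂ} {σ : OneChain ℂ} (h : winding p σ ≠ 0) :
    p ∈ fillSupport σ := by
  intro c hc
  by_contra hp
  exact h (hc ▸ winding_bdry c hp)

theorem isClosed_fillSupport (σ : OneChain ℂ) : IsClosed (fillSupport σ) := by
  have : fillSupport σ = ⋂ (c : TwoChain ℂ) (_ : bdry c = σ), carrier c := by
    ext p; simp [fillSupport]
  rw [this]
  exact isClosed_iInter fun c => isClosed_iInter fun _ =>
    (Finset.finite_toSet c.support).isClosed_biUnion fun s _ =>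
      (isCompact_range s.continuous).isClosed

/-! ### Cones over cycles -/

theorem bdry_add {X : Type*} [TopologicalSpace X] (c d : TwoChain X) :
    bdry (c + d) = bdry c + bdry d := by
  refine Finsupp.sum_add_index' (fun s => by simp) fun s r r' => ?_
  simp only [Finsupp.single_add]; abel

theorem bdry_sum {X ι : Type*} [TopologicalSpace X] (S : Finset ι) (c : ι → TwoChain X) :
    bdry (∑ i ∈ S, c i) = ∑ i ∈ S, bdry (c i) := by
  classical
  induction S using Finset.induction_on with
  | empty => simp [bdry]
  | insert i S hi ih => rw [Finset.sum_insert hi, Finset.sum_insert hi, bdry_add, ih]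

theorem bdry_single {X : Type*} [TopologicalSpace X] (s : C(stdSimplex ℝ (Fin 3), X)) :
    bdry (Finsupp.single s 1) = Finsupp.single (fun t => s (edge 1 2 t)) 1 +
      Finsupp.single (fun t => s (edge 0 2 t)) 1 + Finsupp.single (fun t => s (edge 0 1 t)) 1 := by
  rw [bdry, Finsupp.sum_single_index]; simp

/-- The cone with vertex `0` over a path. -/
noncomputable def coneSimplex (γ : C(unitInterval, ℂ)) : C(stdSimplex ℝ (Fin 3), ℂ) where
  toFun x := ((x.1 1 + x.1 2 : ℝ) : ℂ) *
    γ (projIcc 0 1 zero_le_one (x.1 2 / (x.1 1 + x.1 2)))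
  continuous_toFun := by
    have hc : ∀ i, Continuous fun x : stdSimplex ℝ (Fin 3) => x.1 i := fun i =>
      (continuous_apply i).comp continuous_subtype_val
    rw [continuous_iff_continuousAt]
    intro x
    by_cases hx : x.1 1 + x.1 2 = 0
    · obtain ⟨C, hC⟩ := isCompact_univ.exists_bound_of_continuousOn γ.continuous.continuousOn
      have h0 : Filter.Tendsto (fun x : stdSimplex ℝ (Fin 3) => |x.1 1 + x.1 2| * C) (nhds x)
          (nhds 0) := by
        have : Continuous fun x : stdSimplex ℝ (Fin 3) => |x.1 1 + x.1 2| * C :=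
          ((hc 1).add (hc 2)).abs.mul continuous_const
        simpa [hx] using this.tendsto x
      rw [ContinuousAt, hx]
      simp only [Complex.ofReal_zero, zero_mul]
      refine squeeze_zero_norm (fun y => ?_) h0
      rw [norm_mul, Complex.norm_real]
      exact mul_le_mul_of_nonneg_left (hC _ (mem_univ _)) (norm_nonneg _)
    · refine ContinuousAt.mul (Complex.continuous_ofReal.comp ((hc 1).add (hc 2))).continuousAt ?_
      refine γ.continuous.continuousAt.comp (continuous_projIcc.continuousAt.comp ?_)
      exact (hc 2).continuousAt.div ((hc 1).add (hc 2)).continuousAt hx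

theorem range_coneSimplex_subset (γ : C(unitInterval, ℂ)) :
    range (coneSimplex γ) ⊆ {p | ∃ r ∈ Icc (0:ℝ) 1, ∃ t, p = (r : ℂ) * γ t} := by
  rintro _ ⟨x, rfl⟩
  refine ⟨x.1 1 + x.1 2, ⟨add_nonneg (x.2.1 1) (x.2.1 2), ?_⟩, _, rfl⟩
  have h1 := x.2.2
  rw [Fin.sum_univ_three] at h1
  have := x.2.1 0
  linarith

theorem bdry_coneSimplex (γ : C(unitInterval, ℂ)) :
    bdry (Finsupp.single (coneSimplex γ) 1) = Finsupp.single (⇑γ) 1 +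
      Finsupp.single (fun t : unitInterval => (t : ℂ) * γ 1) 1 +
      Finsupp.single (fun t : unitInterval => (t : ℂ) * γ 0) 1 := by
  have h0 : projIcc (0:ℝ) 1 zero_le_one 0 = 0 := projIcc_left _
  have h1 : projIcc (0:ℝ) 1 zero_le_one 1 = 1 := projIcc_right _
  rw [bdry_single]
  congr 1
  · congr 1
    · congr 1
      funext t
      simp [coneSimplex, edge]
    · congr 1
      funext t
      by_cases ht : (t : ℝ) = 0
      · simp [coneSimplex, edge, ht]
      · simp [coneSimplex, edge, ht]
  · congr 1
    funext t
    simp [coneSimplex, edge]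

/-- The filling of a closed chain of four paths is contained in the cone over it. -/
theorem fillSupport_subset_cone {K M : Finset (Fin 3)} (hK : Even K.card) (hM : Even M.card)
    {γ : Fin 3 → Fin 3 → unitInterval → ℂ} (hγ : ∀ k m, Continuous (γ k m)) {A B : Fin 3 → ℂ}
    (h0 : ∀ k m, γ k m 0 = A k) (h1 : ∀ k m, γ k m 1 = B m) :
    fillSupport (∑ k ∈ K, ∑ m ∈ M, Finsupp.single (γ k m) 1) ⊆
      {p | ∃ k ∈ K, ∃ m ∈ M, ∃ r ∈ Icc (0:ℝ) 1, ∃ t, p = (r : ℂ) * γ k m t} := by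
  classical
  intro p hp
  let G : Fin 3 → Fin 3 → C(unitInterval, ℂ) := fun k m => ⟨γ k m, hγ k m⟩
  have hd : ∀ (n : ℕ) (τ : OneChain ℂ), Even n → n • τ = 0 := by
    rintro n τ ⟨m, rfl⟩
    rw [← two_mul, mul_nsmul]
    have h2 : ∀ τ : OneChain ℂ, 2 • τ = 0 := fun τ => by
      ext γ
      have : ∀ r : ZMod 2, 2 • r = 0 := by decide
      simpa using this (τ γ)
    rw [h2, nsmul_zero]
  have hb : bdry (∑ k ∈ K, ∑ m ∈ M, Finsupp.single (coneSimplex (G k m)) 1) =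
      ∑ k ∈ K, ∑ m ∈ M, Finsupp.single (γ k m) 1 := by
    simp only [bdry_sum, bdry_coneSimplex, Finset.sum_add_distrib]
    have e1 : ∑ k ∈ K, ∑ m ∈ M,
        Finsupp.single (fun t : unitInterval => (t : ℂ) * G k m 1) (1 : ZMod 2) = 0 := by
      have : ∀ k ∈ K, ∑ m ∈ M,
          Finsupp.single (fun t : unitInterval => (t : ℂ) * G k m 1) (1 : ZMod 2) =
          ∑ m ∈ M, Finsupp.single (fun t : unitInterval => (t : ℂ) * B m) (1 : ZMod 2) :=
        fun k _ => Finset.sum_congr rfl fun m _ => by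
          change Finsupp.single (fun t : unitInterval => (t : ℂ) * γ k m 1) (1 : ZMod 2) = _
          rw [h1]
      rw [Finset.sum_congr rfl this, Finset.sum_const, hd _ _ hK]
    have e0 : ∑ k ∈ K, ∑ m ∈ M,
        Finsupp.single (fun t : unitInterval => (t : ℂ) * G k m 0) (1 : ZMod 2) = 0 := by
      refine Finset.sum_eq_zero fun k _ => ?_
      have : ∀ m ∈ M, Finsupp.single (fun t : unitInterval => (t : ℂ) * G k m 0) (1 : ZMod 2) =
          Finsupp.single (fun t : unitInterval => (t : ℂ) * A k) (1 : ZMod 2) := fun m _ => by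
        change Finsupp.single (fun t : unitInterval => (t : ℂ) * γ k m 0) (1 : ZMod 2) = _
        rw [h0]
      rw [Finset.sum_congr rfl this, Finset.sum_const, hd _ _ hM]
    rw [e1, e0, add_zero, add_zero]
    rfl
  have := hp _ hb
  rw [carrier, mem_iUnion₂] at this
  obtain ⟨s, hs, hps⟩ := this
  obtain ⟨k, hk, hs⟩ := Finset.mem_biUnion.1 (Finsupp.support_finsetSum hs)
  obtain ⟨m, hm, hs⟩ := Finset.mem_biUnion.1 (Finsupp.support_finsetSum hs)
  have hs' := Finset.mem_singleton.1 (Finsupp.support_single_subset hs)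
  rw [hs'] at hps
  obtain ⟨r, hr, t, ht⟩ := range_coneSimplex_subset _ hps
  exact ⟨k, hk, m, hm, r, hr, t, ht⟩

/-! ### Lipschitz curves are null sets -/

theorem volume_image_lipschitz_curve {γ : ℝ → ℂ} {S : Set ℝ} {K : NNReal}
    (h : LipschitzOnWith K γ S) : volume (γ '' S) = 0 := by
  let e := Complex.equivRealProdCLM
  have h1 : dimH ((fun x => e (γ x)) '' S) ≤ 1 := by
    have hl : LipschitzOnWith (‖(e : ℂ →L[ℝ] ℝ × ℝ)‖₊ * K) (fun x => e (γ x)) S :=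
      (e : ℂ →L[ℝ] ℝ × ℝ).lipschitz.comp_lipschitzOnWith h
    calc dimH ((fun x => e (γ x)) '' S) ≤ dimH S := hl.dimH_image_le
      _ ≤ dimH (univ : Set ℝ) := dimH_mono (subset_univ _)
      _ = 1 := Real.dimH_univ
  have h2 : volume ((fun x => e (γ x)) '' S) = 0 := by
    refine measure_zero_of_dimH_lt (d := 2) ?_ (lt_of_le_of_lt h1 (by norm_num))
    have := hausdorffMeasure_prod_real
    simp only [NNReal.coe_ofNat]
    rw [this]
  have h3 := Complex.volume_preserving_equiv_real_prod.symm.measure_preimage_equiv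
    (γ '' S)
  rw [← h3]
  refine measure_mono_null ?_ h2
  rintro v ⟨x, hx, hxv⟩
  refine ⟨x, hx, ?_⟩
  simp only [hxv]
  exact Complex.measurableEquivRealProd.apply_symm_apply v

/-! ### Triangles -/

/-- The determinant of two vectors of the plane. -/
def cross (P Q : ℂ) : ℝ := P.re * Q.im - P.im * Q.re

/-- The open triangle with vertices `0`, `P`, `Q`. -/
def tri (P Q : ℂ) : Set ℂ :=
  {p | ∃ s t : ℝ, 0 < s ∧ 0 < t ∧ s + t < 1 ∧ p = s * P + t * Q}

/-- The closed triangle with vertices `0`, `P`, `Q`. -/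
def closedTri (P Q : ℂ) : Set ℂ :=
  {p | ∃ s t : ℝ, 0 ≤ s ∧ 0 ≤ t ∧ s + t ≤ 1 ∧ p = s * P + t * Q}

/-- The segment from `P` to `Q` as a path. -/
noncomputable def segPath (P Q : ℂ) (t : ℝ) : ℂ := (1 - t : ℝ) * P + t * Q

/-- The winding parity of the segment from `P` to `Q`. -/
noncomputable def segPar (p P Q : ℂ) : ZMod 2 := par p (segPath P Q) 0 1

theorem continuous_segPath (P Q : ℂ) : Continuous (segPath P Q) := by
  unfold segPath; fun_prop

@[simp] theorem segPath_zero (P Q : ℂ) : segPath P Q 0 = P := by simp [segPath]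

@[simp] theorem segPath_one (P Q : ℂ) : segPath P Q 1 = Q := by simp [segPath]

theorem segPath_mem {K : Set ℂ} (hK : Convex ℝ K) {P Q : ℂ} (hP : P ∈ K) (hQ : Q ∈ K) {t : ℝ}
    (ht : t ∈ Icc (0:ℝ) 1) : segPath P Q t ∈ K := by
  have := hK hP hQ (sub_nonneg.2 ht.2) ht.1 (sub_add_cancel _ _)
  simpa [segPath, Complex.real_smul] using this

theorem segPath_re (P Q : ℂ) (t : ℝ) : (segPath P Q t).re = (1 - t) * P.re + t * Q.re := by
  rw [segPath, Complex.add_re, Complex.re_ofReal_mul, Complex.re_ofReal_mul]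

theorem segPath_im (P Q : ℂ) (t : ℝ) : (segPath P Q t).im = (1 - t) * P.im + t * Q.im := by
  rw [segPath, Complex.add_im, Complex.im_ofReal_mul, Complex.im_ofReal_mul]

theorem segPar_of_same {p P Q : ℂ} (h : 0 < (P.im - p.im) * (Q.im - p.im)) :
    segPar p P Q = 0 := by
  refine par_of_avoid_left (continuous_segPath P Q).continuousOn fun t ht him => ?_
  rw [uIcc_of_le zero_le_one] at ht
  rw [segPath_im] at him
  exfalso
  have h1 : (1 - t) * (P.im - p.im) + t * (Q.im - p.im) = 0 := by linarith
  have h2 : (1 - t) * (P.im - p.im) ^ 2 + t * ((P.im - p.im) * (Q.im - p.im)) = 0 := by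
    linear_combination (P.im - p.im) * h1
  have h3 : 0 < (P.im - p.im) ^ 2 := by
    have : P.im - p.im ≠ 0 := fun h0 => by rw [h0] at h; simp at h
    positivity
  nlinarith [ht.1, ht.2, mul_nonneg (sub_nonneg.2 ht.2) h3.le, mul_nonneg ht.1 h.le,
    mul_pos h3 h]

theorem segPath_re_sub_mul {p P Q : ℂ} {t : ℝ} (him : (segPath P Q t).im = p.im) :
    ((segPath P Q t).re - p.re) * (Q.im - P.im) = cross (P - p) (Q - p) := by
  rw [segPath_im] at him
  rw [segPath_re, cross]
  simp only [Complex.sub_re, Complex.sub_im]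
  linear_combination (Q.re - P.re) * him

theorem segPar_of_right {p P Q : ℂ} (h : (P.im - p.im) * (Q.im - p.im) < 0)
    (h' : (P.im - p.im) * cross (P - p) (Q - p) < 0) : segPar p P Q = 0 := by
  refine par_of_avoid_left (continuous_segPath P Q).continuousOn fun t ht him => ?_
  have h1 := segPath_re_sub_mul him
  rw [← h1] at h'
  have h2 : (P.im - p.im) * (Q.im - P.im) < 0 := by nlinarith [sq_nonneg (P.im - p.im)]
  by_contra hle
  push Not at hle
  nlinarith [mul_nonneg (sub_nonneg.2 hle) (neg_nonneg.2 h2.le)]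

theorem segPar_of_left {p P Q : ℂ} (h : (P.im - p.im) * (Q.im - p.im) < 0)
    (h' : 0 < (P.im - p.im) * cross (P - p) (Q - p)) : segPar p P Q = 1 := by
  rw [segPar, par_of_avoid_right (continuous_segPath P Q).continuousOn]
  · rw [segPath_zero, segPath_one, side, side, Complex.sub_im, Complex.sub_im]
    by_cases h1 : P.im - p.im < 0
    · rw [if_pos h1, if_neg (by nlinarith), add_zero]
    · rw [if_neg h1, if_pos (by nlinarith), zero_add]
  · intro t ht him
    have h1 := segPath_re_sub_mul him
    rw [← h1] at h'
    have h2 : (P.im - p.im) * (Q.im - P.im) < 0 := by nlinarith [sq_nonneg (P.im - p.im)]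
    by_contra hle
    push Not at hle
    nlinarith [mul_nonneg (sub_nonneg.2 hle) (neg_nonneg.2 h2.le)]

theorem segPar_eq {p P Q : ℂ} (hP : p.im ≠ P.im) (hQ : p.im ≠ Q.im)
    (hc : cross (P - p) (Q - p) ≠ 0) : segPar p P Q =
      if (P.im < p.im ↔ p.im < Q.im) ∧ (p.im < P.im ↔ 0 < cross (P - p) (Q - p))
        then 1 else 0 := by
  rcases lt_or_gt_of_ne hP with aP | aP <;> rcases lt_or_gt_of_ne hQ with aQ | aQ
  · rw [segPar_of_same (mul_pos (sub_pos.2 aP) (sub_pos.2 aQ)), if_neg]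
    simp [aP.not_gt, aQ]
  · have h := mul_neg_of_pos_of_neg (sub_pos.2 aP) (sub_neg.2 aQ)
    rcases lt_or_gt_of_ne hc with hc | hc
    · rw [segPar_of_right h (mul_neg_of_pos_of_neg (sub_pos.2 aP) hc), if_neg]
      simp [aP, hc.not_gt]
    · rw [segPar_of_left h (mul_pos (sub_pos.2 aP) hc), if_pos]
      simp [aP, aP.not_gt, aQ.not_gt, hc]
  · have h := mul_neg_of_neg_of_pos (sub_neg.2 aP) (sub_pos.2 aQ)
    rcases lt_or_gt_of_ne hc with hc | hc
    · rw [segPar_of_left h (mul_pos_of_neg_of_neg (sub_neg.2 aP) hc), if_pos]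
      simp [aP, aP.not_gt, aQ, hc.not_gt]
    · rw [segPar_of_right h (mul_neg_of_neg_of_pos (sub_neg.2 aP) hc), if_neg]
      simp [aP.not_gt, hc]
  · rw [segPar_of_same (mul_pos_of_neg_of_neg (sub_neg.2 aP) (sub_neg.2 aQ)), if_neg]
    simp [aP, aQ.not_gt]

/-- The winding parity of the boundary of the triangle with vertices `0`, `P`, `Q`. -/
noncomputable def triPar (p P Q : ℂ) : ZMod 2 := segPar p P Q + segPar p 0 P + segPar p 0 Q

theorem convex_closedTri (P Q : ℂ) : Convex ℝ (closedTri P Q) := by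
  rintro _ ⟨s, t, hs, ht, hst, rfl⟩ _ ⟨s', t', hs', ht', hst', rfl⟩ α β hα hβ hαβ
  refine ⟨α * s + β * s', α * t + β * t', by positivity, by positivity, ?_, ?_⟩
  · nlinarith
  · simp only [Complex.real_smul]; push_cast; ring

theorem triPar_of_notMem {p P Q : ℂ} (h : p ∉ closedTri P Q) : triPar p P Q = 0 := by
  have hK := convex_closedTri P Q
  obtain ⟨e, he⟩ := exists_par_eq_of_convex hK h
  have h0 : (0:ℂ) ∈ closedTri P Q := ⟨0, 0, by norm_num⟩
  have hP : P ∈ closedTri P Q := ⟨1, 0, by norm_num⟩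
  have hQ : Q ∈ closedTri P Q := ⟨0, 1, by norm_num⟩
  have key : ∀ A ∈ closedTri P Q, ∀ B ∈ closedTri P Q, segPar p A B = e A + e B := by
    intro A hA B hB
    rw [segPar, he _ _ _ (continuous_segPath A B).continuousOn, segPath_zero, segPath_one]
    rw [uIcc_of_le zero_le_one]
    exact fun t ht => segPath_mem hK hA hB ht
  rw [triPar, key P hP Q hQ, key 0 h0 P hP, key 0 h0 Q hQ]
  have : ∀ a b c : ZMod 2, a + b + (c + a) + (c + b) = 0 := by decide
  exact this _ _ _

theorem triPar_of_mem {p P Q : ℂ} (h : p ∈ tri P Q) (hD : cross P Q ≠ 0) (h0 : p.im ≠ 0)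
    (hP : p.im ≠ P.im) (hQ : p.im ≠ Q.im) : triPar p P Q = 1 := by
  obtain ⟨s, t, hs, ht, hst, rfl⟩ := h
  set p : ℂ := s * P + t * Q with hp
  have him : p.im = s * P.im + t * Q.im := by simp [hp]
  have hre : p.re = s * P.re + t * Q.re := by simp [hp]
  have c1 : cross (P - p) (Q - p) = (1 - s - t) * cross P Q := by
    simp only [cross, Complex.sub_re, Complex.sub_im, him, hre]; ring
  have c2 : cross (0 - p) (P - p) = t * cross P Q := by
    simp only [cross, Complex.sub_re, Complex.sub_im, him, hre, Complex.zero_re,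
      Complex.zero_im]; ring
  have c3 : cross (0 - p) (Q - p) = -s * cross P Q := by
    simp only [cross, Complex.sub_re, Complex.sub_im, him, hre, Complex.zero_re,
      Complex.zero_im]; ring
  have hbal : s * (P.im - p.im) + t * (Q.im - p.im) + (1 - s - t) * (0 - p.im) = 0 := by
    linear_combination -him
  have hr : 0 < 1 - s - t := by linarith
  rw [triPar]
  have e0 : (0:ℂ).im = 0 := rfl
  rw [segPar_eq hP hQ (by rw [c1]; exact mul_ne_zero hr.ne' hD),
    segPar_eq h0 hP (by rw [c2]; exact mul_ne_zero ht.ne' hD),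
    segPar_eq h0 hQ (by rw [c3]; exact mul_ne_zero (neg_ne_zero.2 hs.ne') hD), c1, c2, c3, e0]
  have e1 : 0 < -s * cross P Q ↔ cross P Q < 0 := by
    rw [neg_mul, neg_pos]; exact ⟨fun h => by by_contra h'; push Not at h'; nlinarith,
      fun h => mul_neg_of_pos_of_neg hs h⟩
  simp only [mul_pos_iff_of_pos_left hr, mul_pos_iff_of_pos_left ht, e1]
  rcases lt_or_gt_of_ne h0 with a0 | a0 <;> rcases lt_or_gt_of_ne hP with aP | aP <;>
    rcases lt_or_gt_of_ne hQ with aQ | aQ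
  case inl.inl.inl => exfalso; nlinarith [mul_pos hs (sub_pos.2 aP), mul_pos ht (sub_pos.2 aQ)]
  case inr.inr.inr => exfalso; nlinarith [mul_pos hs (sub_pos.2 aP), mul_pos ht (sub_pos.2 aQ)]
  all_goals
    rcases lt_or_gt_of_ne hD with hD' | hD' <;>
      simp [a0, a0.not_gt, aP, aP.not_gt, aQ, aQ.not_gt, hD', hD'.not_gt]

/-- The linear map which sends `1` to `P` and `I` to `Q`. -/
noncomputable def frameMap (P Q : ℂ) : ℂ →ₗ[ℝ] ℂ where
  toFun z := z.re * P + z.im * Q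
  map_add' z w := by simp; ring
  map_smul' r z := by simp; ring

theorem det_frameMap (P Q : ℂ) : LinearMap.det (frameMap P Q) = cross P Q := by
  rw [← LinearMap.det_toMatrix Complex.basisOneI, Matrix.det_fin_two]
  simp [LinearMap.toMatrix_apply, frameMap, cross]; ring

theorem image_frameMap_tri (P Q : ℂ) : frameMap P Q '' tri 1 Complex.I = tri P Q := by
  ext p
  constructor
  · rintro ⟨_, ⟨s, t, hs, ht, hst, rfl⟩, rfl⟩
    exact ⟨s, t, hs, ht, hst, by simp [frameMap]⟩
  · rintro ⟨s, t, hs, ht, hst, rfl⟩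
    exact ⟨_, ⟨s, t, hs, ht, hst, rfl⟩, by simp [frameMap]⟩

theorem volume_tri (P Q : ℂ) :
    volume (tri P Q) = ENNReal.ofReal |cross P Q| * volume (tri 1 Complex.I) := by
  rw [← image_frameMap_tri, Measure.addHaar_image_linearMap, det_frameMap]

theorem volume_range_segPath (P Q : ℂ) : volume (segPath P Q '' Icc 0 1) = 0 := by
  have : LipschitzWith ‖Q - P‖₊ (segPath P Q) := by
    refine LipschitzWith.of_dist_le_mul fun s t => ?_
    rw [dist_eq_norm, Real.dist_eq]
    have : segPath P Q s - segPath P Q t = ((s - t : ℝ) : ℂ) * (Q - P) := by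
      simp only [segPath]; push_cast; ring
    rw [this, norm_mul, Complex.norm_real, mul_comm]; rfl
  exact volume_image_lipschitz_curve this.lipschitzOnWith

theorem volume_closedTri_le (P Q : ℂ) : volume (closedTri P Q) ≤ volume (tri P Q) := by
  have h : closedTri P Q ⊆ tri P Q ∪ (segPath P Q '' Icc 0 1 ∪ segPath 0 P '' Icc 0 1 ∪
      segPath 0 Q '' Icc 0 1) := by
    rintro _ ⟨s, t, hs, ht, hst, rfl⟩
    rcases hs.lt_or_eq with hs' | rfl
    · rcases ht.lt_or_eq with ht' | rfl
      · rcases hst.lt_or_eq with hst' | hst'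
        · exact Or.inl ⟨s, t, hs', ht', hst', rfl⟩
        · refine Or.inr (Or.inl (Or.inl ⟨t, ⟨ht, by linarith⟩, ?_⟩))
          rw [segPath, ← hst']; simp
      · exact Or.inr (Or.inl (Or.inr ⟨s, ⟨hs, by linarith⟩, by simp [segPath]⟩))
    · exact Or.inr (Or.inr ⟨t, ⟨ht, by linarith⟩, by simp [segPath]⟩)
  refine (measure_mono h).trans ((measure_union_le _ _).trans_eq ?_)
  rw [measure_union_null (measure_union_null (volume_range_segPath _ _)
    (volume_range_segPath _ _)) (volume_range_segPath _ _), add_zero]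

theorem measurableSet_tri {P Q : ℂ} (hD : cross P Q ≠ 0) : MeasurableSet (tri P Q) := by
  have : tri P Q = {p | 0 < cross p Q / cross P Q} ∩ {p | 0 < cross P p / cross P Q} ∩
      {p | cross p Q / cross P Q + cross P p / cross P Q < 1} := by
    ext p
    constructor
    · rintro ⟨s, t, hs, ht, hst, rfl⟩
      have e1 : cross P (s * P + t * Q) / cross P Q = t := by
        rw [div_eq_iff hD]; simp [cross]; ring
      have e2 : cross (s * P + t * Q) Q / cross P Q = s := by
        rw [div_eq_iff hD]; simp [cross]; ring
      simp only [mem_inter_iff, mem_ofPred_eq, e1, e2]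
      exact ⟨⟨hs, ht⟩, hst⟩
    · rintro ⟨⟨h1, h2⟩, h3⟩
      refine ⟨_, _, h1, h2, h3, ?_⟩
      apply Complex.ext
      · rw [Complex.add_re, Complex.re_ofReal_mul, Complex.re_ofReal_mul]
        field_simp; simp only [cross]; ring
      · rw [Complex.add_im, Complex.im_ofReal_mul, Complex.im_ofReal_mul]
        field_simp; simp only [cross]; ring
  have hc1 : Continuous fun p => cross p Q / cross P Q := by unfold cross; fun_prop
  have hc2 : Continuous fun p => cross P p / cross P Q := by unfold cross; fun_prop
  rw [this]
  exact (((isOpen_lt continuous_const hc1).inter (isOpen_lt continuous_const hc2)).inter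
    (isOpen_lt (hc1.add hc2) continuous_const)).measurableSet

theorem volume_im_eq (v : ℝ) : volume {z : ℂ | z.im = v} = 0 := by
  have h : {z : ℂ | z.im = v} ⊆ ⋃ n : ℕ, segPath ⟨-n, v⟩ ⟨n, v⟩ '' Icc 0 1 := by
    intro z hz
    obtain ⟨n, hn⟩ := exists_nat_gt |z.re|
    have hn0 : (0:ℝ) < n := (abs_nonneg _).trans_lt hn
    rw [abs_lt] at hn
    refine mem_iUnion.2
      ⟨n, (z.re + n) / (2 * n), ⟨div_nonneg (by linarith) (by positivity), ?_⟩, ?_⟩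
    · rw [div_le_one (by positivity)]; linarith
    · apply Complex.ext
      · rw [segPath_re]; field_simp; ring
      · rw [segPath_im]; rw [mem_ofPred_eq] at hz; rw [hz]; field_simp; ring
  exact measure_mono_null h (measure_iUnion_null fun n => volume_range_segPath _ _)

/-! ### Coordinates adapted to the cone -/

/-- The coordinate along `a k`. -/
noncomputable def cA (e : Frame) (k : Fin 3) (p : E4) : ℝ := inner ℝ (a e k) p

/-- The coordinate along `x k`. -/
noncomputable def cX (e : Frame) (k : Fin 3) (p : E4) : ℝ := inner ℝ (x e k) p

/-- The coordinate along `b m`. -/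
noncomputable def cB (e : Frame) (m : Fin 3) (p : E4) : ℝ := inner ℝ (b e m) p

/-- The coordinate along `y m`. -/
noncomputable def cY (e : Frame) (m : Fin 3) (p : E4) : ℝ := inner ℝ (y e m) p

/-- The frame with the two planes exchanged. -/
noncomputable def swapFrame (e : Frame) : Frame := e.reindex (Equiv.addRight 2)

theorem swapFrame_apply (e : Frame) :
    swapFrame e 0 = e 2 ∧ swapFrame e 1 = e 3 ∧ swapFrame e 2 = e 0 ∧ swapFrame e 3 = e 1 := by
  refine ⟨?_, ?_, ?_, ?_⟩ <;> simp only [swapFrame, OrthonormalBasis.reindex_apply] <;> rfl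

theorem a_swapFrame (e : Frame) (k : Fin 3) : a (swapFrame e) k = b e k := by
  simp [a, b, swapFrame_apply]

theorem b_swapFrame (e : Frame) (k : Fin 3) : b (swapFrame e) k = a e k := by
  simp [a, b, swapFrame_apply]

theorem x_swapFrame (e : Frame) (k : Fin 3) : x (swapFrame e) k = y e k := by
  simp [x, y, swapFrame_apply]

theorem y_swapFrame (e : Frame) (k : Fin 3) : y (swapFrame e) k = x e k := by
  simp [x, y, swapFrame_apply]

theorem cA_swapFrame (e : Frame) (k : Fin 3) : cA (swapFrame e) k = cB e k := by
  funext p; simp [cA, cB, a_swapFrame]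

theorem cB_swapFrame (e : Frame) (k : Fin 3) : cB (swapFrame e) k = cA e k := by
  funext p; simp [cA, cB, b_swapFrame]

theorem cX_swapFrame (e : Frame) (k : Fin 3) : cX (swapFrame e) k = cY e k := by
  funext p; simp [cX, cY, x_swapFrame]

theorem cY_swapFrame (e : Frame) (k : Fin 3) : cY (swapFrame e) k = cX e k := by
  funext p; simp [cX, cY, y_swapFrame]

theorem cA_eq (e : Frame) (k : Fin 3) (p : E4) :
    cA e k p = cs k * inner ℝ (e 0) p + sn k * inner ℝ (e 1) p := by
  simp [cA, a, inner_add_left, inner_smul_left]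

theorem cX_eq (e : Frame) (k : Fin 3) (p : E4) :
    cX e k p = -sn k * inner ℝ (e 0) p + cs k * inner ℝ (e 1) p := by
  simp [cX, x, inner_add_left, inner_smul_left]

theorem cB_eq (e : Frame) (k : Fin 3) (p : E4) :
    cB e k p = cs k * inner ℝ (e 2) p + sn k * inner ℝ (e 3) p := by
  simp [cB, b, inner_add_left, inner_smul_left]

theorem cY_eq (e : Frame) (k : Fin 3) (p : E4) :
    cY e k p = -sn k * inner ℝ (e 2) p + cs k * inner ℝ (e 3) p := by
  simp [cY, y, inner_add_left, inner_smul_left]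

theorem cs_sq_add_sn_sq (k : Fin 3) : cs k ^ 2 + sn k ^ 2 = 1 := by
  have : √(3:ℝ) ^ 2 = 3 := Real.sq_sqrt (by norm_num)
  fin_cases k <;> simp [cs, sn] <;> nlinarith

theorem norm_sq_eq (e : Frame) (k m : Fin 3) (p : E4) :
    ‖p‖ ^ 2 = cA e k p ^ 2 + cX e k p ^ 2 + cB e m p ^ 2 + cY e m p ^ 2 := by
  have h := e.sum_sq_norm_inner_right p
  rw [Fin.sum_univ_four] at h
  simp only [Real.norm_eq_abs, sq_abs] at h
  rw [← h, cA_eq, cX_eq, cB_eq, cY_eq]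
  linear_combination
    (-(inner ℝ (e 0) p ^ 2 + inner ℝ (e 1) p ^ 2)) * cs_sq_add_sn_sq k
      - (inner ℝ (e 2) p ^ 2 + inner ℝ (e 3) p ^ 2) * cs_sq_add_sn_sq m

/-- Turning the index by one step turns the frame of a plane by `2π/3`. -/
theorem cX_add_one (e : Frame) (k : Fin 3) (p : E4) :
    cX e (k + 1) p = -(√3 / 2) * cA e k p - 1 / 2 * cX e k p := by
  have : √(3:ℝ) ^ 2 = 3 := Real.sq_sqrt (by norm_num)
  rw [cX_eq, cX_eq, cA_eq]
  fin_cases k <;> simp [cs, sn] <;> ring_nf <;> simp only [this] <;> ring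

theorem cX_add_two (e : Frame) (k : Fin 3) (p : E4) :
    cX e (k + 2) p = √3 / 2 * cA e k p - 1 / 2 * cX e k p := by
  have : √(3:ℝ) ^ 2 = 3 := Real.sq_sqrt (by norm_num)
  rw [cX_eq, cX_eq, cA_eq]
  fin_cases k <;> simp [cs, sn] <;> ring_nf <;> simp only [this] <;> ring

theorem cA_add_one (e : Frame) (k : Fin 3) (p : E4) :
    cA e (k + 1) p = √3 / 2 * cX e k p - 1 / 2 * cA e k p := by
  have : √(3:ℝ) ^ 2 = 3 := Real.sq_sqrt (by norm_num)
  rw [cA_eq, cX_eq, cA_eq]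
  fin_cases k <;> simp [cs, sn] <;> ring_nf <;> simp only [this] <;> ring

theorem cA_add_two (e : Frame) (k : Fin 3) (p : E4) :
    cA e (k + 2) p = -(√3 / 2) * cX e k p - 1 / 2 * cA e k p := by
  have : √(3:ℝ) ^ 2 = 3 := Real.sq_sqrt (by norm_num)
  rw [cA_eq, cX_eq, cA_eq]
  fin_cases k <;> simp [cs, sn] <;> ring_nf <;> simp only [this] <;> ring

theorem cY_add_one (e : Frame) (k : Fin 3) (p : E4) :
    cY e (k + 1) p = -(√3 / 2) * cB e k p - 1 / 2 * cY e k p := by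
  simpa [cX_swapFrame, cA_swapFrame] using cX_add_one (swapFrame e) k p

theorem cY_add_two (e : Frame) (k : Fin 3) (p : E4) :
    cY e (k + 2) p = √3 / 2 * cB e k p - 1 / 2 * cY e k p := by
  simpa [cX_swapFrame, cA_swapFrame] using cX_add_two (swapFrame e) k p

theorem fin_three_cases (k k' : Fin 3) : k' = k ∨ k' = k + 1 ∨ k' = k + 2 := by
  revert k k'; decide

theorem cA_add (e : Frame) (k : Fin 3) (p p' : E4) : cA e k (p + p') = cA e k p + cA e k p' :=
  inner_add_right _ _ _
theorem cX_add (e : Frame) (k : Fin 3) (p p' : E4) : cX e k (p + p') = cX e k p + cX e k p' :=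
  inner_add_right _ _ _
theorem cB_add (e : Frame) (k : Fin 3) (p p' : E4) : cB e k (p + p') = cB e k p + cB e k p' :=
  inner_add_right _ _ _
theorem cY_add (e : Frame) (k : Fin 3) (p p' : E4) : cY e k (p + p') = cY e k p + cY e k p' :=
  inner_add_right _ _ _
theorem cA_sub (e : Frame) (k : Fin 3) (p p' : E4) : cA e k (p - p') = cA e k p - cA e k p' :=
  inner_sub_right _ _ _
theorem cX_sub (e : Frame) (k : Fin 3) (p p' : E4) : cX e k (p - p') = cX e k p - cX e k p' :=
  inner_sub_right _ _ _
theorem cB_sub (e : Frame) (k : Fin 3) (p p' : E4) : cB e k (p - p') = cB e k p - cB e k p' :=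
  inner_sub_right _ _ _
theorem cY_sub (e : Frame) (k : Fin 3) (p p' : E4) : cY e k (p - p') = cY e k p - cY e k p' :=
  inner_sub_right _ _ _
theorem cA_smul (e : Frame) (k : Fin 3) (s : ℝ) (p : E4) : cA e k (s • p) = s * cA e k p :=
  real_inner_smul_right _ _ _
theorem cB_smul (e : Frame) (k : Fin 3) (s : ℝ) (p : E4) : cB e k (s • p) = s * cB e k p :=
  real_inner_smul_right _ _ _

theorem continuous_cA (e : Frame) (k : Fin 3) : Continuous (cA e k) :=
  continuous_const.inner continuous_id
theorem continuous_cX (e : Frame) (k : Fin 3) : Continuous (cX e k) :=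
  continuous_const.inner continuous_id
theorem continuous_cB (e : Frame) (k : Fin 3) : Continuous (cB e k) :=
  continuous_const.inner continuous_id
theorem continuous_cY (e : Frame) (k : Fin 3) : Continuous (cY e k) :=
  continuous_const.inner continuous_id

/-- The point `s a_k + t b_m`. -/
noncomputable def quadPt (e : Frame) (k m : Fin 3) (s t : ℝ) : E4 := s • a e k + t • b e m

theorem coord_quadPt (e : Frame) (k m : Fin 3) (s t : ℝ) :
    cA e k (quadPt e k m s t) = s ∧ cX e k (quadPt e k m s t) = 0 ∧
      cB e m (quadPt e k m s t) = t ∧ cY e m (quadPt e k m s t) = 0 := by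
  have h := e.orthonormal
  have hh : ∀ i j, inner ℝ (e i) (e j) = if i = j then (1:ℝ) else 0 :=
    orthonormal_iff_ite.1 h
  have e0 : inner ℝ (e 0) (quadPt e k m s t) = s * cs k := by
    simp [quadPt, a, b, inner_add_right, real_inner_smul_right, hh]
  have e1 : inner ℝ (e 1) (quadPt e k m s t) = s * sn k := by
    simp [quadPt, a, b, inner_add_right, real_inner_smul_right, hh]
  have e2 : inner ℝ (e 2) (quadPt e k m s t) = t * cs m := by
    simp [quadPt, a, b, inner_add_right, real_inner_smul_right, hh]
  have e3 : inner ℝ (e 3) (quadPt e k m s t) = t * sn m := by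
    simp [quadPt, a, b, inner_add_right, real_inner_smul_right, hh]
  rw [cA_eq, cX_eq, cB_eq, cY_eq, e0, e1, e2, e3]
  have h1 := cs_sq_add_sn_sq k
  have h2 := cs_sq_add_sn_sq m
  refine ⟨?_, ?_, ?_, ?_⟩
  · linear_combination s * h1
  · ring
  · linear_combination t * h2
  · ring

/-- A point is determined by its coordinates. -/
theorem ext_coord (e : Frame) (k m : Fin 3) {p p' : E4} (hA : cA e k p = cA e k p')
    (hX : cX e k p = cX e k p') (hB : cB e m p = cB e m p') (hY : cY e m p = cY e m p') :
    p = p' := by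
  have h := norm_sq_eq e k m (p - p')
  rw [cA_sub, cX_sub, cB_sub, cY_sub, hA, hX, hB, hY] at h
  simp only [sub_self, ne_eq, OfNat.ofNat_ne_zero, not_false_eq_true, zero_pow, add_zero] at h
  exact sub_eq_zero.1 (norm_eq_zero.1 (pow_eq_zero_iff two_ne_zero |>.1 h))

theorem abs_cA_le (e : Frame) (k : Fin 3) (p : E4) : |cA e k p| ≤ ‖p‖ := by
  refine abs_le_of_sq_le_sq ?_ (norm_nonneg _)
  nlinarith [norm_sq_eq e k 0 p, sq_nonneg (cX e k p), sq_nonneg (cB e 0 p),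
    sq_nonneg (cY e 0 p)]

theorem abs_cX_le (e : Frame) (k : Fin 3) (p : E4) : |cX e k p| ≤ ‖p‖ := by
  refine abs_le_of_sq_le_sq ?_ (norm_nonneg _)
  nlinarith [norm_sq_eq e k 0 p, sq_nonneg (cA e k p), sq_nonneg (cB e 0 p),
    sq_nonneg (cY e 0 p)]

theorem abs_cB_le (e : Frame) (k : Fin 3) (p : E4) : |cB e k p| ≤ ‖p‖ := by
  simpa [cA_swapFrame] using abs_cA_le (swapFrame e) k p
theorem abs_cY_le (e : Frame) (k : Fin 3) (p : E4) : |cY e k p| ≤ ‖p‖ := by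
  simpa [cX_swapFrame] using abs_cX_le (swapFrame e) k p

theorem q_eq (e : Frame) (i j : Fin 3) (p : E4) : q e i j p = ⟨cX e i p, cY e j p⟩ := rfl

theorem q_swapFrame (e : Frame) (i j : Fin 3) (p : E4) :
    q (swapFrame e) j i p = swap (q e i j p) := by
  simp [q_eq, swap, cX_swapFrame, cY_swapFrame]

theorem continuous_q (e : Frame) (i j : Fin 3) : Continuous (q e i j) := by
  have h : q e i j = fun p => Complex.equivRealProdCLM.symm (cX e i p, cY e j p) := by
    funext p
    apply Complex.ext <;> simp [q_eq]
  rw [h]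
  exact Complex.equivRealProdCLM.symm.continuous.comp
    ((continuous_cX e i).prodMk (continuous_cY e j))

theorem norm_q_sub_le (e : Frame) (i j : Fin 3) (p p' : E4) :
    ‖q e i j p - q e i j p'‖ ≤ ‖p - p'‖ := by
  refine abs_le_of_sq_le_sq' ?_ (norm_nonneg _) |>.2
  have h : ‖q e i j p - q e i j p'‖ ^ 2 = cX e i (p - p') ^ 2 + cY e j (p - p') ^ 2 := by
    rw [← Complex.normSq_eq_norm_sq, Complex.normSq_apply, cX_sub, cY_sub]
    simp only [q_eq, Complex.sub_re, Complex.sub_im]; ring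
  rw [h, norm_sq_eq e i j]
  nlinarith [sq_nonneg (cA e i (p - p')), sq_nonneg (cB e j (p - p'))]

theorem mem_Q_coord {e : Frame} {i j : Fin 3} {v : E4} (hv : v ∈ Q e i j) :
    cA e i v = 0 ∧ cB e j v = 0 := by
  have h := e.orthonormal
  have hh : ∀ i j, inner ℝ (e i) (e j) = if i = j then (1:ℝ) else 0 :=
    orthonormal_iff_ite.1 h
  obtain ⟨s, t, rfl⟩ := Submodule.mem_span_pair.1 hv
  rw [cA_eq, cB_eq]
  simp [x, y, inner_add_right, real_inner_smul_right, hh]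
  constructor <;> ring

theorem mem_Q_of_coord {e : Frame} {i j : Fin 3} {v : E4} (hA : cA e i v = 0)
    (hB : cB e j v = 0) : v ∈ Q e i j := by
  have h := e.orthonormal
  have hh : ∀ i j, inner ℝ (e i) (e j) = if i = j then (1:ℝ) else 0 :=
    orthonormal_iff_ite.1 h
  refine Submodule.mem_span_pair.2 ⟨cX e i v, cY e j v, ?_⟩
  have h1 := cs_sq_add_sn_sq i
  have h2 := cs_sq_add_sn_sq j
  have e0 : ∀ s t : ℝ, inner ℝ (e 0) (s • x e i + t • y e j) = -s * sn i := fun s t => by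
    simp [x, y, inner_add_right, real_inner_smul_right, hh]
  have e1 : ∀ s t : ℝ, inner ℝ (e 1) (s • x e i + t • y e j) = s * cs i := fun s t => by
    simp [x, y, inner_add_right, real_inner_smul_right, hh]
  have e2 : ∀ s t : ℝ, inner ℝ (e 2) (s • x e i + t • y e j) = -t * sn j := fun s t => by
    simp [x, y, inner_add_right, real_inner_smul_right, hh]
  have e3 : ∀ s t : ℝ, inner ℝ (e 3) (s • x e i + t • y e j) = t * cs j := fun s t => by
    simp [x, y, inner_add_right, real_inner_smul_right, hh]
  apply ext_coord e i j
  · rw [hA, cA_eq, e0, e1]; ring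
  · rw [cX_eq e i (_ + _), e0, e1]; linear_combination cX e i v * h1
  · rw [hB, cB_eq, e2, e3]; ring
  · rw [cY_eq e j (_ + _), e2, e3]; linear_combination cY e j v * h2

/-! ### The convex domain in coordinates -/

theorem cA_of_mem_quadrant {e : Frame} {k m : Fin 3} {s t : ℝ} (k' : Fin 3) (hk : k' ≠ k) :
    cA e k' (quadPt e k m s t) = -s / 2 := by
  obtain ⟨h1, h2, -, -⟩ := coord_quadPt e k m s t
  rcases fin_three_cases k k' with rfl | rfl | rfl
  · exact absurd rfl hk
  · rw [cA_add_one, h1, h2]; ring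
  · rw [cA_add_two, h1, h2]; ring

theorem swap_quadPt (e : Frame) (k m : Fin 3) (s t : ℝ) :
    quadPt (swapFrame e) m k t s = quadPt e k m s t := by
  simp [quadPt, a_swapFrame, b_swapFrame, add_comm]

theorem cB_of_mem_quadrant {e : Frame} {k m : Fin 3} {s t : ℝ} (m' : Fin 3) (hm : m' ≠ m) :
    cB e m' (quadPt e k m s t) = -t / 2 := by
  rw [← cA_swapFrame, ← swap_quadPt, cA_of_mem_quadrant _ hm]

theorem norm_sq_quadPt (e : Frame) (k m : Fin 3) (s t : ℝ) :
    ‖quadPt e k m s t‖ ^ 2 = s ^ 2 + t ^ 2 := by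
  obtain ⟨h1, h2, h3, h4⟩ := coord_quadPt e k m s t
  rw [norm_sq_eq e k m, h1, h2, h3, h4]; ring

/-- The square of the distance from `0` of the projection of `p` to the quadrant `k m`. -/
noncomputable def quadSq (e : Frame) (k m : Fin 3) (p : E4) : ℝ :=
  max (cA e k p) 0 ^ 2 + max (cB e m p) 0 ^ 2

theorem continuous_quadSq (e : Frame) (k m : Fin 3) : Continuous (quadSq e k m) :=
  (((continuous_cA e k).max continuous_const).pow 2).add
    (((continuous_cB e m).max continuous_const).pow 2)

/-- The domain is cut out by finitely many inequalities. -/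
theorem mem_U_iff {e : Frame} {η : ℝ} (hη : η < 1) {p : E4} :
    p ∈ U e η ↔ ‖p‖ < 1 ∧ (∀ k m, quadSq e k m p < (1 - η) ^ 2) ∧
      (∀ k, cA e k p < 1 - √η) ∧ ∀ m, cB e m p < 1 - √η := by
  have hr : 0 < 1 - η := by linarith
  have hia : ∀ i, inner ℝ p (a e i) = cA e i p := fun i => real_inner_comm _ _
  have hib : ∀ i, inner ℝ p (b e i) = cB e i p := fun i => real_inner_comm _ _
  rw [U, mem_ofPred_eq, mem_ball_zero_iff]
  simp only [hia, hib]
  refine and_congr_right fun _ => and_congr_left fun _ => ⟨fun h k m => ?_, fun h w hw => ?_⟩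
  · by_contra hcon
    push Not at hcon
    have hpos : 0 < quadSq e k m p := lt_of_lt_of_le (by positivity) hcon
    have hd : 0 < √(quadSq e k m p) := Real.sqrt_pos.2 hpos
    have hsq : √(quadSq e k m p) ^ 2 = quadSq e k m p := Real.sq_sqrt hpos.le
    set d := √(quadSq e k m p)
    set α := max (cA e k p) 0
    set β := max (cB e m p) 0
    have hαβ : quadSq e k m p = α ^ 2 + β ^ 2 := rfl
    have hα : α * cA e k p = α ^ 2 := by
      rcases max_cases (cA e k p) 0 with ⟨h, _⟩ | ⟨h, _⟩ <;> simp only [α, h] <;> ring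
    have hβ : β * cB e m p = β ^ 2 := by
      rcases max_cases (cB e m p) 0 with ⟨h, _⟩ | ⟨h, _⟩ <;> simp only [β, h] <;> ring
    have hα0 : 0 ≤ α := le_max_right _ _
    have hβ0 : 0 ≤ β := le_max_right _ _
    have h1 := h (quadPt e k m (α / d) (β / d)) ⟨mem_iUnion₂.2 ⟨k, m, α / d, β / d,
      by positivity, by positivity, rfl⟩, by
        rw [mem_sphere_zero_iff_norm, ← pow_left_inj₀ (norm_nonneg _) zero_le_one two_ne_zero,
          norm_sq_quadPt]
        field_simp; linarith⟩
    have h2 : inner ℝ p (quadPt e k m (α / d) (β / d)) = d := by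
      rw [quadPt, inner_add_right, real_inner_smul_right, real_inner_smul_right, hia, hib]
      field_simp
      linarith
    rw [h2] at h1
    nlinarith
  · obtain ⟨hZ, hS⟩ := hw
    obtain ⟨k, m, s, t, hs, ht, rfl⟩ := mem_iUnion₂.1 hZ
    have hst : s ^ 2 + t ^ 2 = 1 := by
      rw [← norm_sq_quadPt e k m, quadPt, mem_sphere_zero_iff_norm.1 hS]; norm_num
    rw [inner_add_right, real_inner_smul_right, real_inner_smul_right, hia, hib]
    have h1 := h k m
    rw [quadSq] at h1
    have hA := le_max_left (cA e k p) 0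
    have hB := le_max_left (cB e m p) 0
    set α := max (cA e k p) 0
    set β := max (cB e m p) 0
    have h2 : s * cA e k p + t * cB e m p ≤ s * α + t * β := by gcongr
    have h3 : (s * α + t * β) ^ 2 ≤ α ^ 2 + β ^ 2 := by
      nlinarith [sq_nonneg (s * β - t * α)]
    have h4 : s * α + t * β < 1 - η := by
      by_contra hcon; push Not at hcon; nlinarith
    linarith

theorem isOpen_U {e : Frame} {η : ℝ} (hη : η < 1) : IsOpen (U e η) := by
  have : U e η = {p | ‖p‖ < 1} ∩ (⋂ k, ⋂ m, {p | quadSq e k m p < (1 - η) ^ 2}) ∩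
      (⋂ k, {p | cA e k p < 1 - √η}) ∩ ⋂ m, {p | cB e m p < 1 - √η} := by
    ext p
    rw [mem_U_iff hη]
    simp only [mem_inter_iff, mem_iInter, mem_ofPred_eq]
    tauto
  rw [this]
  refine (((isOpen_lt continuous_norm continuous_const).inter ?_).inter ?_).inter ?_
  · exact isOpen_iInter_of_finite fun k => isOpen_iInter_of_finite fun m =>
      isOpen_lt (continuous_quadSq e k m) continuous_const
  · exact isOpen_iInter_of_finite fun k => isOpen_lt (continuous_cA e k) continuous_const
  · exact isOpen_iInter_of_finite fun k => isOpen_lt (continuous_cB e k) continuous_const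

theorem le_of_mem_closure_U {e : Frame} {η : ℝ} (hη : η < 1) {p : E4} (hp : p ∈ closure (U e η)) :
    ‖p‖ ≤ 1 ∧ (∀ k m, quadSq e k m p ≤ (1 - η) ^ 2) ∧
      (∀ k, cA e k p ≤ 1 - √η) ∧ ∀ m, cB e m p ≤ 1 - √η := by
  refine ⟨?_, fun k m => ?_, fun k => ?_, fun m => ?_⟩
  · exact closure_minimal (fun p hp => ((mem_U_iff hη).1 hp).1.le)
      (isClosed_le continuous_norm continuous_const) hp
  · exact closure_minimal (t := {p | quadSq e k m p ≤ (1 - η) ^ 2})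
      (fun p hp => (((mem_U_iff hη).1 hp).2.1 k m).le)
      (isClosed_le (continuous_quadSq e k m) continuous_const) hp
  · exact closure_minimal (t := {p | cA e k p ≤ 1 - √η})
      (fun p hp => (((mem_U_iff hη).1 hp).2.2.1 k).le)
      (isClosed_le (continuous_cA e k) continuous_const) hp
  · exact closure_minimal (t := {p | cB e m p ≤ 1 - √η})
      (fun p hp => (((mem_U_iff hη).1 hp).2.2.2 m).le)
      (isClosed_le (continuous_cB e m) continuous_const) hp

theorem mem_closure_U {e : Frame} {η : ℝ} (hη : η < 1) (hc : 0 < 1 - √η) {p : E4}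
    (h1 : ‖p‖ ≤ 1) (h2 : ∀ k m, quadSq e k m p ≤ (1 - η) ^ 2) (h3 : ∀ k, cA e k p ≤ 1 - √η)
    (h4 : ∀ m, cB e m p ≤ 1 - √η) : p ∈ closure (U e η) := by
  have hr : 0 < 1 - η := by linarith
  have ht : Filter.Tendsto (fun n : ℕ => (1 - 1 / ((n:ℝ) + 1)) • p) Filter.atTop (nhds p) := by
    have := (tendsto_const_nhds.sub tendsto_one_div_add_atTop_nhds_zero_nat :
      Filter.Tendsto (fun n : ℕ => (1:ℝ) - 1 / ((n:ℝ) + 1)) Filter.atTop (nhds (1 - 0)))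
    simpa using this.smul_const p
  refine mem_closure_of_tendsto ht (Filter.Eventually.of_forall fun n => ?_)
  set s : ℝ := 1 - 1 / ((n:ℝ) + 1) with hs
  have hn : (0:ℝ) < 1 / ((n:ℝ) + 1) := by positivity
  have hn1 : 1 / ((n:ℝ) + 1) ≤ 1 := by
    rw [div_le_one (by positivity)]; linarith [n.cast_nonneg (α := ℝ)]
  have hs0 : 0 ≤ s := by linarith
  have hs1 : s < 1 := by linarith
  have hlin : ∀ u v : ℝ, 0 < v → u ≤ v → s * u < v := fun u v hv huv => by nlinarith
  have hmax : ∀ u : ℝ, max (s * u) 0 = s * max u 0 := fun u => by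
    rw [mul_max_of_nonneg _ _ hs0, mul_zero]
  rw [mem_U_iff hη, norm_smul, Real.norm_of_nonneg hs0]
  refine ⟨hlin _ _ one_pos h1, fun k m => ?_, fun k => ?_, fun m => ?_⟩
  · rw [quadSq, cA_smul, cB_smul, hmax, hmax]
    have := hlin _ _ (by positivity) (hlin _ _ (by positivity : (0:ℝ) < (1 - η) ^ 2) (h2 k m)).le
    rw [quadSq] at this
    linarith
  · rw [cA_smul]; exact hlin _ _ hc (h3 k)
  · rw [cB_smul]; exact hlin _ _ hc (h4 m)

/-! ### The curves -/

/-- The pairs `(s, t)` for which `s a_k + t b_m` lies on the curve `k m`. -/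
def OnCurve (c r s t : ℝ) : Prop :=
  0 ≤ s ∧ 0 ≤ t ∧ s ≤ c ∧ t ≤ c ∧ s ^ 2 + t ^ 2 ≤ r ^ 2 ∧ (s = c ∨ t = c ∨ s ^ 2 + t ^ 2 = r ^ 2)

/-- The radius of the curve in the direction `θ`. -/
noncomputable def rad (c r θ : ℝ) : ℝ := min r (c / max (Real.cos θ) (Real.sin θ))

/-- The coordinates of the curve in the direction `θ`. -/
noncomputable def curvA (c r θ : ℝ) : ℝ := rad c r θ * Real.cos θ

noncomputable def curvB (c r θ : ℝ) : ℝ := rad c r θ * Real.sin θ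

/-- The point of the curve `k m` in the direction `θ`. -/
noncomputable def arcPt (e : Frame) (c r : ℝ) (k m : Fin 3) (θ : ℝ) : E4 :=
  quadPt e k m (curvA c r θ) (curvB c r θ)

theorem arc_eq (e : Frame) (η : ℝ) (k m : Fin 3) (t : unitInterval) :
    arc e η k m t = arcPt e (1 - √η) (1 - η) k m (Real.pi / 2 * t) := by
  simp only [arc, arcPt, quadPt, curvA, curvB, rad, smul_add, smul_smul]

theorem rad_symm (c r θ : ℝ) : rad c r (Real.pi / 2 - θ) = rad c r θ := by
  rw [rad, rad, Real.cos_pi_div_two_sub, Real.sin_pi_div_two_sub, max_comm]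

theorem curvA_symm (c r θ : ℝ) : curvA c r (Real.pi / 2 - θ) = curvB c r θ := by
  rw [curvA, curvB, rad_symm, Real.cos_pi_div_two_sub]

theorem curvB_symm (c r θ : ℝ) : curvB c r (Real.pi / 2 - θ) = curvA c r θ := by
  rw [curvA, curvB, rad_symm, Real.sin_pi_div_two_sub]

theorem arcPt_symm (e : Frame) (c r : ℝ) (k m : Fin 3) (θ : ℝ) :
    arcPt (swapFrame e) c r m k (Real.pi / 2 - θ) = arcPt e c r k m θ := by
  rw [arcPt, arcPt, curvA_symm, curvB_symm, swap_quadPt]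

theorem mem_symm_iff {θ : ℝ} :
    Real.pi / 2 - θ ∈ Icc 0 (Real.pi / 2) ↔ θ ∈ Icc 0 (Real.pi / 2) := by
  simp only [mem_Icc]; constructor <;> rintro ⟨h1, h2⟩ <;> constructor <;> linarith

theorem cos_sin_nonneg {θ : ℝ} (h : θ ∈ Icc 0 (Real.pi / 2)) : 0 ≤ Real.cos θ ∧ 0 ≤ Real.sin θ :=
  ⟨Real.cos_nonneg_of_mem_Icc ⟨by linarith [h.1, Real.pi_pos], h.2⟩,
    Real.sin_nonneg_of_nonneg_of_le_pi h.1 (by linarith [h.2, Real.pi_pos])⟩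

theorem max_pos_of_mem {θ : ℝ} (h : θ ∈ Icc 0 (Real.pi / 2)) :
    1 / 2 ≤ max (Real.cos θ) (Real.sin θ) ^ 2 ∧ 0 < max (Real.cos θ) (Real.sin θ) ∧
      max (Real.cos θ) (Real.sin θ) ≤ 1 := by
  obtain ⟨hc, hs⟩ := cos_sin_nonneg h
  have h1 := Real.sin_sq_add_cos_sq θ
  have h2 : 1 / 2 ≤ max (Real.cos θ) (Real.sin θ) ^ 2 := by
    rcases max_cases (Real.cos θ) (Real.sin θ) with ⟨h2, h3⟩ | ⟨h2, h3⟩ <;> rw [h2] <;> nlinarith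
  refine ⟨h2, ?_, max_le (Real.cos_le_one _) (Real.sin_le_one _)⟩
  have h0 : 0 ≤ max (Real.cos θ) (Real.sin θ) := le_max_of_le_left hc
  rcases h0.lt_or_eq with h3 | h3
  · exact h3
  · rw [← h3] at h2; norm_num at h2

section curve

variable {c r R : ℝ}

theorem rad_pos (hc : 0 < c) (hr : 0 < r) {θ : ℝ} (h : θ ∈ Icc 0 (Real.pi / 2)) :
    0 < rad c r θ := lt_min hr (div_pos hc (max_pos_of_mem h).2.1)

theorem le_rad (hc : 0 < c) (hcr : c ≤ r) {θ : ℝ} (h : θ ∈ Icc 0 (Real.pi / 2)) :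
    c ≤ rad c r θ :=
  le_min hcr (le_div_self hc.le (max_pos_of_mem h).2.1 (max_pos_of_mem h).2.2)

theorem onCurve (hc : 0 < c) (hr : 0 < r) {θ : ℝ} (h : θ ∈ Icc 0 (Real.pi / 2)) :
    OnCurve c r (curvA c r θ) (curvB c r θ) := by
  obtain ⟨hcos, hsin⟩ := cos_sin_nonneg h
  obtain ⟨-, hM, -⟩ := max_pos_of_mem h
  have hρ := rad_pos hc hr h
  have h1 := Real.sin_sq_add_cos_sq θ
  have hsq : curvA c r θ ^ 2 + curvB c r θ ^ 2 = rad c r θ ^ 2 := by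
    rw [curvA, curvB]; linear_combination rad c r θ ^ 2 * h1
  have hρM : rad c r θ * max (Real.cos θ) (Real.sin θ) ≤ c := by
    rw [← le_div_iff₀ hM]; exact min_le_right _ _
  refine ⟨mul_nonneg hρ.le hcos, mul_nonneg hρ.le hsin, ?_, ?_, ?_, ?_⟩
  · exact (mul_le_mul_of_nonneg_left (le_max_left _ _) hρ.le).trans hρM
  · exact (mul_le_mul_of_nonneg_left (le_max_right _ _) hρ.le).trans hρM
  · rw [hsq]; exact pow_le_pow_left₀ hρ.le (min_le_left _ _) 2
  · rw [hsq]
    rcases min_choice r (c / max (Real.cos θ) (Real.sin θ)) with h2 | h2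
    · right; right; rw [rad, h2]
    · have h3 : rad c r θ * max (Real.cos θ) (Real.sin θ) = c := by
        rw [rad, h2]; field_simp
      rcases max_choice (Real.cos θ) (Real.sin θ) with h4 | h4 <;> rw [h4] at h3
      · left; exact h3
      · right; left; exact h3

/-- Every point of the curve is reached in the direction of its argument. -/
theorem curv_arg (hr : 0 < r) {s t : ℝ} (h : OnCurve c r s t) :
    (⟨s, t⟩ : ℂ).arg ∈ Icc 0 (Real.pi / 2) ∧ curvA c r (⟨s, t⟩ : ℂ).arg = s ∧
      curvB c r (⟨s, t⟩ : ℂ).arg = t := by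
  obtain ⟨hs, ht, hsc, htc, hst, hor⟩ := h
  set z : ℂ := ⟨s, t⟩ with hz
  have hmem : z.arg ∈ Icc 0 (Real.pi / 2) :=
    ⟨Complex.arg_nonneg_iff.2 ht, Complex.arg_le_pi_div_two_iff.2 (Or.inl hs)⟩
  obtain ⟨-, hM, -⟩ := max_pos_of_mem hmem
  have hcos : ‖z‖ * Real.cos z.arg = s := Complex.norm_mul_cos_arg z
  have hsin : ‖z‖ * Real.sin z.arg = t := Complex.norm_mul_sin_arg z
  have hn : ‖z‖ ^ 2 = s ^ 2 + t ^ 2 := by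
    rw [← Complex.normSq_eq_norm_sq, Complex.normSq_apply]; simp only [hz]; ring
  have hmax : ‖z‖ * max (Real.cos z.arg) (Real.sin z.arg) = max s t := by
    rw [mul_max_of_nonneg _ _ (norm_nonneg _), hcos, hsin]
  have hle1 : ‖z‖ ≤ r := abs_le_of_sq_le_sq' (by rw [hn]; exact hst) hr.le |>.2
  have hle2 : ‖z‖ ≤ c / max (Real.cos z.arg) (Real.sin z.arg) := by
    rw [le_div_iff₀ hM, hmax]; exact max_le hsc htc
  have hrad : rad c r z.arg = ‖z‖ := by
    refine le_antisymm ?_ (le_min hle1 hle2)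
    rcases hor with h1 | h1 | h1
    · refine (min_le_right _ _).trans ?_
      rw [div_le_iff₀ hM, hmax, ← h1]; exact le_max_left _ _
    · refine (min_le_right _ _).trans ?_
      rw [div_le_iff₀ hM, hmax, ← h1]; exact le_max_right _ _
    · refine (min_le_left _ _).trans ?_
      exact abs_le_of_sq_le_sq' (by rw [hn, h1]) (norm_nonneg _) |>.2
  exact ⟨hmem, by rw [curvA, hrad, hcos], by rw [curvB, hrad, hsin]⟩

theorem curvB_mono (hc : 0 < c) (hr : 0 < r) {θ θ' : ℝ} (h : θ ∈ Icc 0 (Real.pi / 2))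
    (h' : θ' ∈ Icc 0 (Real.pi / 2)) (hle : θ ≤ θ') : curvB c r θ ≤ curvB c r θ' := by
  obtain ⟨hcos, hsin⟩ := cos_sin_nonneg h
  obtain ⟨hcos', hsin'⟩ := cos_sin_nonneg h'
  obtain ⟨-, hM, -⟩ := max_pos_of_mem h
  obtain ⟨-, hM', -⟩ := max_pos_of_mem h'
  have hss : Real.sin θ ≤ Real.sin θ' :=
    Real.sin_le_sin_of_le_of_le_pi_div_two (by linarith [h.1, Real.pi_pos]) h'.2 hle
  have hd : 0 ≤ Real.sin (θ' - θ) :=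
    Real.sin_nonneg_of_nonneg_of_le_pi (by linarith) (by linarith [h.1, h'.2, Real.pi_pos])
  rw [Real.sin_sub] at hd
  rw [curvB, curvB, rad, rad, min_mul_of_nonneg _ _ hsin, min_mul_of_nonneg _ _ hsin']
  refine min_le_min (mul_le_mul_of_nonneg_left hss hr.le) ?_
  rw [div_mul_eq_mul_div, div_mul_eq_mul_div, div_le_div_iff₀ hM hM', mul_assoc, mul_assoc]
  refine mul_le_mul_of_nonneg_left ?_ hc.le
  rw [mul_max_of_nonneg _ _ hsin]
  refine max_le ?_ ?_
  · exact (by linarith : Real.sin θ * Real.cos θ' ≤ Real.sin θ' * Real.cos θ).trans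
      (mul_le_mul_of_nonneg_left (le_max_left _ _) hsin')
  · rw [mul_comm]
    exact mul_le_mul_of_nonneg_left (le_max_right _ _) hsin'

theorem curvA_anti (hc : 0 < c) (hr : 0 < r) {θ θ' : ℝ} (h : θ ∈ Icc 0 (Real.pi / 2))
    (h' : θ' ∈ Icc 0 (Real.pi / 2)) (hle : θ ≤ θ') : curvA c r θ' ≤ curvA c r θ := by
  rw [← curvB_symm, ← curvB_symm]
  exact curvB_mono hc hr (mem_symm_iff.2 h') (mem_symm_iff.2 h) (by linarith)

/-- The curve starts with a segment of length `R`. -/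
theorem curvA_eq_of_curvB_le (hc : 0 < c) (hrR : r ^ 2 = c ^ 2 + R ^ 2) (hRc : R < c)
    {s t : ℝ} (h : OnCurve c r s t) (ht : t ≤ R) : s = c := by
  obtain ⟨hs, ht0, hsc, htc, hst, h1 | h1 | h1⟩ := h
  · exact h1
  · linarith
  · nlinarith

theorem onCurve_arctan (hc : 0 < c) (hr : 0 < r) (hrR : r ^ 2 = c ^ 2 + R ^ 2) (hRc : R < c)
    {τ : ℝ} (h0 : 0 ≤ τ) (hτ : τ ≤ R) :
    Real.arctan (τ / c) ∈ Icc 0 (Real.pi / 2) ∧ curvA c r (Real.arctan (τ / c)) = c ∧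
      curvB c r (Real.arctan (τ / c)) = τ := by
  have h1 : OnCurve c r c τ :=
    ⟨hc.le, h0, le_rfl, by linarith, by rw [hrR]; nlinarith, Or.inl rfl⟩
  have h2 := curv_arg hr h1
  have h3 : (⟨c, τ⟩ : ℂ).arg = Real.arctan (τ / c) := by
    have h4 := abs_lt.1 (Complex.abs_arg_lt_pi_div_two_iff.2 (Or.inl hc) :
      |(⟨c, τ⟩ : ℂ).arg| < Real.pi / 2)
    rw [← Real.arctan_tan h4.1 h4.2, Complex.tan_arg]
  rwa [h3] at h2

theorem le_curvB_iff (hc : 0 < c) (hr : 0 < r) (hrR : r ^ 2 = c ^ 2 + R ^ 2) (hRc : R < c)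
    {τ θ : ℝ} (h0 : 0 ≤ τ) (hτ : τ ≤ R) (hθ : θ ∈ Icc 0 (Real.pi / 2)) :
    τ ≤ curvB c r θ ↔ Real.arctan (τ / c) ≤ θ := by
  obtain ⟨h1, -, h3⟩ := onCurve_arctan hc hr hrR hRc h0 hτ
  constructor
  · intro h
    by_contra hlt
    push Not at hlt
    have hlt' : θ < Real.pi / 2 := hlt.trans (Real.arctan_lt_pi_div_two _)
    have hcos : 0 < Real.cos θ := Real.cos_pos_of_mem_Ioo ⟨by linarith [hθ.1, Real.pi_pos], hlt'⟩
    have htan : Real.tan θ < τ / c := by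
      rw [← Real.tan_arctan (τ / c)]
      exact Real.tan_lt_tan_of_lt_of_lt_pi_div_two (by linarith [hθ.1, Real.pi_pos])
        (Real.arctan_lt_pi_div_two _) hlt
    obtain ⟨-, hsin⟩ := cos_sin_nonneg hθ
    have hA := (onCurve hc hr hθ).2.2.1
    rw [Real.tan_eq_sin_div_cos, div_lt_div_iff₀ hcos hc] at htan
    rw [curvB] at h
    rw [curvA] at hA
    have h4 : rad c r θ * (Real.sin θ * c) < rad c r θ * (τ * Real.cos θ) :=
      mul_lt_mul_of_pos_left htan (rad_pos hc hr hθ)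
    nlinarith
  · intro h
    rw [← h3]
    exact curvB_mono hc hr h1 hθ h

theorem abs_curv_sub_le (hc : 0 < c) (hr : 0 < r) (hrc : r ≤ 11 / 10 * c) {θ θ' : ℝ}
    (h : θ ∈ Icc 0 (Real.pi / 2)) (h' : θ' ∈ Icc 0 (Real.pi / 2)) :
    |curvA c r θ - curvA c r θ'| ≤ 31 / 10 * c * |θ - θ'| ∧
      |curvB c r θ - curvB c r θ'| ≤ 31 / 10 * c * |θ - θ'| := by
  obtain ⟨hM2, hM, -⟩ := max_pos_of_mem h
  obtain ⟨hM2', hM', -⟩ := max_pos_of_mem h'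
  have hcl : |Real.cos θ - Real.cos θ'| ≤ |θ - θ'| := by
    have := Real.lipschitzWith_cos.dist_le_mul θ θ'
    simpa [Real.dist_eq] using this
  have hsl : |Real.sin θ - Real.sin θ'| ≤ |θ - θ'| := by
    have := Real.lipschitzWith_sin.dist_le_mul θ θ'
    simpa [Real.dist_eq] using this
  have hMl : |max (Real.cos θ) (Real.sin θ) - max (Real.cos θ') (Real.sin θ')| ≤ |θ - θ'| :=
    (abs_max_sub_max_le_max _ _ _ _).trans (max_le hcl hsl)
  have hρ0 := rad_pos hc hr h'
  have hρr : rad c r θ' ≤ 11 / 10 * c := (min_le_left _ _).trans hrc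
  have hrad : |rad c r θ - rad c r θ'| ≤ 2 * c * |θ - θ'| := by
    refine (abs_min_sub_min_le_max _ _ _ _).trans (max_le (by simp; positivity) ?_)
    set M := max (Real.cos θ) (Real.sin θ)
    set M' := max (Real.cos θ') (Real.sin θ')
    have hMM : 1 / 2 ≤ M * M' := by
      have : (1 / 2 : ℝ) ^ 2 ≤ (M * M') ^ 2 := by rw [mul_pow]; nlinarith
      exact abs_le_of_sq_le_sq' this (by positivity) |>.2
    have h1 : c / M - c / M' = c * (M' - M) / (M * M') := by field_simp
    rw [h1, abs_div, abs_mul, abs_of_pos hc, abs_of_pos (mul_pos hM hM'), abs_sub_comm,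
      div_le_iff₀ (mul_pos hM hM')]
    have : c * |M - M'| ≤ c * |θ - θ'| := mul_le_mul_of_nonneg_left hMl hc.le
    nlinarith [mul_nonneg hc.le (abs_nonneg (θ - θ'))]
  have key : ∀ u u' : ℝ, |u| ≤ 1 → |u - u'| ≤ |θ - θ'| →
      |rad c r θ * u - rad c r θ' * u'| ≤ 31 / 10 * c * |θ - θ'| := by
    intro u u' hu huu
    have h1 : rad c r θ * u - rad c r θ' * u' =
        (rad c r θ - rad c r θ') * u + rad c r θ' * (u - u') := by ring
    rw [h1]
    refine (abs_add_le _ _).trans ?_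
    rw [abs_mul, abs_mul, abs_of_pos hρ0]
    have h2 : |rad c r θ - rad c r θ'| * |u| ≤ 2 * c * |θ - θ'| * 1 :=
      mul_le_mul hrad hu (abs_nonneg _) (by positivity)
    have h3 : rad c r θ' * |u - u'| ≤ 11 / 10 * c * |θ - θ'| :=
      mul_le_mul hρr huu (abs_nonneg _) (by positivity)
    linarith
  exact ⟨key _ _ (Real.abs_cos_le_one _) hcl, key _ _ (Real.abs_sin_le_one _) hsl⟩

end curve

/-- The relations between the sizes involved which the proof uses: `c` and `r` are the distances
from the origin to the flat and to the round part of the curves, and `R` is the length of the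
straight pieces of the curves. -/
structure Sizes (c r R δ ν L : ℝ) : Prop where
  c_pos : 0 < c
  r_pos : 0 < r
  R_pos : 0 < R
  r_sq : r ^ 2 = c ^ 2 + R ^ 2
  R_lt : 4 * R < c
  δ_pos : 0 < δ
  δ_lt : δ < ν
  gap : ν + 6 * δ < R
  L_nonneg : 0 ≤ L
  L_le : L ≤ 1 / 1000
  norm_lt : r ^ 2 + δ ^ 2 < 1

theorem Sizes.c_le_r {c r R δ ν L : ℝ} (S : Sizes c r R δ ν L) : c ≤ r := by
  have := S.r_sq; have := S.c_pos; have := S.r_pos; have := S.R_pos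
  nlinarith

theorem Sizes.r_le {c r R δ ν L : ℝ} (S : Sizes c r R δ ν L) : r ≤ 11 / 10 * c := by
  have := S.r_sq; have := S.c_pos; have := S.r_pos; have := S.R_pos; have := S.R_lt
  nlinarith

theorem frontier_quadPt_iff {e : Frame} {η : ℝ} (hη0 : 0 < η) (hη : η < 1) {k m : Fin 3} {s t : ℝ}
    (hs : 0 ≤ s) (ht : 0 ≤ t) :
    quadPt e k m s t ∈ frontier (U e η) ↔ OnCurve (1 - √η) (1 - η) s t := by
  have hc : 0 < 1 - √η := by
    have : √η < 1 := by rw [Real.sqrt_lt' one_pos]; linarith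
    linarith
  have hr : 0 < 1 - η := by linarith
  have hr1 : (1 - η) ^ 2 < 1 := by nlinarith
  obtain ⟨h1, -, h3, -⟩ := coord_quadPt e k m s t
  have hn := norm_sq_quadPt e k m s t
  have hA : ∀ k', cA e k' (quadPt e k m s t) ≤ s := fun k' => by
    by_cases h : k' = k
    · rw [h, h1]
    · rw [cA_of_mem_quadrant k' h]; linarith
  have hB : ∀ m', cB e m' (quadPt e k m s t) ≤ t := fun k' => by
    by_cases h : k' = m
    · rw [h, h3]
    · rw [cB_of_mem_quadrant k' h]; linarith
  have hq : ∀ k' m', quadSq e k' m' (quadPt e k m s t) ≤ s ^ 2 + t ^ 2 := fun k' m' => by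
    rw [quadSq]
    have e1 : max (cA e k' (quadPt e k m s t)) 0 ^ 2 ≤ s ^ 2 :=
      pow_le_pow_left₀ (le_max_right _ _) (max_le (hA k') hs) 2
    have e2 : max (cB e m' (quadPt e k m s t)) 0 ^ 2 ≤ t ^ 2 :=
      pow_le_pow_left₀ (le_max_right _ _) (max_le (hB m') ht) 2
    linarith
  have hq' : quadSq e k m (quadPt e k m s t) = s ^ 2 + t ^ 2 := by
    rw [quadSq, h1, h3, max_eq_left hs, max_eq_left ht]
  rw [(isOpen_U hη).frontier_eq, mem_sdiff, mem_U_iff hη]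
  constructor
  · rintro ⟨hcl, hnot⟩
    obtain ⟨-, g2, g3, g4⟩ := le_of_mem_closure_U hη hcl
    have g2' := g2 k m
    have g3' := g3 k
    have g4' := g4 m
    rw [hq'] at g2'
    rw [h1] at g3'
    rw [h3] at g4'
    refine ⟨hs, ht, g3', g4', g2', ?_⟩
    by_contra hcon
    push Not at hcon
    obtain ⟨f1, f2, f3⟩ := hcon
    refine hnot ⟨?_, fun k' m' => (hq k' m').trans_lt (lt_of_le_of_ne g2' f3),
      fun k' => (hA k').trans_lt (lt_of_le_of_ne g3' f1),
      fun m' => (hB m').trans_lt (lt_of_le_of_ne g4' f2)⟩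
    by_contra hlt; push Not at hlt; nlinarith
  · rintro ⟨-, -, hsc, htc, hst, hor⟩
    refine ⟨mem_closure_U hη hc ?_ (fun k' m' => (hq k' m').trans hst)
      (fun k' => (hA k').trans hsc) fun m' => (hB m').trans htc, ?_⟩
    · by_contra hlt; push Not at hlt; nlinarith
    · rintro ⟨-, f2, f3, f4⟩
      have f2' := f2 k m
      have f3' := f3 k
      have f4' := f4 m
      rw [hq'] at f2'
      rw [h1] at f3'
      rw [h3] at f4'
      rcases hor with h | h | h <;> linarith

/-- The coordinates of a point near the curve. -/
theorem coord_near {e : Frame} {k m : Fin 3} {s t δ : ℝ} {p : E4} (hs : 0 ≤ s) (ht : 0 ≤ t)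
    (hp : ‖p - quadPt e k m s t‖ < δ) :
    |cA e k p - s| < δ ∧ |cB e m p - t| < δ ∧ (∀ k', k' ≠ k → cA e k' p < δ) ∧
      (∀ m', m' ≠ m → cB e m' p < δ) ∧
      (cA e k p - s) ^ 2 + cX e k p ^ 2 + (cB e m p - t) ^ 2 + cY e m p ^ 2 < δ ^ 2 := by
  obtain ⟨h1, h2, h3, h4⟩ := coord_quadPt e k m s t
  refine ⟨?_, ?_, fun k' hk => ?_, fun m' hm => ?_, ?_⟩
  · have := abs_cA_le e k (p - quadPt e k m s t)
    rw [cA_sub, h1] at this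
    linarith
  · have := abs_cB_le e m (p - quadPt e k m s t)
    rw [cB_sub, h3] at this
    linarith
  · have := (abs_le.1 (abs_cA_le e k' (p - quadPt e k m s t))).2
    rw [cA_sub, cA_of_mem_quadrant k' hk] at this
    linarith
  · have := (abs_le.1 (abs_cB_le e m' (p - quadPt e k m s t))).2
    rw [cB_sub, cB_of_mem_quadrant m' hm] at this
    linarith
  · have h5 := norm_sq_eq e k m (p - quadPt e k m s t)
    rw [cA_sub, cX_sub, cB_sub, cY_sub, h1, h2, h3, h4, sub_zero, sub_zero] at h5
    rw [← h5]
    exact pow_lt_pow_left₀ hp (norm_nonneg _) two_ne_zero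

theorem norm_lt_one_of_near {e : Frame} {k m : Fin 3} {s t δ r : ℝ} {p : E4} (hs : 0 ≤ s)
    (ht : 0 ≤ t) (hp : ‖p - quadPt e k m s t‖ < δ) (hq : quadSq e k m p ≤ r ^ 2)
    (hδ : r ^ 2 + δ ^ 2 < 1) : ‖p‖ < 1 := by
  obtain ⟨-, -, -, -, h⟩ := coord_near hs ht hp
  have key : ∀ u v : ℝ, 0 ≤ v → u ^ 2 ≤ max u 0 ^ 2 + (u - v) ^ 2 := fun u v hv => by
    rcases max_cases u 0 with ⟨h1, h2⟩ | ⟨h1, h2⟩ <;> rw [h1] <;> nlinarith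
  have h1 := key (cA e k p) s hs
  have h2 := key (cB e m p) t ht
  have h3 := norm_sq_eq e k m p
  rw [quadSq] at hq
  by_contra hlt
  push Not at hlt
  nlinarith

theorem cA_eq_of_near_face {e : Frame} {η R δ ν L : ℝ} (hη : η < 1)
    (S : Sizes (1 - √η) (1 - η) R δ ν L) {k m : Fin 3} {s t : ℝ}
    (hst : OnCurve (1 - √η) (1 - η) s t) (ht : t ≤ R - δ) {p : E4} (hp : p ∈ frontier (U e η))
    (hpz : ‖p - quadPt e k m s t‖ < δ) : cA e k p = 1 - √η := by
  have hδ := S.δ_pos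
  have hR := S.R_pos
  have hRc := S.R_lt
  have hgap := S.gap
  have hν := S.δ_lt
  have hr := S.r_sq
  have hs : s = 1 - √η := curvA_eq_of_curvB_le S.c_pos hr (by linarith) hst (by linarith)
  rw [(isOpen_U hη).frontier_eq] at hp
  obtain ⟨-, g2, g3, -⟩ := le_of_mem_closure_U hη hp.1
  obtain ⟨h1, h2, h3, h4, -⟩ := coord_near hst.1 hst.2.1 hpz
  by_contra hne
  have hlt := lt_of_le_of_ne (g3 k) hne
  apply hp.2
  have hA : ∀ k', max (cA e k' p) 0 < 1 - √η := fun k' => max_lt (by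
    by_cases hk : k' = k
    · rw [hk]; exact hlt
    · linarith [h3 k' hk]) S.c_pos
  have hB : ∀ m', max (cB e m' p) 0 < R := fun m' => max_lt (by
    by_cases hm : m' = m
    · rw [hm]; linarith [(abs_lt.1 h2).2]
    · linarith [h4 m' hm]) hR
  rw [mem_U_iff hη]
  refine ⟨norm_lt_one_of_near hst.1 hst.2.1 hpz (g2 k m) S.norm_lt, fun k' m' => ?_,
    fun k' => (le_max_left _ _).trans_lt (hA k'),
    fun m' => (le_max_left _ _).trans_lt ((hB m').trans (by linarith))⟩
  rw [quadSq, hr]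
  exact add_lt_add (pow_lt_pow_left₀ (hA k') (le_max_right _ _) two_ne_zero)
    (pow_lt_pow_left₀ (hB m') (le_max_right _ _) two_ne_zero)

theorem onCurve_of_near {e : Frame} {η R δ ν L : ℝ} (hη : η < 1)
    (S : Sizes (1 - √η) (1 - η) R δ ν L) {k m : Fin 3} {s t : ℝ}
    (hs : ν + δ ≤ s) (ht : ν + δ ≤ t) {p : E4} (hp : p ∈ frontier (U e η))
    (hpz : ‖p - quadPt e k m s t‖ < δ) :
    ν < cA e k p ∧ ν < cB e m p ∧ OnCurve (1 - √η) (1 - η) (cA e k p) (cB e m p) := by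
  have hδ := S.δ_pos
  have hR := S.R_pos
  have hRc := S.R_lt
  have hgap := S.gap
  have hν := S.δ_lt
  have hr := S.r_sq
  have hc := S.c_pos
  rw [(isOpen_U hη).frontier_eq] at hp
  obtain ⟨-, g2, g3, g4⟩ := le_of_mem_closure_U hη hp.1
  have hs0 : 0 ≤ s := by linarith
  have ht0 : 0 ≤ t := by linarith
  obtain ⟨h1, h2, h3, h4, -⟩ := coord_near hs0 ht0 hpz
  have hAν : ν < cA e k p := by linarith [(abs_lt.1 h1).1]
  have hBν : ν < cB e m p := by linarith [(abs_lt.1 h2).1]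
  have hqkm := g2 k m
  have hqe : quadSq e k m p = cA e k p ^ 2 + cB e m p ^ 2 := by
    rw [quadSq, max_eq_left (by linarith), max_eq_left (by linarith)]
  refine ⟨hAν, hBν, by linarith, by linarith, g3 k, g4 m, hqe ▸ hqkm, ?_⟩
  by_contra hcon
  push Not at hcon
  obtain ⟨f1, f2, f3⟩ := hcon
  apply hp.2
  have hδR : δ ^ 2 < R ^ 2 := pow_lt_pow_left₀ (by linarith) hδ.le two_ne_zero
  have hδc : δ ^ 2 < (1 - √η) ^ 2 := pow_lt_pow_left₀ (by linarith) hδ.le two_ne_zero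
  have mA : ∀ k', k' ≠ k → max (cA e k' p) 0 ^ 2 ≤ δ ^ 2 := fun k' hk =>
    pow_le_pow_left₀ (le_max_right _ _) (max_le (h3 k' hk).le hδ.le) 2
  have mB : ∀ m', m' ≠ m → max (cB e m' p) 0 ^ 2 ≤ δ ^ 2 := fun m' hm =>
    pow_le_pow_left₀ (le_max_right _ _) (max_le (h4 m' hm).le hδ.le) 2
  have mA' : max (cA e k p) 0 ^ 2 ≤ (1 - √η) ^ 2 :=
    pow_le_pow_left₀ (le_max_right _ _) (max_le (g3 k) hc.le) 2
  have mB' : max (cB e m p) 0 ^ 2 ≤ (1 - √η) ^ 2 :=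
    pow_le_pow_left₀ (le_max_right _ _) (max_le (g4 m) hc.le) 2
  rw [mem_U_iff hη]
  refine ⟨norm_lt_one_of_near hs0 ht0 hpz (g2 k m) S.norm_lt, fun k' m' => ?_, fun k' => ?_,
    fun m' => ?_⟩
  · by_cases hk : k' = k
    · by_cases hm : m' = m
      · rw [hk, hm]; exact lt_of_le_of_ne hqkm (hqe ▸ f3)
      · rw [quadSq, hk]; linarith [mB m' hm]
    · by_cases hm : m' = m
      · rw [quadSq, hm]; linarith [mA k' hk]
      · rw [quadSq]; linarith [mB m' hm, mA k' hk]
  · by_cases hk : k' = k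
    · rw [hk]; exact lt_of_le_of_ne (g3 k) f1
    · linarith [h3 k' hk]
  · by_cases hm : m' = m
    · rw [hm]; exact lt_of_le_of_ne (g4 m) f2
    · linarith [h4 m' hm]

/-! ### The deformed curves -/

/-- The angles of the points of the curve at distance at least `τ` from both axes. -/
def angles (c r τ : ℝ) : Set ℝ :=
  {θ | θ ∈ Icc 0 (Real.pi / 2) ∧ τ ≤ curvA c r θ ∧ τ ≤ curvB c r θ}

/-- The curve `k m` shifted by `ξ`. -/
noncomputable def graphPt (e : Frame) (c r : ℝ) (ξ : Fin 3 → Fin 3 → ℝ → E4) (k m : Fin 3)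
    (θ : ℝ) : E4 := arcPt e c r k m θ + ξ k m θ

/-- The deformed curves `Γ k m` of a sliding boundary, parametrized by the angle of the original
curve, and the displacements `ξ k m` of which the boundary is the graph in the tubes. These are
the only properties of the boundary which the estimate of the areas uses. They are symmetric
under the exchange of the two planes. -/
structure SlidingFamily (e : Frame) (c r R δ ν L : ℝ) (Γ ξ : Fin 3 → Fin 3 → ℝ → E4) : Prop where
  sizes : Sizes c r R δ ν L
  lip : ∀ k m, ∃ K : NNReal, LipschitzOnWith K (Γ k m) (Icc 0 (Real.pi / 2))
  start : ∀ k m m', Γ k m 0 = Γ k m' 0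
  finish : ∀ k k' m, Γ k m (Real.pi / 2) = Γ k' m (Real.pi / 2)
  close : ∀ k m, ∀ θ ∈ Icc 0 (Real.pi / 2), ‖Γ k m θ - arcPt e c r k m θ‖ < δ
  faceA : ∀ k m, ∀ θ ∈ Icc 0 (Real.pi / 2), curvB c r θ ≤ R - δ → cA e k (Γ k m θ) = c
  faceB : ∀ k m, ∀ θ ∈ Icc 0 (Real.pi / 2), curvA c r θ ≤ R - δ → cB e m (Γ k m θ) = c
  graph : ∀ k m, ∃ f : ℝ → ℝ, ContinuousOn f (angles c r (ν + δ)) ∧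
    ∀ θ ∈ angles c r (ν + δ), f θ ∈ angles c r ν ∧ Γ k m θ = graphPt e c r ξ k m (f θ)
  ξ_coord : ∀ k m, ∀ θ ∈ angles c r ν, cA e k (ξ k m θ) = 0 ∧ cB e m (ξ k m θ) = 0
  ξ_lt : ∀ k m, ∀ θ ∈ angles c r ν, ‖ξ k m θ‖ < δ
  ξ_lip : ∀ k m, ∀ θ ∈ angles c r ν, ∀ θ' ∈ angles c r ν,
    ‖ξ k m θ - ξ k m θ'‖ ≤ L * ‖arcPt e c r k m θ - arcPt e c r k m θ'‖

theorem mem_angles_symm {c r τ θ : ℝ} :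
    Real.pi / 2 - θ ∈ angles c r τ ↔ θ ∈ angles c r τ := by
  simp only [angles, mem_ofPred_eq, mem_symm_iff, curvA_symm, curvB_symm]
  tauto

/-- The curves run backwards, with the two planes exchanged. -/
noncomputable def flip (Γ : Fin 3 → Fin 3 → ℝ → E4) (k m : Fin 3) (θ : ℝ) : E4 :=
  Γ m k (Real.pi / 2 - θ)

theorem graphPt_flip (e : Frame) (c r : ℝ) (ξ : Fin 3 → Fin 3 → ℝ → E4) (k m : Fin 3) (θ : ℝ) :
    graphPt (swapFrame e) c r (flip ξ) m k (Real.pi / 2 - θ) = graphPt e c r ξ k m θ := by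
  rw [graphPt, graphPt, arcPt_symm, flip, sub_sub_cancel]

theorem arcPt_flip (e : Frame) (c r : ℝ) (k m : Fin 3) (θ : ℝ) :
    arcPt (swapFrame e) c r m k θ = arcPt e c r k m (Real.pi / 2 - θ) := by
  rw [← arcPt_symm e c r k m, sub_sub_cancel]

theorem SlidingFamily.flip {e : Frame} {c r R δ ν L : ℝ} {Γ ξ : Fin 3 → Fin 3 → ℝ → E4}
    (F : SlidingFamily e c r R δ ν L Γ ξ) :
    SlidingFamily (swapFrame e) c r R δ ν L (flip Γ) (flip ξ) where
  sizes := F.sizes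
  lip m k := by
    obtain ⟨K, hK⟩ := F.lip k m
    refine ⟨K, LipschitzOnWith.of_dist_le_mul fun θ hθ θ' hθ' => ?_⟩
    have := hK.dist_le_mul _ (mem_symm_iff.2 hθ) _ (mem_symm_iff.2 hθ')
    rw [YProd.flip, YProd.flip]
    rwa [dist_sub_left] at this
  start m k k' := by simpa [YProd.flip] using F.finish k k' m
  finish m m' k := by simpa [YProd.flip] using F.start k m m'
  close m k θ hθ := by
    have := F.close k m _ (mem_symm_iff.2 hθ)
    rwa [arcPt_flip]
  faceA m k θ hθ h := by
    rw [cA_swapFrame]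
    exact F.faceB k m _ (mem_symm_iff.2 hθ) (by rwa [curvA_symm])
  faceB m k θ hθ h := by
    rw [cB_swapFrame]
    exact F.faceA k m _ (mem_symm_iff.2 hθ) (by rwa [curvB_symm])
  graph m k := by
    obtain ⟨f, hf, hf'⟩ := F.graph k m
    refine ⟨fun θ => Real.pi / 2 - f (Real.pi / 2 - θ), continuousOn_const.sub
      (hf.comp (continuous_const.sub continuous_id).continuousOn
        fun θ hθ => mem_angles_symm.2 hθ), fun θ hθ => ?_⟩
    obtain ⟨h1, h2⟩ := hf' _ (mem_angles_symm.2 hθ)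
    exact ⟨mem_angles_symm.2 h1, by rw [graphPt_flip, ← h2, YProd.flip]⟩
  ξ_coord m k θ hθ := by
    rw [cA_swapFrame, cB_swapFrame]
    exact (F.ξ_coord k m _ (mem_angles_symm.2 hθ)).symm
  ξ_lt m k θ hθ := F.ξ_lt k m _ (mem_angles_symm.2 hθ)
  ξ_lip m k θ hθ θ' hθ' := by
    rw [arcPt_flip, arcPt_flip]
    exact F.ξ_lip k m _ (mem_angles_symm.2 hθ) _ (mem_angles_symm.2 hθ')

theorem norm_arcPt_sub_le {e : Frame} {c r R δ ν L : ℝ} (S : Sizes c r R δ ν L) (k m : Fin 3)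
    {θ θ' : ℝ} (h : θ ∈ Icc 0 (Real.pi / 2)) (h' : θ' ∈ Icc 0 (Real.pi / 2)) :
    ‖arcPt e c r k m θ - arcPt e c r k m θ'‖ ≤ 31 / 5 * c * |θ - θ'| := by
  obtain ⟨h1, h2⟩ := abs_curv_sub_le S.c_pos S.r_pos S.r_le h h'
  have hc := S.c_pos
  have h3 : arcPt e c r k m θ - arcPt e c r k m θ' =
      quadPt e k m (curvA c r θ - curvA c r θ') (curvB c r θ - curvB c r θ') := by
    simp only [arcPt, quadPt, sub_smul]; abel
  have h4 := norm_sq_quadPt e k m (curvA c r θ - curvA c r θ') (curvB c r θ - curvB c r θ')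
  rw [h3]
  refine abs_le_of_sq_le_sq' ?_ (by positivity) |>.2
  rw [h4, ← sq_abs (curvA c r θ - _), ← sq_abs (curvB c r θ - _)]
  have := abs_nonneg (curvA c r θ - curvA c r θ')
  have := abs_nonneg (curvB c r θ - curvB c r θ')
  have h5 : 0 ≤ c * |θ - θ'| := by positivity
  nlinarith

/-- The sizes in the theorem satisfy the relations which the proof uses. -/
theorem sizes_of_hyps {η δ ν L : ℝ} (hη₀ : 0 < η) (hη₁ : η < 1) (hδ₀ : 0 < δ) (hδ₁ : δ < R1 η)
    (hL₀ : 0 < L)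
    (hangle : Real.arctan (R3 η / (1 - √η)) < Real.pi / 16)
    (hδ₂ : δ < min ν ((R3 η - ν) / 6))
    (hL₁ : L < δ ^ 2 * R3 η / ((1 - √η) * (1 - η) ^ 2)) :
    Sizes (1 - √η) (1 - η) (R3 η) δ ν L := by
  have hq0 : 0 < √η := Real.sqrt_pos.2 hη₀
  have hq1 : √η < 1 := by rw [Real.sqrt_lt' one_pos]; linarith
  have hqq : √η ^ 2 = η := Real.sq_sqrt hη₀.le
  have hc : 0 < 1 - √η := by linarith
  have hr : 0 < 1 - η := by linarith
  obtain ⟨hδν, hδR⟩ := lt_min_iff.1 hδ₂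
  have hR : 0 < R3 η := by linarith
  have hRsq : R3 η ^ 2 = (1 - η) ^ 2 - (1 - √η) ^ 2 := by
    rw [R3, Real.sq_sqrt]; nlinarith
  have hRc : 4 * R3 η < 1 - √η := by
    have h1 : Real.pi / 16 < Real.arctan (1 / 4) := by
      have e1 : Real.arctan (1 / 4) + Real.arctan (1 / 4) = Real.arctan (8 / 15) := by
        rw [Real.arctan_add (by norm_num)]; norm_num
      have e2 : Real.arctan (8 / 15) + Real.arctan (8 / 15) = Real.arctan (240 / 161) := by
        rw [Real.arctan_add (by norm_num)]; norm_num
      have e3 : Real.pi / 4 < Real.arctan (240 / 161) := by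
        rw [← Real.arctan_one]; exact Real.arctan_strictMono (by norm_num)
      linarith
    have h2 := Real.arctan_strictMono.lt_iff_lt.1 (hangle.trans h1)
    rw [div_lt_iff₀ hc] at h2
    linarith
  have hR1 : δ ^ 2 < 1 - (1 - η) ^ 2 := by
    rw [R1] at hδ₁
    exact (Real.lt_sqrt hδ₀.le).1 hδ₁
  refine ⟨hc, hr, hR, by linarith, hRc, hδ₀, hδν, by linarith, hL₀.le, ?_, by linarith⟩
  refine hL₁.le.trans ?_
  rw [div_le_iff₀ (by positivity)]
  have h1 : δ ^ 2 ≤ (R3 η / 6) ^ 2 := pow_le_pow_left₀ hδ₀.le (by linarith) 2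
  have h2 : (R3 η) ^ 2 ≤ ((1 - √η) / 4) ^ 2 := pow_le_pow_left₀ hR.le (by linarith) 2
  have h3 : (1 - √η) ^ 2 ≤ (1 - η) ^ 2 := by nlinarith
  have h4 : δ ^ 2 ≤ (1 - √η) ^ 2 / 576 := by nlinarith
  have h5 : δ ^ 2 * R3 η ≤ (1 - √η) ^ 2 / 576 * ((1 - √η) / 4) :=
    mul_le_mul h4 (by linarith) hR.le (by positivity)
  have h6 : (1 - √η) * (1 - √η) ^ 2 ≤ (1 - √η) * (1 - η) ^ 2 := mul_le_mul_of_nonneg_left h3 hc.le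
  nlinarith [pow_pos hc 3]

theorem arcPt_mem_frontier {e : Frame} {η : ℝ} (hη₀ : 0 < η) (hη₁ : η < 1) (hc : 0 < 1 - √η)
    (k m : Fin 3) {θ : ℝ} (hθ : θ ∈ Icc 0 (Real.pi / 2)) :
    arcPt e (1 - √η) (1 - η) k m θ ∈ frontier (U e η) ∩ Z e := by
  have h := onCurve hc (sub_pos.2 hη₁) hθ
  exact ⟨(frontier_quadPt_iff hη₀ hη₁ h.1 h.2.1).2 h,
    mem_iUnion₂.2 ⟨k, m, _, _, h.1, h.2.1, rfl⟩⟩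

theorem quadPt_mem_l {e : Frame} {η ν : ℝ} (hη₀ : 0 < η) (hη₁ : η < 1) {k m : Fin 3} {s t : ℝ}
    (hst : OnCurve (1 - √η) (1 - η) s t) (hs : ν ≤ s) (ht : ν ≤ t) :
    quadPt e k m s t ∈ l e η ν k m := by
  obtain ⟨h1, -, h3, -⟩ := coord_quadPt e k m s t
  refine ⟨⟨⟨s, t, hst.1, hst.2.1, rfl⟩, (frontier_quadPt_iff hη₀ hη₁ hst.1 hst.2.1).2 hst⟩,
    ?_, ?_⟩
  · have h5 := (abs_le.1 (abs_cB_le e m (quadPt e k m s t - (1 - √η) • a e k))).2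
    have h6 : cB e m ((1 - √η) • a e k) = 0 := by
      have := (coord_quadPt e k m (1 - √η) 0).2.2.1
      simpa [quadPt] using this
    rw [cB_sub, h3, h6] at h5
    rw [dist_eq_norm]; linarith
  · have h5 := (abs_le.1 (abs_cA_le e k (quadPt e k m s t - (1 - √η) • b e m))).2
    have h6 : cA e k ((1 - √η) • b e m) = 0 := by
      have := (coord_quadPt e k m 0 (1 - √η)).1
      simpa [quadPt] using this
    rw [cA_sub, h1, h6] at h5
    rw [dist_eq_norm]; linarith

theorem arcPt_mem_l {e : Frame} {η ν : ℝ} (hη₀ : 0 < η) (hη₁ : η < 1) (hc : 0 < 1 - √η)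
    {k m : Fin 3} {θ : ℝ} (hθ : θ ∈ angles (1 - √η) (1 - η) ν) :
    arcPt e (1 - √η) (1 - η) k m θ ∈ l e η ν k m :=
  quadPt_mem_l hη₀ hη₁ (onCurve hc (sub_pos.2 hη₁) hθ.1) hθ.2.1 hθ.2.2

/-- A point of the boundary near the middle part of a curve lies in the tube and therefore on the
graph. -/
theorem eq_graph_of_near {e : Frame} {η R δ ν L : ℝ} (hη₀ : 0 < η) (hη₁ : η < 1)
    (hδ₁ : δ < R1 η) (S : Sizes (1 - √η) (1 - η) R δ ν L) {G : Set E4} {k m : Fin 3}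
    {ξ : E4 → E4} (hξQ : ∀ z ∈ l e η ν k m, ξ z ∈ Q e k m ∧ ‖ξ z‖ < R1 η)
    (hξG : G ∩ tube e η ν k m = (fun z => z + ξ z) '' l e η ν k m) {p : E4} (hpG : p ∈ G)
    (hp : p ∈ frontier (U e η)) {s t : ℝ} (hs : ν + δ ≤ s) (ht : ν + δ ≤ t)
    (hpz : ‖p - quadPt e k m s t‖ < δ) :
    p = quadPt e k m (cA e k p) (cB e m p) + ξ (quadPt e k m (cA e k p) (cB e m p)) := by
  have hδ := S.δ_pos
  have hδν := S.δ_lt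
  obtain ⟨hA, hB, hcur⟩ := onCurve_of_near hη₁ S hs ht hp hpz
  obtain ⟨g1, g2, g3, g4⟩ := coord_quadPt e k m (cA e k p) (cB e m p)
  obtain ⟨-, -, -, -, hsum⟩ := coord_near (by linarith) (by linarith) hpz
  have htube : p ∈ tube e η ν k m := by
    refine ⟨_, quadPt_mem_l hη₀ hη₁ hcur hA.le hB.le, p - quadPt e k m (cA e k p) (cB e m p),
      mem_Q_of_coord (by rw [cA_sub, g1, sub_self]) (by rw [cB_sub, g3, sub_self]), ?_,
      by abel⟩
    refine lt_trans ?_ hδ₁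
    refine (abs_lt_of_sq_lt_sq' ?_ hδ.le).2
    rw [norm_sq_eq e k m, cA_sub, cX_sub, cB_sub, cY_sub, g1, g2, g3, g4]
    nlinarith [sq_nonneg (cA e k p - s), sq_nonneg (cB e m p - t)]
  have h : p ∈ (fun z => z + ξ z) '' l e η ν k m := hξG ▸ (⟨hpG, htube⟩ : p ∈ G ∩ tube e η ν k m)
  obtain ⟨z, hzl, hzp⟩ := h
  obtain ⟨s', t', -, -, hzst⟩ := hzl.1.1
  have hQ := mem_Q_coord (hξQ z hzl).1
  replace hzst : z = quadPt e k m s' t' := hzst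
  obtain ⟨q1, -, q3, -⟩ := coord_quadPt e k m s' t'
  have hA' : cA e k p = s' := by
    rw [← hzp]; beta_reduce; rw [cA_add, hQ.1, add_zero, hzst, q1]
  have hB' : cB e m p = t' := by
    rw [← hzp]; beta_reduce; rw [cB_add, hQ.2, add_zero, hzst, q3]
  rw [hA', hB', ← hzst]
  exact hzp.symm

/-- The graph of `ξ` over a curve is covered by the image of this curve, whose points move by
less than `δ`; hence `ξ` is smaller than `δ`. -/
theorem norm_graph_lt {e : Frame} {η δ ν : ℝ} (hδν : δ < ν) {k m : Fin 3} {ψ : E4 → E4}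
    (hψ : ∀ p ∈ Z e ∩ frontier (U e η), ‖ψ p - p‖ < δ) {s t : ℝ} (hs : ν ≤ s) (ht : ν ≤ t)
    {v : E4} (hv : v ∈ Q e k m)
    (hG : quadPt e k m s t + v ∈ ψ '' (Z e ∩ frontier (U e η))) : ‖v‖ < δ := by
  obtain ⟨p, hp, hpz⟩ := hG
  have hd := hψ p hp
  obtain ⟨k', m', s', t', hs', ht', hpst⟩ := mem_iUnion₂.1 hp.1
  replace hpst : p = quadPt e k' m' s' t' := hpst
  obtain ⟨c1, c2, c3, c4⟩ := coord_quadPt e k m s t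
  have hQ := mem_Q_coord hv
  have hA : cA e k (ψ p) = s := by rw [hpz, cA_add, hQ.1, add_zero, c1]
  have hB : cB e m (ψ p) = t := by rw [hpz, cB_add, hQ.2, add_zero, c3]
  have hA' := (abs_le.1 (abs_cA_le e k (ψ p - p))).2
  have hB' := (abs_le.1 (abs_cB_le e m (ψ p - p))).2
  rw [cA_sub, hA] at hA'
  rw [cB_sub, hB] at hB'
  have hk : k = k' := by
    by_contra hne
    rw [hpst, cA_of_mem_quadrant k hne] at hA'
    rw [hpst] at hd
    linarith
  have hm : m = m' := by
    by_contra hne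
    rw [hpst, cB_of_mem_quadrant m hne] at hB'
    rw [hpst] at hd
    linarith
  subst hk hm
  obtain ⟨d1, d2, d3, d4⟩ := coord_quadPt e k m s' t'
  have hX : cX e k v = cX e k (ψ p - p) := by
    rw [cX_sub, hpz, cX_add, hpst, d2, c2]; ring
  have hY : cY e m v = cY e m (ψ p - p) := by
    rw [cY_sub, hpz, cY_add, hpst, d4, c4]; ring
  refine lt_of_le_of_lt (abs_le_of_sq_le_sq' ?_ (norm_nonneg _)).2 hd
  rw [norm_sq_eq e k m, norm_sq_eq e k m (ψ p - p), hQ.1, hQ.2, hX, hY]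
  nlinarith [sq_nonneg (cA e k (ψ p - p)), sq_nonneg (cB e m (ψ p - p))]

theorem lipschitzOnWith_arcPt {e : Frame} {c r R δ ν L : ℝ} (S : Sizes c r R δ ν L)
    (k m : Fin 3) :
    LipschitzOnWith (Real.toNNReal (31 / 5 * c)) (arcPt e c r k m) (Icc 0 (Real.pi / 2)) := by
  have := S.c_pos
  refine LipschitzOnWith.of_dist_le_mul fun θ hθ θ' hθ' => ?_
  rw [dist_eq_norm, Real.dist_eq, Real.coe_toNNReal _ (by positivity)]
  exact norm_arcPt_sub_le S k m hθ hθ'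

theorem U_swapFrame (e : Frame) {η : ℝ} (hη₁ : η < 1) : U (swapFrame e) η = U e η := by
  ext p
  rw [mem_U_iff hη₁, mem_U_iff hη₁]
  simp only [quadSq, cA_swapFrame, cB_swapFrame]
  constructor <;> rintro ⟨h1, h2, h3, h4⟩ <;>
    exact ⟨h1, fun k m => by rw [add_comm]; exact h2 m k, h4, h3⟩

theorem exists_slidingFamily {e : Frame} {η R δ ν L : ℝ} (hη₀ : 0 < η) (hη₁ : η < 1)
    (hδ₁ : δ < R1 η) (S : Sizes (1 - √η) (1 - η) R δ ν L) {G : Set E4}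
    (hG : IsSlidingBoundary e η δ ν L G) {φ : ℝ → E4 → E4}
    (hφ : IsSlidingDeformation (U e η) (frontier (U e η) ∩ Z e) δ φ)
    (hφG : φ 1 '' (frontier (U e η) ∩ Z e) = G) :
    ∃ ξ, SlidingFamily e (1 - √η) (1 - η) R δ ν L
      (fun k m θ => φ 1 (arcPt e (1 - √η) (1 - η) k m θ)) ξ := by
  choose ξ hξQ hξL hξG using hG.graph
  have hc := S.c_pos
  have hr := S.r_pos
  have h01 : (1:ℝ) ∈ Icc (0:ℝ) 1 := by simp
  have hfr := fun k m θ hθ => arcPt_mem_frontier (e := e) hη₀ hη₁ hc k m (θ := θ) hθ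
  have hdist : ∀ p ∈ frontier (U e η) ∩ Z e, ‖φ 1 p - p‖ < δ := fun p hp => by
    rw [← dist_eq_norm]; exact hφ.close 1 h01 p ⟨hp, hp.1⟩
  have hlip : ∀ k m, ∃ K : NNReal, LipschitzOnWith K
      (fun θ => φ 1 (arcPt e (1 - √η) (1 - η) k m θ)) (Icc 0 (Real.pi / 2)) := by
    intro k m
    obtain ⟨K, hK⟩ := hφ.lip
    exact ⟨_, hK.comp (lipschitzOnWith_arcPt S k m)
      fun θ hθ => frontier_subset_closure (hfr k m θ hθ).1⟩
  refine ⟨fun k m θ => ξ k m (arcPt e (1 - √η) (1 - η) k m θ), S, hlip, ?_, ?_, ?_, ?_, ?_, ?_,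
    ?_, ?_, ?_⟩
  · intro k m m'
    have : ∀ m, arcPt e (1 - √η) (1 - η) k m 0 =
        quadPt e k 0 (curvA (1 - √η) (1 - η) 0) 0 := fun m => by
      simp [arcPt, quadPt, curvB]
    simp only [this]
  · intro k k' m
    have : ∀ k, arcPt e (1 - √η) (1 - η) k m (Real.pi / 2) =
        quadPt e 0 m 0 (curvB (1 - √η) (1 - η) (Real.pi / 2)) :=
      fun k => by simp [arcPt, quadPt, curvA]
    simp only [this]
  · exact fun k m θ hθ => hdist _ (hfr k m θ hθ)
  · exact fun k m θ hθ h => cA_eq_of_near_face hη₁ S (onCurve hc hr hθ) h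
      (hφ.slide 1 h01 (hfr k m θ hθ).1) (hdist _ (hfr k m θ hθ))
  · intro k m θ hθ h
    have h1 := hφ.slide 1 h01 (hfr k m θ hθ).1
    rw [← U_swapFrame e hη₁] at h1
    have h2 := hdist _ (hfr k m θ hθ)
    rw [← arcPt_symm] at h1 h2
    have h3 := cA_eq_of_near_face hη₁ S (onCurve hc hr (mem_symm_iff.2 hθ))
      (by rwa [curvB_symm]) h1 h2
    rwa [cA_swapFrame, arcPt_symm] at h3
  · intro k m
    have hkey := fun θ (hθ : θ ∈ angles (1 - √η) (1 - η) (ν + δ)) =>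
      onCurve_of_near (k := k) (m := m) hη₁ S hθ.2.1 hθ.2.2
        (hφ.slide 1 h01 (hfr k m θ hθ.1).1) (hdist _ (hfr k m θ hθ.1))
    obtain ⟨K, hK⟩ := hlip k m
    refine ⟨fun θ => Complex.arg ⟨cA e k (φ 1 (arcPt e (1 - √η) (1 - η) k m θ)),
      cB e m (φ 1 (arcPt e (1 - √η) (1 - η) k m θ))⟩, ?_, fun θ hθ => ?_⟩
    · intro θ hθ
      have h3 := (Complex.equivRealProdCLM.symm.continuous.comp
        ((continuous_cA e k).prodMk (continuous_cB e m))).comp_continuousOn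
        (hK.continuousOn.mono fun θ (hθ : θ ∈ angles (1 - √η) (1 - η) (ν + δ)) => hθ.1)
      have h2 : ContinuousOn (fun θ => (⟨cA e k (φ 1 (arcPt e (1 - √η) (1 - η) k m θ)),
          cB e m (φ 1 (arcPt e (1 - √η) (1 - η) k m θ))⟩ : ℂ))
          (angles (1 - √η) (1 - η) (ν + δ)) := by
        refine h3.congr fun θ _ => ?_
        apply Complex.ext <;> simp
      refine (Complex.continuousAt_arg ?_).comp_continuousWithinAt (h2 θ hθ)
      exact Or.inl (by
        have := S.δ_lt; have := S.δ_pos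
        linarith [(hkey θ hθ).1] :
        (0:ℝ) < cA e k (φ 1 (arcPt e (1 - √η) (1 - η) k m θ)))
    · obtain ⟨hA, hB, hcur⟩ := hkey θ hθ
      obtain ⟨h1, h2, h3⟩ := curv_arg hr hcur
      refine ⟨⟨h1, by rw [h2]; exact hA.le, by rw [h3]; exact hB.le⟩, ?_⟩
      have := eq_graph_of_near hη₀ hη₁ hδ₁ S (hξQ k m) (hξG k m)
        (hφG ▸ mem_image_of_mem _ (hfr k m θ hθ.1)) (hφ.slide 1 h01 (hfr k m θ hθ.1).1)
        hθ.2.1 hθ.2.2 (hdist _ (hfr k m θ hθ.1))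
      have hz : arcPt e (1 - √η) (1 - η) k m
          (⟨cA e k (φ 1 (arcPt e (1 - √η) (1 - η) k m θ)),
            cB e m (φ 1 (arcPt e (1 - √η) (1 - η) k m θ))⟩ : ℂ).arg =
          quadPt e k m (cA e k (φ 1 (arcPt e (1 - √η) (1 - η) k m θ)))
            (cB e m (φ 1 (arcPt e (1 - √η) (1 - η) k m θ))) := by
        conv_lhs => rw [arcPt, h2, h3]
      rw [graphPt]
      beta_reduce
      rw [hz]
      exact this
  · exact fun k m θ hθ => mem_Q_coord (hξQ k m _ (arcPt_mem_l hη₀ hη₁ hc hθ)).1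
  · intro k m θ hθ
    have hl := arcPt_mem_l (e := e) hη₀ hη₁ hc (k := k) (m := m) hθ
    refine norm_graph_lt (ψ := φ 1) S.δ_lt (fun p hp => hdist p hp.symm) hθ.2.1 hθ.2.2
      (hξQ k m _ hl).1 ?_
    rw [inter_comm, hφG]
    have : _ ∈ G ∩ tube e η ν k m := hξG k m ▸ mem_image_of_mem _ hl
    exact this.1
  · exact fun k m θ hθ θ' hθ' => hξL k m _ (arcPt_mem_l hη₀ hη₁ hc hθ) _
      (arcPt_mem_l hη₀ hη₁ hc hθ')

/-! ### The projected curves near the faces -/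

theorem fin3_add (i : Fin 3) :
    i + 1 + 1 = i + 2 ∧ i + 1 + 2 = i ∧ i + 2 + 1 = i ∧ i + 2 + 2 = i + 1 := by
  revert i; decide

theorem cX_eq_one (e : Frame) (i : Fin 3) (p : E4) :
    cX e i p = √3 / 2 * cA e (i + 1) p - 1 / 2 * cX e (i + 1) p := by
  rw [← cX_add_two, (fin3_add i).2.1]

theorem cX_eq_two (e : Frame) (i : Fin 3) (p : E4) :
    cX e i p = -(√3 / 2) * cA e (i + 2) p - 1 / 2 * cX e (i + 2) p := by
  rw [← cX_add_one, (fin3_add i).2.2.1]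

theorem cY_eq_one (e : Frame) (i : Fin 3) (p : E4) :
    cY e i p = √3 / 2 * cB e (i + 1) p - 1 / 2 * cY e (i + 1) p := by
  rw [← cY_add_two, (fin3_add i).2.1]

theorem cY_eq_two (e : Frame) (i : Fin 3) (p : E4) :
    cY e i p = -(√3 / 2) * cB e (i + 2) p - 1 / 2 * cY e (i + 2) p := by
  rw [← cY_add_one, (fin3_add i).2.2.1]

theorem sqrt_three_bounds : 0.866 < √(3:ℝ) / 2 ∧ √(3:ℝ) / 2 < 0.8661 := by
  constructor
  · rw [lt_div_iff₀ two_pos]; exact Real.lt_sqrt_of_sq_lt (by norm_num)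
  · rw [div_lt_iff₀ two_pos, Real.sqrt_lt' (by norm_num)]; norm_num

theorem q_re (e : Frame) (i j : Fin 3) (p : E4) : (q e i j p).re = cX e i p := rfl

theorem q_im (e : Frame) (i j : Fin 3) (p : E4) : (q e i j p).im = cY e j p := rfl

namespace SlidingFamily

variable {e : Frame} {c r R δ ν L : ℝ} {Γ ξ : Fin 3 → Fin 3 → ℝ → E4}

theorem curv_nonneg (F : SlidingFamily e c r R δ ν L Γ ξ) {θ : ℝ} (hθ : θ ∈ Icc 0 (Real.pi / 2)) :
    0 ≤ curvA c r θ ∧ 0 ≤ curvB c r θ :=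
  ⟨(onCurve F.sizes.c_pos F.sizes.r_pos hθ).1, (onCurve F.sizes.c_pos F.sizes.r_pos hθ).2.1⟩

theorem cY_near (F : SlidingFamily e c r R δ ν L Γ ξ) (k j : Fin 3) {θ : ℝ}
    (hθ : θ ∈ Icc 0 (Real.pi / 2)) :
    |cY e j (Γ k (j + 1) θ) - √3 / 2 * curvB c r θ| < δ ∧
      |cY e j (Γ k (j + 2) θ) + √3 / 2 * curvB c r θ| < δ := by
  constructor
  · have h := (abs_cY_le e j _).trans_lt (F.close k (j + 1) θ hθ)
    obtain ⟨-, -, h3, h4⟩ := coord_quadPt e k (j + 1) (curvA c r θ) (curvB c r θ)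
    rw [cY_sub, cY_eq_one e j (arcPt _ _ _ _ _ _), arcPt, h3, h4, mul_zero, sub_zero] at h
    exact h
  · have h := (abs_cY_le e j _).trans_lt (F.close k (j + 2) θ hθ)
    obtain ⟨-, -, h3, h4⟩ := coord_quadPt e k (j + 2) (curvA c r θ) (curvB c r θ)
    rw [cY_sub, cY_eq_two e j (arcPt _ _ _ _ _ _), arcPt, h3, h4, mul_zero, sub_zero, neg_mul,
      sub_neg_eq_add] at h
    exact h

theorem abs_cX_lt (F : SlidingFamily e c r R δ ν L Γ ξ) (k m : Fin 3) {θ : ℝ}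
    (hθ : θ ∈ Icc 0 (Real.pi / 2)) : |cX e k (Γ k m θ)| < δ := by
  have h := (abs_cX_le e k _).trans_lt (F.close k m θ hθ)
  obtain ⟨-, h2, -, -⟩ := coord_quadPt e k m (curvA c r θ) (curvB c r θ)
  rwa [cX_sub, arcPt, h2, sub_zero] at h

theorem abs_cB_lt (F : SlidingFamily e c r R δ ν L Γ ξ) (k m : Fin 3) {θ : ℝ}
    (hθ : θ ∈ Icc 0 (Real.pi / 2)) : |cB e m (Γ k m θ) - curvB c r θ| < δ := by
  have h := (abs_cB_le e m _).trans_lt (F.close k m θ hθ)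
  obtain ⟨-, -, h2, -⟩ := coord_quadPt e k m (curvA c r θ) (curvB c r θ)
  rwa [cB_sub, arcPt, h2] at h

theorem continuousOn_q (F : SlidingFamily e c r R δ ν L Γ ξ) (i j k m : Fin 3) :
    ContinuousOn (fun θ => q e i j (Γ k m θ)) (Icc 0 (Real.pi / 2)) := by
  obtain ⟨K, hK⟩ := F.lip k m
  exact (continuous_q e i j).comp_continuousOn hK.continuousOn

end SlidingFamily

/-! ### Pairs of boxes around the images of a face -/

/-- The sum of the winding parities of the four projected curves. -/
noncomputable def sumPar (e : Frame) (Γ : Fin 3 → Fin 3 → ℝ → E4) (i j : Fin 3) (p : ℂ) : ZMod 2 :=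
  par p (fun θ => q e i j (Γ (i + 1) (j + 1) θ)) 0 (Real.pi / 2) +
  par p (fun θ => q e i j (Γ (i + 1) (j + 2) θ)) 0 (Real.pi / 2) +
  (par p (fun θ => q e i j (Γ (i + 2) (j + 1) θ)) 0 (Real.pi / 2) +
  par p (fun θ => q e i j (Γ (i + 2) (j + 2) θ)) 0 (Real.pi / 2))

/-- The point `p` does not lie on the four projected curves. -/
def OffCurves (e : Frame) (Γ : Fin 3 → Fin 3 → ℝ → E4) (i j : Fin 3) (p : ℂ) : Prop :=
  ∀ k m, ∀ θ ∈ Icc 0 (Real.pi / 2), q e i j (Γ k m θ) ≠ p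

theorem par_eq_near_of_far_above {p : ℂ} {γ : ℝ → ℂ} {t : ℝ} (ht : t ∈ Icc 0 (Real.pi / 2))
    (hγ : ContinuousOn γ (Icc 0 (Real.pi / 2))) (hp : ∀ θ ∈ Icc 0 (Real.pi / 2), γ θ ≠ p)
    (hfar : ∀ θ ∈ Icc t (Real.pi / 2), (γ θ).im ≠ p.im) :
    par p γ 0 (Real.pi / 2) = par p γ 0 t := by
  have h0 : (0:ℝ) ∈ Icc 0 (Real.pi / 2) := ⟨le_rfl, by positivity⟩
  have h1 : Real.pi / 2 ∈ Icc 0 (Real.pi / 2) := ⟨by positivity, le_rfl⟩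
  rw [← par_add hγ hp h0 ht h1, par_of_avoid_left (s := t) (t := Real.pi / 2), add_zero]
  · rw [uIcc_of_le ht.2]; exact hγ.mono (Icc_subset_Icc_left ht.1)
  · rw [uIcc_of_le ht.2]; exact fun θ hθ h => absurd h (hfar θ hθ)

/-- Around the image of a face, the winding parities in the two planes which see the face from
opposite sides add up to one: the parts of the curves in the face project to translates of each
other, so that their contributions cancel, and of the other parts exactly one crosses, once, the
horizontal ray to the left of the point. -/
theorem SlidingFamily.sumPar_add {e : Frame} {c r R δ ν L : ℝ} {Γ ξ : Fin 3 → Fin 3 → ℝ → E4}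
    (F : SlidingFamily e c r R δ ν L Γ ξ) (i j : Fin 3) {p : ℂ}
    (hre : |p.re - √3 / 2 * c| ≤ δ) (him : |p.im| ≤ √3 / 2 * (ν + 3 * δ) + δ / 2)
    (hoff : OffCurves e Γ i j p) :
    sumPar e Γ i j p + sumPar e Γ (i + 2) j (p - (√3 * c : ℝ)) = 1 := by
  have hc := F.sizes.c_pos
  have hr := F.sizes.r_pos
  have hδ := F.sizes.δ_pos
  have hδν := F.sizes.δ_lt
  have hgap := F.sizes.gap
  have hRc := F.sizes.R_lt
  have hR := F.sizes.R_pos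
  obtain ⟨s1, s2⟩ := sqrt_three_bounds
  obtain ⟨i1, i2, i3, i4⟩ := fin3_add i
  obtain ⟨hre1, hre2⟩ := abs_le.1 hre
  obtain ⟨him1, him2⟩ := abs_le.1 him
  have hνδ : 0 ≤ ν + 5 * δ := by linarith
  have hνR : ν + 5 * δ ≤ R := by linarith
  have hle := fun θ hθ => le_curvB_iff hc hr F.sizes.r_sq (by linarith) hνδ hνR (θ := θ) hθ
  obtain ⟨ht1, -, -⟩ := onCurve_arctan hc hr F.sizes.r_sq (by linarith) hνδ hνR
  set θ₁ := Real.arctan ((ν + 5 * δ) / c) with hθ₁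
  have h0 : (0:ℝ) ∈ Icc 0 (Real.pi / 2) := ⟨le_rfl, by positivity⟩
  have h1 : Real.pi / 2 ∈ Icc 0 (Real.pi / 2) := ⟨by positivity, le_rfl⟩
  -- beyond the face, the curves lie above or below the boxes
  have hup : ∀ k, ∀ θ ∈ Icc θ₁ (Real.pi / 2), p.im < cY e j (Γ k (j + 1) θ) := by
    intro k θ hθ
    have hθI : θ ∈ Icc 0 (Real.pi / 2) := ⟨ht1.1.trans hθ.1, hθ.2⟩
    have := (abs_lt.1 (F.cY_near k j hθI).1).1
    have h2 := (hle θ hθI).2 hθ.1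
    nlinarith
  have hdown : ∀ k, ∀ θ ∈ Icc θ₁ (Real.pi / 2), cY e j (Γ k (j + 2) θ) < p.im := by
    intro k θ hθ
    have hθI : θ ∈ Icc 0 (Real.pi / 2) := ⟨ht1.1.trans hθ.1, hθ.2⟩
    have := (abs_lt.1 (F.cY_near k j hθI).2).2
    have h2 := (hle θ hθI).2 hθ.1
    nlinarith
  have hface : ∀ k m, ∀ θ ∈ Icc 0 θ₁, cA e k (Γ k m θ) = c := by
    intro k m θ hθ
    have hθI : θ ∈ Icc 0 (Real.pi / 2) := ⟨hθ.1, hθ.2.trans ht1.2⟩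
    refine F.faceA k m θ hθI ?_
    have h2 := curvB_mono hc hr hθI ht1 hθ.2
    have h3 := (onCurve_arctan hc hr F.sizes.r_sq (by linarith) hνδ hνR).2.2
    rw [← hθ₁] at h3
    linarith
  have hlevel : ∀ k m, (m = j + 1 ∨ m = j + 2) → ∀ θ ∈ Icc 0 (Real.pi / 2),
      cY e j (Γ k m θ) = p.im → cA e k (Γ k m θ) = c := by
    intro k m hm θ hθ him
    rcases le_total θ θ₁ with h | h
    · exact hface k m θ ⟨hθ.1, h⟩
    · rcases hm with rfl | rfl
      · exact absurd him (hup k θ ⟨h, hθ.2⟩).ne'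
      · exact absurd him (hdown k θ ⟨h, hθ.2⟩).ne
  -- the curves through the face
  have hright : ∀ m, (m = j + 1 ∨ m = j + 2) →
      par p (fun θ => q e i j (Γ (i + 1) m θ)) 0 (Real.pi / 2) =
      par (p - (√3 * c : ℝ)) (fun θ => q e (i + 2) j (Γ (i + 1) m θ)) 0 (Real.pi / 2) := by
    intro m hm
    have hfar : ∀ θ ∈ Icc θ₁ (Real.pi / 2), cY e j (Γ (i + 1) m θ) ≠ p.im := by
      rcases hm with rfl | rfl
      · exact fun θ hθ => (hup _ θ hθ).ne'
      · exact fun θ hθ => (hdown _ θ hθ).ne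
    have hshift : ∀ θ ∈ Icc 0 θ₁, q e i j (Γ (i + 1) m θ) - p =
        q e (i + 2) j (Γ (i + 1) m θ) - (p - (√3 * c : ℝ)) := by
      intro θ hθ
      have e1 := cX_eq_one e i (Γ (i + 1) m θ)
      have e2 := cX_eq_two e (i + 2) (Γ (i + 1) m θ)
      rw [i4, hface _ m θ hθ] at e2
      rw [hface _ m θ hθ] at e1
      apply Complex.ext
      · simp only [Complex.sub_re, q_re, Complex.ofReal_re]; linarith
      · simp only [Complex.sub_im, q_im, Complex.ofReal_im]; ring
    rw [par_eq_near_of_far_above ht1 (F.continuousOn_q i j _ m) (hoff (i + 1) m) hfar,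
      par_eq_near_of_far_above ht1 (F.continuousOn_q (i + 2) j _ m)]
    · refine par_congr_sub ?_
      rw [uIcc_of_le ht1.1]; exact hshift
    · intro θ hθ heq
      rcases le_total θ θ₁ with h | h
      · have := hshift θ ⟨hθ.1, h⟩
        rw [heq, sub_self, sub_eq_zero] at this
        exact hoff _ _ θ hθ this
      · refine hfar θ ⟨h, hθ.2⟩ ?_
        rw [← q_im e (i + 2) j, heq]; simp
    · intro θ hθ
      simpa [q_im] using hfar θ hθ
  -- the curves on the far left
  have hleft : ∀ m, (m = j + 1 ∨ m = j + 2) →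
      par p (fun θ => q e i j (Γ (i + 2) m θ)) 0 (Real.pi / 2) =
      side p (q e i j (Γ (i + 2) m 0)) + side p (q e i j (Γ (i + 2) m (Real.pi / 2))) := by
    intro m hm
    refine par_of_avoid_right (by rw [uIcc_of_le h0.2]; exact F.continuousOn_q i j _ m) ?_
    rw [uIcc_of_le h0.2]
    intro θ hθ him
    rw [q_re, cX_eq_two, hlevel _ m hm θ hθ him]
    have := (abs_lt.1 (F.abs_cX_lt (i + 2) m hθ)).1
    nlinarith
  have hright' : ∀ m, (m = j + 1 ∨ m = j + 2) →
      par (p - (√3 * c : ℝ)) (fun θ => q e (i + 2) j (Γ i m θ)) 0 (Real.pi / 2) = 0 := by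
    intro m hm
    refine par_of_avoid_left (by rw [uIcc_of_le h0.2]; exact F.continuousOn_q _ j _ m) ?_
    rw [uIcc_of_le h0.2]
    intro θ hθ him
    have e1 := cX_eq_one e (i + 2) (Γ i m θ)
    rw [i3, hlevel i m hm θ hθ (by simpa [q_im] using him)] at e1
    rw [q_re, e1, Complex.sub_re, Complex.ofReal_re]
    have := (abs_lt.1 (F.abs_cX_lt i m hθ)).2
    nlinarith
  have sup : side p (q e i j (Γ (i + 2) (j + 1) (Real.pi / 2))) = 0 := by
    rw [side, if_neg]
    rw [Complex.sub_im, q_im, not_lt, sub_nonneg]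
    exact (hup _ _ ⟨ht1.2, le_rfl⟩).le
  have sdown : side p (q e i j (Γ (i + 2) (j + 2) (Real.pi / 2))) = 1 := by
    rw [side, if_pos]
    rw [Complex.sub_im, q_im, sub_neg]
    exact hdown _ _ ⟨ht1.2, le_rfl⟩
  rw [sumPar, sumPar, i3, i4, hright _ (Or.inl rfl), hright _ (Or.inr rfl), hleft _ (Or.inl rfl),
    hleft _ (Or.inr rfl), hright' _ (Or.inl rfl), hright' _ (Or.inr rfl), sup, sdown,
    F.start (i + 2) (j + 1) (j + 2)]
  generalize side p _ = w
  generalize par _ _ 0 _ = u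
  generalize par _ _ 0 _ = v
  revert u v w; decide

theorem par_self (p : ℂ) (γ : ℝ → ℂ) (t : ℝ) : par p γ t t = 0 := by
  by_cases h : ∃ g : ℝ → ℝ, IsArgLift p γ (uIcc t t) g
  · obtain ⟨g, hg⟩ := h
    rw [par_eq hg (n := 0) (by simp)]; simp
  · rw [par, dif_neg h]

theorem par_symm {p : ℂ} {γ : ℝ → ℂ} {a b : ℝ} (hab : a ≤ b) (hγ : ContinuousOn γ (Icc a b))
    (hp : ∀ x ∈ Icc a b, γ x ≠ p) : par p γ b a = par p γ a b := by
  have h := par_add hγ hp (left_mem_Icc.2 hab) (right_mem_Icc.2 hab) (left_mem_Icc.2 hab)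
  rw [par_self] at h
  have : ∀ u v : ZMod 2, u + v = 0 → v = u := by decide
  exact this _ _ h

/-- The winding parity is compatible with the exchange of the two planes. -/
theorem SlidingFamily.sumPar_flip {e : Frame} {c r R δ ν L : ℝ} {Γ ξ : Fin 3 → Fin 3 → ℝ → E4}
    (F : SlidingFamily e c r R δ ν L Γ ξ) (i j : Fin 3) {p : ℂ} (hoff : OffCurves e Γ i j p) :
    sumPar (swapFrame e) (YProd.flip Γ) j i (swap p) = sumPar e Γ i j p := by
  obtain ⟨ε, hε⟩ := par_swap p
  have h02 : (0:ℝ) ≤ Real.pi / 2 := by positivity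
  have key : ∀ k m, par (swap p) (fun θ => q (swapFrame e) j i (YProd.flip Γ m k θ)) 0
      (Real.pi / 2) = par p (fun θ => q e i j (Γ k m θ)) 0 (Real.pi / 2) +
        ε (q e i j (Γ k m (Real.pi / 2))) + ε (q e i j (Γ k m 0)) := by
    intro k m
    have hcont := F.continuousOn_q i j k m
    have hmaps : MapsTo (fun θ => Real.pi / 2 - θ) (Icc 0 (Real.pi / 2)) (Icc 0 (Real.pi / 2)) :=
      fun θ hθ => mem_symm_iff.2 hθ
    have hsub : ContinuousOn (fun θ : ℝ => Real.pi / 2 - θ) (uIcc 0 (Real.pi / 2)) := by fun_prop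
    have h1 : par (swap p) (fun θ => q (swapFrame e) j i (YProd.flip Γ m k θ)) 0 (Real.pi / 2) =
        par (swap p) (fun θ => swap (q e i j (Γ k m (Real.pi / 2 - θ)))) 0 (Real.pi / 2) :=
      par_congr fun θ _ => by
        rw [q_swapFrame]; rfl
    have h2 := hε (fun θ => q e i j (Γ k m (Real.pi / 2 - θ))) 0 (Real.pi / 2)
    have h3 := par_comp (p := p) (γ := fun θ => q e i j (Γ k m θ))
      (f := fun θ => Real.pi / 2 - θ) (a := 0) (b := Real.pi / 2) hsub
      (by rw [uIcc_of_le h02]; exact hmaps) hcont (hoff k m)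
    rw [uIcc_of_le h02] at h2
    rw [h1, h2 (hcont.comp (by fun_prop) hmaps) (fun θ hθ => hoff k m _ (hmaps hθ)), h3, sub_zero,
      sub_self, par_symm h02 hcont (hoff k m)]
  simp only [sumPar, key]
  rw [F.start (i + 1) (j + 1) (j + 2), F.start (i + 2) (j + 1) (j + 2),
    F.finish (i + 1) (i + 2) (j + 1), F.finish (i + 1) (i + 2) (j + 2)]
  generalize par p _ 0 _ = u1
  generalize par p _ 0 _ = u2
  generalize par p _ 0 _ = u3
  generalize par p _ 0 _ = u4
  generalize ε _ = w1
  generalize ε _ = w2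
  generalize ε _ = w3
  generalize ε _ = w4
  have : ∀ w : ZMod 2, w + w = 0 := by decide
  linear_combination this w1 + this w2 + this w3 + this w4

/-! ### The shifted curves and the boxes which contain the ends of the deformed curves -/

/-- The side, right or left, on which the image of `a k` lies in a plane `Q i j` with `i ≠ k`, or,
in the same way, the side, upper or lower, on which the image of `b k` lies in `Q j i`. -/
noncomputable def sg (i k : Fin 3) : ℝ := if k = i + 1 then 1 else -1

theorem sg_mul_self (i k : Fin 3) : sg i k * sg i k = 1 := by
  unfold sg; split_ifs <;> norm_num

theorem abs_sg (i k : Fin 3) : |sg i k| = 1 := by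
  unfold sg; split_ifs <;> norm_num

theorem eq_of_ne {i k : Fin 3} (h : k ≠ i) : k = i + 1 ∨ k = i + 2 := by
  revert i k; decide

theorem add_one_ne (i : Fin 3) : i + 1 ≠ i := by
  revert i; decide

theorem add_two_ne (i : Fin 3) : i + 2 ≠ i := by
  revert i; decide

theorem sg_one (i : Fin 3) : sg i (i + 1) = 1 := if_pos rfl

theorem sg_two (i : Fin 3) : sg i (i + 2) = -1 := if_neg (by revert i; decide)

theorem sg_of_ne {i k k' : Fin 3} (h : k ≠ i) (h' : k' ≠ i) (hk : k ≠ k') : sg i k' = -sg i k := by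
  rcases eq_of_ne h with rfl | rfl <;> rcases eq_of_ne h' with rfl | rfl
  · exact absurd rfl hk
  · rw [sg_one, sg_two]
  · rw [sg_one, sg_two, neg_neg]
  · exact absurd rfl hk

theorem cX_eq_sg (e : Frame) {i k : Fin 3} (h : k ≠ i) (p : E4) :
    cX e i p = sg i k * (√3 / 2 * cA e k p) - 1 / 2 * cX e k p := by
  rcases eq_of_ne h with rfl | rfl
  · rw [sg_one, cX_eq_one]; ring
  · rw [sg_two, cX_eq_two]; ring

theorem cY_eq_sg (e : Frame) {j m : Fin 3} (h : m ≠ j) (p : E4) :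
    cY e j p = sg j m * (√3 / 2 * cB e m p) - 1 / 2 * cY e m p := by
  simpa [cX_swapFrame, cA_swapFrame] using cX_eq_sg (swapFrame e) h p

theorem angles_eq {c r R δ ν L τ : ℝ} (S : Sizes c r R δ ν L) (h0 : 0 ≤ τ) (hτ : τ ≤ R) :
    angles c r τ = Icc (Real.arctan (τ / c)) (Real.pi / 2 - Real.arctan (τ / c)) := by
  have hRc : R < c := by linarith [S.R_lt, S.R_pos]
  have hle := fun θ hθ => le_curvB_iff S.c_pos S.r_pos S.r_sq hRc h0 hτ (θ := θ) hθ
  obtain ⟨h1, -, -⟩ := onCurve_arctan S.c_pos S.r_pos S.r_sq hRc h0 hτ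
  ext θ
  constructor
  · rintro ⟨hθ, hA, hB⟩
    rw [← curvB_symm] at hA
    have := (hle _ (mem_symm_iff.2 hθ)).1 hA
    exact ⟨(hle _ hθ).1 hB, by linarith⟩
  · rintro ⟨ha, hb⟩
    have hθ : θ ∈ Icc 0 (Real.pi / 2) := ⟨h1.1.trans ha, by linarith [h1.1]⟩
    refine ⟨hθ, ?_, (hle _ hθ).2 ha⟩
    rw [← curvB_symm]
    exact (hle _ (mem_symm_iff.2 hθ)).2 (by linarith)

/-- The angle of the point at height `ν + 3 δ` on the face; from here on, the deformed curves are
replaced by polygons. -/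
noncomputable def cutAngle (c δ ν : ℝ) : ℝ := Real.arctan ((ν + 3 * δ) / c)

/-- A rectangle in the plane `Q i j` around the image of the part of the face of `a k` at height at
most `ν + 3 δ`. It ends exactly at the heights of the images of the points of the two shifted curves
at the angle `cutAngle`, so that these curves leave it there. -/
def box (e : Frame) (c r δ ν : ℝ) (ξ : Fin 3 → Fin 3 → ℝ → E4) (i j k : Fin 3) : Set ℂ :=
  {z | |z.re - sg i k * (√3 / 2 * c)| ≤ δ ∧ ∀ m, m ≠ j →
    sg j m * z.im ≤ sg j m * cY e j (graphPt e c r ξ k m (cutAngle c δ ν))}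

theorem convex_box (e : Frame) (c r δ ν : ℝ) (ξ : Fin 3 → Fin 3 → ℝ → E4) (i j k : Fin 3) :
    Convex ℝ (box e c r δ ν ξ i j k) := by
  rintro z ⟨h1, h2⟩ w ⟨h3, h4⟩ s t hs ht hst
  rw [abs_le] at h1 h3
  refine ⟨abs_le.2 ?_, fun m hm => ?_⟩
  · obtain rfl : t = 1 - s := by linarith
    simp only [Complex.add_re, Complex.smul_re, smul_eq_mul]
    generalize sg i k * (√3 / 2 * c) = x at *
    constructor
    · linear_combination mul_le_mul_of_nonneg_left h1.1 hs + mul_le_mul_of_nonneg_left h3.1 ht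
    · linear_combination mul_le_mul_of_nonneg_left h1.2 hs + mul_le_mul_of_nonneg_left h3.2 ht
  · obtain rfl : t = 1 - s := by linarith
    simp only [Complex.add_im, Complex.smul_im, smul_eq_mul]
    linear_combination mul_le_mul_of_nonneg_left (h2 m hm) hs +
      mul_le_mul_of_nonneg_left (h4 m hm) ht

theorem isClosed_box (e : Frame) (c r δ ν : ℝ) (ξ : Fin 3 → Fin 3 → ℝ → E4) (i j k : Fin 3) :
    IsClosed (box e c r δ ν ξ i j k) := by
  have hre := Complex.continuous_re
  have him := Complex.continuous_im
  have h : box e c r δ ν ξ i j k = {z | |z.re - sg i k * (√3 / 2 * c)| ≤ δ} ∩ ⋂ m, ⋂ (_ : m ≠ j),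
      {z | sg j m * z.im ≤ sg j m * cY e j (graphPt e c r ξ k m (cutAngle c δ ν))} := by
    ext z; simp only [box, mem_inter_iff, mem_iInter, mem_ofPred_eq]
  rw [h]
  refine (isClosed_le (by fun_prop) continuous_const).inter ?_
  refine isClosed_iInter fun m => isClosed_iInter fun _ => ?_
  exact isClosed_le (continuous_const.mul him) continuous_const

namespace SlidingFamily

variable {e : Frame} {c r R δ ν L : ℝ} {Γ ξ : Fin 3 → Fin 3 → ℝ → E4}

theorem coord_graphPt (F : SlidingFamily e c r R δ ν L Γ ξ) (k m : Fin 3) {θ : ℝ}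
    (hθ : θ ∈ angles c r ν) :
    cA e k (graphPt e c r ξ k m θ) = curvA c r θ ∧ cB e m (graphPt e c r ξ k m θ) = curvB c r θ ∧
      cX e k (graphPt e c r ξ k m θ) = cX e k (ξ k m θ) ∧
      cY e m (graphPt e c r ξ k m θ) = cY e m (ξ k m θ) := by
  obtain ⟨h1, h2, h3, h4⟩ := coord_quadPt e k m (curvA c r θ) (curvB c r θ)
  obtain ⟨h5, h6⟩ := F.ξ_coord k m θ hθ
  refine ⟨?_, ?_, ?_, ?_⟩
  · rw [graphPt, cA_add, arcPt, h1, h5, add_zero]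
  · rw [graphPt, cB_add, arcPt, h3, h6, add_zero]
  · rw [graphPt, cX_add, arcPt, h2, zero_add]
  · rw [graphPt, cY_add, arcPt, h4, zero_add]

theorem cutAngle_spec (F : SlidingFamily e c r R δ ν L Γ ξ) :
    cutAngle c δ ν ∈ Icc 0 (Real.pi / 2) ∧ curvA c r (cutAngle c δ ν) = c ∧
      curvB c r (cutAngle c δ ν) = ν + 3 * δ :=
  onCurve_arctan F.sizes.c_pos F.sizes.r_pos F.sizes.r_sq
    (by linarith [F.sizes.R_lt, F.sizes.R_pos]) (by linarith [F.sizes.δ_pos, F.sizes.δ_lt])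
    (by linarith [F.sizes.δ_pos, F.sizes.gap])

theorem cutAngle_mem (F : SlidingFamily e c r R δ ν L Γ ξ) : cutAngle c δ ν ∈ angles c r ν := by
  obtain ⟨h1, h2, h3⟩ := F.cutAngle_spec
  have := F.sizes.δ_pos; have := F.sizes.gap; have := F.sizes.R_lt; have := F.sizes.R_pos
  have := F.sizes.δ_lt
  exact ⟨h1, by linarith, by linarith⟩

theorem Icc_subset_angles (F : SlidingFamily e c r R δ ν L Γ ξ) :
    Icc (cutAngle c δ ν) (Real.pi / 2 - cutAngle c δ ν) ⊆ angles c r ν := by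
  have := F.sizes.δ_pos; have := F.sizes.gap; have := F.sizes.R_lt; have := F.sizes.R_pos
  have := F.sizes.δ_lt
  rw [cutAngle, ← angles_eq F.sizes (by linarith) (by linarith)]
  rintro θ ⟨h1, h2, h3⟩
  exact ⟨h1, by linarith, by linarith⟩

theorem cutAngle_lt (F : SlidingFamily e c r R δ ν L Γ ξ) : cutAngle c δ ν < Real.pi / 4 := by
  rw [cutAngle, ← Real.arctan_one]
  refine Real.arctan_strictMono ?_
  have := F.sizes.c_pos; have := F.sizes.R_pos
  rw [div_lt_one F.sizes.c_pos]
  linarith [F.sizes.δ_pos, F.sizes.gap, F.sizes.R_lt]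

theorem abs_ξ_lt (F : SlidingFamily e c r R δ ν L Γ ξ) (k m : Fin 3) {θ : ℝ}
    (hθ : θ ∈ angles c r ν) : |cX e k (ξ k m θ)| < δ ∧ |cY e m (ξ k m θ)| < δ :=
  ⟨(abs_cX_le e k _).trans_lt (F.ξ_lt k m θ hθ), (abs_cY_le e m _).trans_lt (F.ξ_lt k m θ hθ)⟩

theorem graphPt_re (F : SlidingFamily e c r R δ ν L Γ ξ) {i k : Fin 3} (m : Fin 3) (hk : k ≠ i)
    {θ : ℝ} (hθ : θ ∈ angles c r ν) : cX e i (graphPt e c r ξ k m θ) =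
      sg i k * (√3 / 2 * curvA c r θ) - 1 / 2 * cX e k (ξ k m θ) := by
  obtain ⟨h1, -, h3, -⟩ := F.coord_graphPt k m hθ
  rw [cX_eq_sg e hk, h1, h3]

theorem graphPt_im (F : SlidingFamily e c r R δ ν L Γ ξ) {j m : Fin 3} (k : Fin 3) (hm : m ≠ j)
    {θ : ℝ} (hθ : θ ∈ angles c r ν) : cY e j (graphPt e c r ξ k m θ) =
      sg j m * (√3 / 2 * curvB c r θ) - 1 / 2 * cY e m (ξ k m θ) := by
  obtain ⟨-, h2, -, h4⟩ := F.coord_graphPt k m hθ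
  rw [cY_eq_sg e hm, h2, h4]

theorem _root_.YProd.abs_sg_mul_sub {i k : Fin 3} {u v : ℝ} : |sg i k * (sg i k * u - v) - u| = |v| := by
  have : sg i k * (sg i k * u - v) - u = -(sg i k * v) := by
    linear_combination u * sg_mul_self i k
  rw [this, abs_neg, abs_mul, abs_sg, one_mul]

/-- The height of the box on each side. -/
theorem abs_height_sub_le (F : SlidingFamily e c r R δ ν L Γ ξ) {j m : Fin 3} (k : Fin 3)
    (hm : m ≠ j) : |sg j m * cY e j (graphPt e c r ξ k m (cutAngle c δ ν)) -
      √3 / 2 * (ν + 3 * δ)| ≤ δ / 2 := by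
  rw [F.graphPt_im k hm F.cutAngle_mem, F.cutAngle_spec.2.2, abs_sg_mul_sub, abs_mul]
  have := (F.abs_ξ_lt k m F.cutAngle_mem).2
  rw [abs_of_pos (by norm_num : (0:ℝ) < 1 / 2)]; linarith

theorem im_of_mem_box (F : SlidingFamily e c r R δ ν L Γ ξ) {i j k : Fin 3} {z : ℂ}
    (hz : z ∈ box e c r δ ν ξ i j k) : |z.im| ≤ √3 / 2 * (ν + 3 * δ) + δ / 2 := by
  have h1 := hz.2 (j + 1) (add_one_ne j)
  have h2 := hz.2 (j + 2) (add_two_ne j)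
  have h3 := (abs_le.1 (F.abs_height_sub_le (j := j) (m := j + 1) k (add_one_ne j))).2
  have h4 := (abs_le.1 (F.abs_height_sub_le (j := j) (m := j + 2) k (add_two_ne j))).2
  rw [sg_one] at h1 h3
  rw [sg_two] at h2 h4
  exact abs_le.2 ⟨by linarith, by linarith⟩

theorem mem_box (F : SlidingFamily e c r R δ ν L Γ ξ) {i j k : Fin 3} {z : ℂ}
    (hre : |z.re - sg i k * (√3 / 2 * c)| ≤ δ) (him : |z.im| ≤ √3 / 2 * (ν + 3 * δ) - δ / 2) :
    z ∈ box e c r δ ν ξ i j k := by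
  refine ⟨hre, fun m hm => ?_⟩
  have h3 := (abs_le.1 (F.abs_height_sub_le k hm)).1
  have h4 : sg j m * z.im ≤ |z.im| := by
    refine (le_abs_self _).trans_eq ?_
    rw [abs_mul, abs_sg, one_mul]
  linarith

theorem origin_mem_box (F : SlidingFamily e c r R δ ν L Γ ξ) (i j k : Fin 3) :
    (⟨sg i k * (√3 / 2 * c), 0⟩ : ℂ) ∈ box e c r δ ν ξ i j k := by
  have := F.sizes.δ_pos; have := F.sizes.δ_lt; have := sqrt_three_bounds.1
  refine F.mem_box (by simpa using F.sizes.δ_pos.le) ?_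
  rw [abs_zero]; nlinarith

theorem curve_mem_box (F : SlidingFamily e c r R δ ν L Γ ξ) {i j k m : Fin 3} (hk : k ≠ i)
    (hm : m ≠ j) {θ : ℝ} (hθ : θ ∈ Icc 0 (Real.pi / 2)) (hB : curvB c r θ ≤ ν + δ) :
    q e i j (Γ k m θ) ∈ box e c r δ ν ξ i j k := by
  have hδ := F.sizes.δ_pos; have hν := F.sizes.δ_lt; have hs := sqrt_three_bounds
  have hg := F.sizes.gap
  have hB0 := (F.curv_nonneg hθ).2
  have hX := (abs_lt.1 (F.abs_cX_lt k m hθ))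
  refine F.mem_box ?_ ?_
  · rw [q_re, cX_eq_sg e hk, F.faceA k m θ hθ (by linarith)]
    rw [abs_le]; constructor <;> linarith
  · rw [q_im]
    obtain ⟨h1, h2⟩ := F.cY_near k j hθ
    have h3 : √3 / 2 * curvB c r θ ≤ √3 / 2 * (ν + δ) := by gcongr
    have h4 : 0 ≤ √3 / 2 * curvB c r θ := by positivity
    rcases eq_of_ne hm with rfl | rfl
    · rw [abs_lt] at h1
      rw [abs_le]; constructor <;> nlinarith
    · rw [abs_lt] at h2
      rw [abs_le]; constructor <;> nlinarith

/-- The height increases along the part of the shifted curve in the face. -/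
theorem height_mono (F : SlidingFamily e c r R δ ν L Γ ξ) {j m : Fin 3} (k : Fin 3)
    (hm : m ≠ j) {θ : ℝ} (hθ : θ ∈ angles c r ν) (hle : θ ≤ cutAngle c δ ν) :
    sg j m * cY e j (graphPt e c r ξ k m θ) ≤
      sg j m * cY e j (graphPt e c r ξ k m (cutAngle c δ ν)) := by
  obtain ⟨c1, c2, c3⟩ := F.cutAngle_spec
  have hδ := F.sizes.δ_pos; have hL := F.sizes.L_le; have hg := F.sizes.gap
  have hs := sqrt_three_bounds.1
  have hmono := curvB_mono F.sizes.c_pos F.sizes.r_pos hθ.1 c1 hle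
  have hA : curvA c r θ = c := curvA_eq_of_curvB_le F.sizes.c_pos F.sizes.r_sq
    (by linarith [F.sizes.R_lt, F.sizes.R_pos]) (onCurve F.sizes.c_pos F.sizes.r_pos hθ.1)
    (by linarith)
  have hlip := F.ξ_lip k m _ F.cutAngle_mem θ hθ
  have hd : ‖arcPt e c r k m (cutAngle c δ ν) - arcPt e c r k m θ‖ =
      curvB c r (cutAngle c δ ν) - curvB c r θ := by
    have : arcPt e c r k m (cutAngle c δ ν) - arcPt e c r k m θ =
        quadPt e k m 0 (curvB c r (cutAngle c δ ν) - curvB c r θ) := by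
      rw [arcPt, arcPt, quadPt, quadPt, quadPt, c2, hA]; module
    have h2 := norm_sq_quadPt e k m 0 (curvB c r (cutAngle c δ ν) - curvB c r θ)
    rw [this]
    exact (sq_eq_sq₀ (norm_nonneg _) (by linarith)).1 (by rw [h2]; ring)
  have h5 := (abs_le.1 ((abs_cY_le e m _).trans hlip))
  rw [cY_sub, hd] at h5
  rw [F.graphPt_im k hm F.cutAngle_mem, F.graphPt_im k hm hθ]
  have e1 := sg_mul_self j m
  set x := curvB c r (cutAngle c δ ν) - curvB c r θ with hx
  set w := cY e m (ξ k m (cutAngle c δ ν)) - cY e m (ξ k m θ) with hw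
  have h6 : sg j m * w ≤ L * x := by
    have := (abs_le.2 h5)
    calc sg j m * w ≤ |sg j m * w| := le_abs_self _
      _ ≤ L * x := by rw [abs_mul, abs_sg, one_mul]; exact this
  have h7 : 0 ≤ x := by linarith
  have h8 : L * x ≤ 1 / 1000 * x := by gcongr
  have h9 : sg j m * (sg j m * (√3 / 2 * curvB c r (cutAngle c δ ν)) -
      1 / 2 * cY e m (ξ k m (cutAngle c δ ν))) - sg j m * (sg j m * (√3 / 2 * curvB c r θ) -
      1 / 2 * cY e m (ξ k m θ)) = √3 / 2 * x - 1 / 2 * (sg j m * w) := by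
    rw [hx, hw]
    linear_combination (√3 / 2 * (curvB c r (cutAngle c δ ν) - curvB c r θ)) * e1
  nlinarith

theorem height_pos (F : SlidingFamily e c r R δ ν L Γ ξ) {j m : Fin 3} (k : Fin 3)
    (hm : m ≠ j) {θ : ℝ} (hθ : θ ∈ angles c r ν) :
    0 < sg j m * cY e j (graphPt e c r ξ k m θ) := by
  rw [F.graphPt_im k hm hθ]
  have h1 := abs_sg_mul_sub (i := j) (k := m) (u := √3 / 2 * curvB c r θ)
    (v := 1 / 2 * cY e m (ξ k m θ))
  rw [abs_mul, abs_of_pos (by norm_num : (0:ℝ) < 1 / 2)] at h1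
  have h2 := (F.abs_ξ_lt k m hθ).2
  have h3 := hθ.2.2
  have := F.sizes.δ_lt; have := sqrt_three_bounds.1; have := F.sizes.δ_pos
  have h4 := neg_abs_le (sg j m * (sg j m * (√3 / 2 * curvB c r θ) - 1 / 2 * cY e m (ξ k m θ)) -
    √3 / 2 * curvB c r θ)
  nlinarith

theorem graphPt_mem_box (F : SlidingFamily e c r R δ ν L Γ ξ) {i j k m : Fin 3} (hk : k ≠ i)
    (hm : m ≠ j) {θ : ℝ} (hθ : θ ∈ angles c r ν) (hle : θ ≤ cutAngle c δ ν) :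
    q e i j (graphPt e c r ξ k m θ) ∈ box e c r δ ν ξ i j k := by
  obtain ⟨c1, c2, c3⟩ := F.cutAngle_spec
  have hδ := F.sizes.δ_pos; have hg := F.sizes.gap
  have hmono := curvB_mono F.sizes.c_pos F.sizes.r_pos hθ.1 c1 hle
  have hA : curvA c r θ = c := curvA_eq_of_curvB_le F.sizes.c_pos F.sizes.r_sq
    (by linarith [F.sizes.R_lt, F.sizes.R_pos]) (onCurve F.sizes.c_pos F.sizes.r_pos hθ.1)
    (by linarith)
  have hX := abs_lt.1 (F.abs_ξ_lt k m hθ).1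
  refine ⟨?_, fun m' hm' => ?_⟩
  · rw [q_re, F.graphPt_re m hk hθ, hA, abs_le]; constructor <;> linarith
  · rw [q_im]
    by_cases h : m = m'
    · subst h; exact F.height_mono k hm hθ hle
    · have h1 := F.height_pos k hm hθ
      have h2 := F.height_pos k hm' F.cutAngle_mem
      rw [sg_of_ne hm hm' h] at h2 ⊢
      linarith

end SlidingFamily

/-! ### Replacing the deformed curves by polygons -/

theorem par_eq_sum {p : ℂ} {g : ℝ → ℂ} {α β : ℝ} (hg : ContinuousOn g (Icc α β))
    (hp : ∀ x ∈ Icc α β, g x ≠ p) (t : ℕ → ℝ) (n : ℕ) (ht : ∀ l ≤ n, t l ∈ Icc α β) :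
    par p g (t 0) (t n) = ∑ l ∈ Finset.range n, par p g (t l) (t (l + 1)) := by
  induction n with
  | zero => simp [par_self]
  | succ n ih =>
    rw [Finset.sum_range_succ, ← ih fun l hl => ht l (by omega)]
    exact (par_add hg hp (ht 0 (by omega)) (ht n (by omega)) (ht (n + 1) le_rfl)).symm

theorem par_eq_segPar {p : ℂ} {K : Set ℂ} (hK : Convex ℝ K) (hp : p ∉ K) {γ : ℝ → ℂ} {s t : ℝ}
    (hγ : ContinuousOn γ (uIcc s t)) (hm : MapsTo γ (uIcc s t) K) :
    par p γ s t = segPar p (γ s) (γ t) := by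
  obtain ⟨e, he⟩ := exists_par_eq_of_convex hK hp
  rw [he γ s t hγ hm, segPar, he _ 0 1 (continuous_segPath _ _).continuousOn, segPath_zero,
    segPath_one]
  rw [uIcc_of_le zero_le_one]
  exact fun x hx => segPath_mem hK (hm left_mem_uIcc) (hm right_mem_uIcc) hx

/-- Around `p`, the parity of any path in `K` is the difference of the values of `ε` at its end
points. -/
def IsParPrimitive (p : ℂ) (K : Set ℂ) (ε : ℂ → ZMod 2) : Prop :=
  ∀ (γ : ℝ → ℂ) (s t : ℝ), ContinuousOn γ (uIcc s t) → MapsTo γ (uIcc s t) K →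
    par p γ s t = ε (γ s) + ε (γ t)

theorem IsParPrimitive.segPar {p : ℂ} {K : Set ℂ} {ε : ℂ → ZMod 2} (h : IsParPrimitive p K ε)
    (hK : Convex ℝ K) {P Q : ℂ} (hP : P ∈ K) (hQ : Q ∈ K) : segPar p P Q = ε P + ε Q := by
  rw [YProd.segPar, h _ 0 1 (continuous_segPath _ _).continuousOn, segPath_zero, segPath_one]
  rw [uIcc_of_le zero_le_one]
  exact fun x hx => segPath_mem hK hP hQ hx

/-- The angles at which the shifted curves are replaced by polygons with `n` edges. -/
noncomputable def meshAngle (c δ ν : ℝ) (n l : ℕ) : ℝ :=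
  cutAngle c δ ν + l * ((Real.pi / 2 - 2 * cutAngle c δ ν) / n)

/-- The vertices of a polygon from `c a k` to `c b m`, the others of which lie on the shifted curve
`k m`. -/
noncomputable def node (e : Frame) (c r δ ν : ℝ) (ξ : Fin 3 → Fin 3 → ℝ → E4) (n : ℕ)
    (k m : Fin 3) (l : ℕ) : E4 :=
  if l = 0 then c • a e k else if l = n + 2 then c • b e m else
    graphPt e c r ξ k m (meshAngle c δ ν n (l - 1))

/-- The rectangle around the image of the end of the curves in the face of `b m`. -/
def boxB (e : Frame) (c r δ ν : ℝ) (ξ : Fin 3 → Fin 3 → ℝ → E4) (i j m : Fin 3) : Set ℂ :=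
  {z | swap z ∈ box (swapFrame e) c r δ ν (flip ξ) j i m}

theorem convex_boxB (e : Frame) (c r δ ν : ℝ) (ξ : Fin 3 → Fin 3 → ℝ → E4) (i j m : Fin 3) :
    Convex ℝ (boxB e c r δ ν ξ i j m) := by
  intro z hz w hw s t hs ht hst
  have h : swap (s • z + t • w) = s • swap z + t • swap w := by
    apply Complex.ext <;> simp [swap]
  rw [boxB, mem_ofPred_eq, h]
  exact convex_box _ _ _ _ _ _ _ _ _ hz hw hs ht hst

theorem node_zero (e : Frame) (c r δ ν : ℝ) (ξ : Fin 3 → Fin 3 → ℝ → E4) (n : ℕ) (k m : Fin 3) :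
    node e c r δ ν ξ n k m 0 = c • a e k := if_pos rfl

theorem node_last (e : Frame) (c r δ ν : ℝ) (ξ : Fin 3 → Fin 3 → ℝ → E4) (n : ℕ) (k m : Fin 3) :
    node e c r δ ν ξ n k m (n + 2) = c • b e m := by
  rw [node, if_neg (by omega), if_pos rfl]

theorem node_succ (e : Frame) (c r δ ν : ℝ) (ξ : Fin 3 → Fin 3 → ℝ → E4) {n l : ℕ} (k m : Fin 3)
    (hl : l ≤ n) :
    node e c r δ ν ξ n k m (l + 1) = graphPt e c r ξ k m (meshAngle c δ ν n l) := by
  rw [node, if_neg (by omega), if_neg (by omega), Nat.add_sub_cancel]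

theorem q_smul_a (e : Frame) {i k : Fin 3} (j : Fin 3) (hk : k ≠ i) (c : ℝ) :
    q e i j (c • a e k) = ⟨sg i k * (√3 / 2 * c), 0⟩ := by
  obtain ⟨h1, h2, h3, h4⟩ := coord_quadPt e k j c 0
  rw [quadPt, zero_smul, add_zero] at h1 h2 h3 h4
  rw [q_eq, cX_eq_sg e hk, h1, h2, h4, mul_zero, sub_zero]

theorem q_smul_b (e : Frame) {j m : Fin 3} (i : Fin 3) (hm : m ≠ j) (c : ℝ) :
    q e i j (c • b e m) = ⟨0, sg j m * (√3 / 2 * c)⟩ := by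
  have h := q_smul_a (swapFrame e) i hm c
  rw [q_swapFrame, a_swapFrame] at h
  have h2 := congrArg swap h
  simpa [swap] using h2

namespace SlidingFamily

variable {e : Frame} {c r R δ ν L : ℝ} {Γ ξ : Fin 3 → Fin 3 → ℝ → E4}

theorem meshAngle_mem (F : SlidingFamily e c r R δ ν L Γ ξ) {n l : ℕ} (hn : 0 < n) (hl : l ≤ n) :
    meshAngle c δ ν n l ∈ Icc (cutAngle c δ ν) (Real.pi / 2 - cutAngle c δ ν) := by
  have h := F.cutAngle_lt
  have hn' : (0:ℝ) < n := Nat.cast_pos.2 hn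
  have hl' : (l:ℝ) ≤ n := Nat.cast_le.2 hl
  have h1 : 0 ≤ (Real.pi / 2 - 2 * cutAngle c δ ν) / n := div_nonneg (by linarith) hn'.le
  have h2 : (n:ℝ) * ((Real.pi / 2 - 2 * cutAngle c δ ν) / n) =
      Real.pi / 2 - 2 * cutAngle c δ ν := by field_simp
  unfold meshAngle
  constructor
  · nlinarith
  · nlinarith

theorem _root_.YProd.meshAngle_zero (c δ ν : ℝ) (n : ℕ) : meshAngle c δ ν n 0 = cutAngle c δ ν := by
  simp [meshAngle]

theorem _root_.YProd.meshAngle_last (c δ ν : ℝ) {n : ℕ} (hn : 0 < n) :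
    meshAngle c δ ν n n = Real.pi / 2 - cutAngle c δ ν := by
  have hn' : (0:ℝ) < n := Nat.cast_pos.2 hn
  unfold meshAngle; field_simp; ring

theorem meshAngle_lt (F : SlidingFamily e c r R δ ν L Γ ξ) {n l l' : ℕ} (hn : 0 < n)
    (hl : l < l') : meshAngle c δ ν n l < meshAngle c δ ν n l' := by
  have h := F.cutAngle_lt
  have hn' : (0:ℝ) < n := Nat.cast_pos.2 hn
  have h1 : 0 < (Real.pi / 2 - 2 * cutAngle c δ ν) / n := div_pos (by linarith) hn'
  unfold meshAngle
  have : (l:ℝ) < l' := Nat.cast_lt.2 hl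
  gcongr

theorem meshAngle_succ_sub_le (F : SlidingFamily e c r R δ ν L Γ ξ) {n : ℕ} (hn : 0 < n) (l : ℕ) :
    meshAngle c δ ν n (l + 1) - meshAngle c δ ν n l ≤ Real.pi / 2 / n := by
  have h := F.cutAngle_spec.1.1
  have hn' : (0:ℝ) < n := Nat.cast_pos.2 hn
  have : meshAngle c δ ν n (l + 1) - meshAngle c δ ν n l =
      (Real.pi / 2 - 2 * cutAngle c δ ν) / n := by
    unfold meshAngle; push_cast; ring
  rw [this]
  gcongr; linarith

theorem norm_graphPt_sub_le (F : SlidingFamily e c r R δ ν L Γ ξ) (k m : Fin 3) {θ θ' : ℝ}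
    (h : θ ∈ angles c r ν) (h' : θ' ∈ angles c r ν) :
    ‖graphPt e c r ξ k m θ - graphPt e c r ξ k m θ'‖ ≤ 7 * c * |θ - θ'| := by
  -- the original curve contributes `31 / 5`, and the displacement `L` times as much
  have h1 := norm_arcPt_sub_le (e := e) F.sizes k m h.1 h'.1
  have h2 := F.ξ_lip k m θ h θ' h'
  have h3 : graphPt e c r ξ k m θ - graphPt e c r ξ k m θ' =
      (arcPt e c r k m θ - arcPt e c r k m θ') + (ξ k m θ - ξ k m θ') := by
    simp only [graphPt]; abel
  have h4 : L * ‖arcPt e c r k m θ - arcPt e c r k m θ'‖ ≤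
      1 / 1000 * ‖arcPt e c r k m θ - arcPt e c r k m θ'‖ := by gcongr; exact F.sizes.L_le
  have h5 : 0 ≤ c * |θ - θ'| := mul_nonneg F.sizes.c_pos.le (abs_nonneg _)
  rw [h3]
  refine (norm_add_le _ _).trans ?_
  linarith

theorem lipschitzOnWith_q_graphPt (F : SlidingFamily e c r R δ ν L Γ ξ) (i j k m : Fin 3) :
    LipschitzOnWith (Real.toNNReal (7 * c)) (fun θ => q e i j (graphPt e c r ξ k m θ))
      (angles c r ν) := by
  have := F.sizes.c_pos
  refine LipschitzOnWith.of_dist_le_mul fun θ hθ θ' hθ' => ?_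
  rw [dist_eq_norm, Real.dist_eq, Real.coe_toNNReal _ (by positivity)]
  exact (norm_q_sub_le e i j _ _).trans (F.norm_graphPt_sub_le k m hθ hθ')

/-- Between two subdivision points, the projected shifted curve stays close to its starting
point. -/
theorem dist_q_graphPt_lt (F : SlidingFamily e c r R δ ν L Γ ξ) (i j k m : Fin 3) {n l : ℕ}
    {ρ : ℝ} (hn : 0 < n) (hl : l < n) (hρ : 7 * c * (Real.pi / 2) < n * ρ) {θ θ' : ℝ}
    (h : θ ∈ Icc (meshAngle c δ ν n l) (meshAngle c δ ν n (l + 1)))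
    (h' : θ' ∈ Icc (meshAngle c δ ν n l) (meshAngle c δ ν n (l + 1))) :
    dist (q e i j (graphPt e c r ξ k m θ)) (q e i j (graphPt e c r ξ k m θ')) < ρ := by
  have hn' : (0:ℝ) < n := Nat.cast_pos.2 hn
  have hsub : Icc (meshAngle c δ ν n l) (meshAngle c δ ν n (l + 1)) ⊆ angles c r ν :=
    (Icc_subset_Icc (F.meshAngle_mem hn hl.le).1 (F.meshAngle_mem hn hl).2).trans
      F.Icc_subset_angles
  rw [dist_eq_norm]
  refine (norm_q_sub_le e i j _ _).trans_lt
    ((F.norm_graphPt_sub_le k m (hsub h) (hsub h')).trans_lt ?_)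
  have h1 : |θ - θ'| ≤ Real.pi / 2 / n :=
    (abs_le.2 ⟨by linarith [h.1, h'.2], by linarith [h.2, h'.1]⟩).trans
      (F.meshAngle_succ_sub_le hn l)
  have hc := F.sizes.c_pos
  calc 7 * c * |θ - θ'| ≤ 7 * c * (Real.pi / 2 / n) := by gcongr
    _ = 7 * c * (Real.pi / 2) / n := by ring
    _ < ρ := by rw [div_lt_iff₀ hn']; linarith

theorem mem_boxB_of_curve (F : SlidingFamily e c r R δ ν L Γ ξ) {i j k m : Fin 3} (hk : k ≠ i)
    (hm : m ≠ j) {θ : ℝ} (hθ : θ ∈ Icc 0 (Real.pi / 2)) (hA : curvA c r θ ≤ ν + δ) :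
    q e i j (Γ k m θ) ∈ boxB e c r δ ν ξ i j m := by
  rw [boxB, mem_ofPred_eq, ← q_swapFrame]
  have h := F.flip.curve_mem_box (m := k) hm hk (mem_symm_iff.2 hθ) (by rwa [curvB_symm])
  rwa [YProd.flip, sub_sub_cancel] at h

theorem mem_boxB_of_graphPt (F : SlidingFamily e c r R δ ν L Γ ξ) {i j k m : Fin 3} (hk : k ≠ i)
    (hm : m ≠ j) {θ : ℝ} (hθ : θ ∈ angles c r ν) (hle : Real.pi / 2 - cutAngle c δ ν ≤ θ) :
    q e i j (graphPt e c r ξ k m θ) ∈ boxB e c r δ ν ξ i j m := by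
  rw [boxB, mem_ofPred_eq, ← q_swapFrame]
  have h := F.flip.graphPt_mem_box (m := k) hm hk (mem_angles_symm.2 hθ) (by linarith)
  rwa [graphPt_flip] at h

theorem mem_boxB_of_end (F : SlidingFamily e c r R δ ν L Γ ξ) {i j m : Fin 3} (hm : m ≠ j) :
    q e i j (c • b e m) ∈ boxB e c r δ ν ξ i j m := by
  rw [q_smul_b e i hm]
  exact F.flip.origin_mem_box j i m

/-- Away from the boxes and from the shifted curves, the parity of a deformed curve is that of the
polygon, up to terms which depend on one of the two indices only. -/
theorem par_eq_polygon (F : SlidingFamily e c r R δ ν L Γ ξ) {i j k m : Fin 3} (hk : k ≠ i)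
    (hm : m ≠ j) {p : ℂ} {n : ℕ} {ρ : ℝ} (hn : 0 < n) (hρ : 7 * c * (Real.pi / 2) < n * ρ)
    (hΓ : ∀ θ ∈ Icc 0 (Real.pi / 2), q e i j (Γ k m θ) ≠ p)
    (hfar : ∀ θ ∈ angles c r ν, ρ ≤ dist p (q e i j (graphPt e c r ξ k m θ)))
    {εA εB : ℂ → ZMod 2} (hA : IsParPrimitive p (box e c r δ ν ξ i j k) εA)
    (hB : IsParPrimitive p (boxB e c r δ ν ξ i j m) εB) :
    par p (fun θ => q e i j (Γ k m θ)) 0 (Real.pi / 2) =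
      ∑ l ∈ Finset.range (n + 2), segPar p (q e i j (node e c r δ ν ξ n k m l))
        (q e i j (node e c r δ ν ξ n k m (l + 1))) +
      (εA (q e i j (Γ k m 0)) + εA (q e i j (c • a e k))) +
      (εB (q e i j (Γ k m (Real.pi / 2))) + εB (q e i j (c • b e m))) := by
  have hc := F.sizes.c_pos; have hr := F.sizes.r_pos; have hδ := F.sizes.δ_pos
  have hδν := F.sizes.δ_lt; have hgap := F.sizes.gap; have hRc := F.sizes.R_lt
  have hR := F.sizes.R_pos
  have hpi := Real.pi_pos
  have hn' : (0:ℝ) < n := Nat.cast_pos.2 hn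
  have hρ0 : 0 < ρ := by
    have : 0 < n * ρ := lt_trans (by positivity) hρ
    exact (mul_pos_iff_of_pos_left hn').1 this
  have hle := fun {τ : ℝ} h0 hτ θ hθ =>
    le_curvB_iff hc hr F.sizes.r_sq (by linarith) (τ := τ) h0 hτ (θ := θ) hθ
  obtain ⟨t1, t2, t3⟩ := onCurve_arctan hc hr F.sizes.r_sq (by linarith) (τ := ν + δ)
    (by linarith) (by linarith)
  obtain ⟨c1, c2, c3⟩ := F.cutAngle_spec
  set θ₁ := Real.arctan ((ν + δ) / c) with hθ₁
  set θ₂ := Real.pi / 2 - θ₁ with hθ₂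
  set θμ := cutAngle c δ ν with hθμ
  have h0 : (0:ℝ) ∈ Icc 0 (Real.pi / 2) := ⟨le_rfl, by positivity⟩
  have h1 : Real.pi / 2 ∈ Icc 0 (Real.pi / 2) := ⟨by positivity, le_rfl⟩
  have t1' : θ₂ ∈ Icc 0 (Real.pi / 2) := mem_symm_iff.2 t1
  have hmidset : angles c r (ν + δ) = Icc θ₁ θ₂ := angles_eq F.sizes (by linarith) (by linarith)
  have hlt : θ₁ < θ₂ := by
    have : θ₁ < θμ := by
      rw [hθ₁, hθμ, cutAngle]
      refine Real.arctan_strictMono ?_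
      gcongr; linarith
    have := F.cutAngle_lt
    linarith
  have hang : angles c r ν = Icc (Real.arctan (ν / c)) (Real.pi / 2 - Real.arctan (ν / c)) :=
    angles_eq F.sizes (by linarith) (by linarith)
  obtain ⟨f, hf, hfΓ⟩ := F.graph k m
  rw [hmidset] at hf hfΓ
  set γ : ℝ → ℂ := fun θ => q e i j (Γ k m θ) with hγ
  set g : ℝ → ℂ := fun θ => q e i j (graphPt e c r ξ k m θ) with hg
  have hγc : ContinuousOn γ (Icc 0 (Real.pi / 2)) := F.continuousOn_q i j k m
  have hgc : ContinuousOn g (angles c r ν) := (F.lipschitzOnWith_q_graphPt i j k m).continuousOn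
  have hgp : ∀ θ ∈ angles c r ν, g θ ≠ p := by
    intro θ hθ h
    have := hfar θ hθ
    rw [← h, dist_self] at this
    linarith
  -- the ends of the deformed curve
  have hstart : par p γ 0 θ₁ = εA (γ 0) + εA (γ θ₁) := by
    refine hA γ 0 θ₁ ?_ ?_ <;> rw [uIcc_of_le t1.1]
    · exact hγc.mono (Icc_subset_Icc_right t1.2)
    · intro θ hθ
      have hθI : θ ∈ Icc 0 (Real.pi / 2) := ⟨hθ.1, hθ.2.trans t1.2⟩
      exact F.curve_mem_box hk hm hθI ((curvB_mono hc hr hθI t1 hθ.2).trans t3.le)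
  have hend : par p γ θ₂ (Real.pi / 2) = εB (γ θ₂) + εB (γ (Real.pi / 2)) := by
    refine hB γ θ₂ _ ?_ ?_ <;> rw [uIcc_of_le t1'.2]
    · exact hγc.mono (Icc_subset_Icc_left t1'.1)
    · intro θ hθ
      have hθI : θ ∈ Icc 0 (Real.pi / 2) := ⟨t1'.1.trans hθ.1, hθ.2⟩
      refine F.mem_boxB_of_curve hk hm hθI ((curvA_anti hc hr t1' hθI hθ.1).trans ?_)
      rw [hθ₂, curvA_symm, t3]
  -- the middle part
  have hγg : ∀ θ ∈ Icc θ₁ θ₂, γ θ = g (f θ) := fun θ hθ => by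
    rw [hγ, hg]; beta_reduce; rw [(hfΓ θ hθ).2]
  have hmid : par p γ θ₁ θ₂ = par p g (f θ₁) (f θ₂) := by
    have hm1 : MapsTo f (Icc θ₁ θ₂) (angles c r ν) := fun θ hθ => (hfΓ θ hθ).1
    rw [hang] at hm1 hgc hgp
    rw [← par_comp (f := f) (a := θ₁) (b := θ₂) _ _ hgc hgp]
    · refine par_congr ?_
      rw [uIcc_of_le hlt.le]; exact hγg
    · rw [uIcc_of_le hlt.le]; exact hf
    · rw [uIcc_of_le hlt.le]; exact hm1
  have hf1 := (hfΓ θ₁ ⟨le_rfl, hlt.le⟩)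
  have hf2 := (hfΓ θ₂ ⟨hlt.le, le_rfl⟩)
  -- the reparametrized middle part begins and ends inside the boxes, since at its end points the
  -- deformed curve has height less than `ν + 2 δ`
  have hf1μ : f θ₁ ≤ θμ := by
    have h2 := (abs_lt.1 (F.abs_cB_lt k m t1)).2
    rw [hf1.2, (F.coord_graphPt k m hf1.1).2.1, t3] at h2
    by_contra hcon
    push Not at hcon
    have := curvB_mono hc hr c1 hf1.1.1 hcon.le
    linarith
  have hf2μ : Real.pi / 2 - θμ ≤ f θ₂ := by
    have h2 := (abs_cA_le e k _).trans_lt (F.close k m θ₂ t1')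
    rw [cA_sub, arcPt, (coord_quadPt e k m _ _).1, hθ₂, curvA_symm, t3, ← hθ₂, hf2.2,
      (F.coord_graphPt k m hf2.1).1] at h2
    have h3 := (abs_lt.1 h2).2
    by_contra hcon
    push Not at hcon
    have := curvA_anti hc hr hf2.1.1 (mem_symm_iff.2 c1) hcon.le
    rw [curvA_symm] at this
    linarith
  have hμ : θμ ∈ angles c r ν := F.cutAngle_mem
  have hμ' : Real.pi / 2 - θμ ∈ angles c r ν := mem_angles_symm.2 hμ
  have hord : ∀ s ∈ angles c r ν, ∀ t ∈ angles c r ν, Icc s t ⊆ angles c r ν := by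
    rw [hang]; exact fun s hs t ht => Icc_subset_Icc hs.1 ht.2
  have hg1 : par p g (f θ₁) θμ = εA (g (f θ₁)) + εA (g θμ) := by
    refine hA g _ _ ?_ ?_ <;> rw [uIcc_of_le hf1μ]
    · exact hgc.mono (hord _ hf1.1 _ hμ)
    · exact fun θ hθ => F.graphPt_mem_box hk hm (hord _ hf1.1 _ hμ hθ) hθ.2
  have hg2 : par p g (Real.pi / 2 - θμ) (f θ₂) = εB (g (Real.pi / 2 - θμ)) + εB (g (f θ₂)) := by
    refine hB g _ _ ?_ ?_ <;> rw [uIcc_of_le hf2μ]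
    · exact hgc.mono (hord _ hμ' _ hf2.1)
    · exact fun θ hθ => F.mem_boxB_of_graphPt hk hm (hord _ hμ' _ hf2.1 hθ) hθ.1
  have hgmid : par p g θμ (Real.pi / 2 - θμ) = ∑ l ∈ Finset.range n,
      segPar p (q e i j (node e c r δ ν ξ n k m (l + 1)))
        (q e i j (node e c r δ ν ξ n k m (l + 1 + 1))) := by
    have hgc' := hgc
    have hgp' := hgp
    rw [hang] at hgc' hgp'
    have h2 := par_eq_sum hgc' hgp' (meshAngle c δ ν n) n fun l hl => by
      rw [← hang]; exact F.Icc_subset_angles (F.meshAngle_mem hn hl)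
    rw [meshAngle_zero, meshAngle_last _ _ _ hn] at h2
    rw [h2]
    refine Finset.sum_congr rfl fun l hl => ?_
    have hl' := Finset.mem_range.1 hl
    have hll := (F.meshAngle_lt hn (Nat.lt_succ_self l)).le
    rw [node_succ e c r δ ν ξ k m hl'.le, node_succ e c r δ ν ξ k m hl']
    have hsub := hord _ (F.Icc_subset_angles (F.meshAngle_mem hn hl'.le)) _
      (F.Icc_subset_angles (F.meshAngle_mem hn hl'))
    refine par_eq_segPar (K := Metric.ball (g (meshAngle c δ ν n l)) ρ) (convex_ball _ _) ?_ ?_ ?_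
    · rw [Metric.mem_ball, not_lt]
      exact hfar _ (hsub ⟨le_rfl, hll⟩)
    · rw [uIcc_of_le hll]
      exact hgc.mono hsub
    · rw [uIcc_of_le hll]
      exact fun θ hθ => F.dist_q_graphPt_lt i j k m hn hl' hρ hθ ⟨le_rfl, hll⟩
  have hgp' := hgp
  have hgc' := hgc
  have hf1' := hf1.1
  have hf2' := hf2.1
  rw [hang] at hgp' hgc' hf1' hf2' hμ hμ'
  rw [← par_add hγc hΓ h0 t1' h1, ← par_add hγc hΓ h0 t1 t1', hstart, hend, hmid,
    ← par_add hgc' hgp' hf1' hμ' hf2', ← par_add hgc' hgp' hf1' hμ hμ', hg1, hg2, hgmid,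
    Finset.sum_range_succ, Finset.sum_range_succ', node_zero, zero_add, node_last,
    node_succ _ _ _ _ _ _ _ _ (Nat.zero_le n), node_succ _ _ _ _ _ _ _ _ le_rfl, meshAngle_zero,
    meshAngle_last _ _ _ hn, hA.segPar (convex_box _ _ _ _ _ _ _ _ _),
    hB.segPar (convex_boxB _ _ _ _ _ _ _ _ _), hγg θ₁ ⟨le_rfl, hlt.le⟩, hγg θ₂ ⟨hlt.le, le_rfl⟩]
  · have : ∀ w : ZMod 2, w + w = 0 := by decide
    linear_combination this (εA (g (f θ₁))) + this (εB (g (f θ₂))) -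
      this (εA (q e i j (c • a e k))) - this (εB (q e i j (c • b e m)))
  · rw [← hang] at hμ'
    exact F.mem_boxB_of_graphPt hk hm hμ' le_rfl
  · exact F.mem_boxB_of_end hm
  · rw [q_smul_a e j hk]; exact F.origin_mem_box i j k
  · rw [← hang] at hμ
    exact F.graphPt_mem_box hk hm hμ le_rfl

end SlidingFamily

theorem sum_erase {M : Type*} [AddCommMonoid M] (i : Fin 3) (f : Fin 3 → M) :
    ∑ k ∈ Finset.univ.erase i, f k = f (i + 1) + f (i + 2) := by
  have : Finset.univ.erase i = {i + 1, i + 2} := by revert i; decide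
  rw [this, Finset.sum_pair (by revert i; decide)]

theorem sum_triPar (p : ℂ) (N : ℕ → ℂ) (n : ℕ) :
    ∑ l ∈ Finset.range n, triPar p (N l) (N (l + 1)) =
      ∑ l ∈ Finset.range n, segPar p (N l) (N (l + 1)) + (segPar p 0 (N 0) + segPar p 0 (N n)) := by
  have h : ∀ w : ZMod 2, w + w = 0 := by decide
  induction n with
  | zero => simp [h]
  | succ n ih =>
    rw [Finset.sum_range_succ, Finset.sum_range_succ, ih, triPar]
    linear_combination h (segPar p 0 (N n))

/-- Away from the boxes and from the shifted curves, the winding parity of the deformed cycle is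
that of the sum of the triangles spanned by `0` and the edges of the polygons. -/
theorem SlidingFamily.sumPar_eq_triPar {e : Frame} {c r R δ ν L : ℝ}
    {Γ ξ : Fin 3 → Fin 3 → ℝ → E4} (F : SlidingFamily e c r R δ ν L Γ ξ) {i j : Fin 3} {p : ℂ}
    {n : ℕ} {ρ : ℝ} (hn : 0 < n) (hρ : 7 * c * (Real.pi / 2) < n * ρ) (hΓ : OffCurves e Γ i j p)
    (hfar : ∀ k m, ∀ θ ∈ angles c r ν, ρ ≤ dist p (q e i j (graphPt e c r ξ k m θ)))
    (hA : ∀ k, k ≠ i → p ∉ box e c r δ ν ξ i j k) (hB : ∀ m, m ≠ j → p ∉ boxB e c r δ ν ξ i j m) :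
    sumPar e Γ i j p = ∑ k ∈ Finset.univ.erase i, ∑ m ∈ Finset.univ.erase j,
      ∑ l ∈ Finset.range (n + 2), triPar p (q e i j (node e c r δ ν ξ n k m l))
        (q e i j (node e c r δ ν ξ n k m (l + 1))) := by
  have i1 := add_one_ne i; have i2 := add_two_ne i
  have j1 := add_one_ne j; have j2 := add_two_ne j
  obtain ⟨ε1, h1⟩ := exists_par_eq_of_convex (convex_box _ _ _ _ _ _ _ _ _) (hA _ i1)
  obtain ⟨ε2, h2⟩ := exists_par_eq_of_convex (convex_box _ _ _ _ _ _ _ _ _) (hA _ i2)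
  obtain ⟨ε3, h3⟩ := exists_par_eq_of_convex (convex_boxB _ _ _ _ _ _ _ _ _) (hB _ j1)
  obtain ⟨ε4, h4⟩ := exists_par_eq_of_convex (convex_boxB _ _ _ _ _ _ _ _ _) (hB _ j2)
  rw [sumPar, F.par_eq_polygon i1 j1 hn hρ (hΓ _ _) (hfar _ _) h1 h3,
    F.par_eq_polygon i1 j2 hn hρ (hΓ _ _) (hfar _ _) h1 h4,
    F.par_eq_polygon i2 j1 hn hρ (hΓ _ _) (hfar _ _) h2 h3,
    F.par_eq_polygon i2 j2 hn hρ (hΓ _ _) (hfar _ _) h2 h4]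
  simp only [sum_erase, sum_triPar p (fun l => q e i j (node e c r δ ν ξ n _ _ l)), node_zero,
    node_last]
  rw [F.start (i + 1) (j + 2) (j + 1), F.start (i + 2) (j + 2) (j + 1),
    F.finish (i + 2) (i + 1) (j + 1), F.finish (i + 2) (i + 1) (j + 2)]
  -- the terms which depend on one of the two indices only occur twice
  have h : ∀ w : ZMod 2, w + w = 0 := by decide
  linear_combination h (ε1 (q e i j (Γ (i + 1) (j + 1) 0))) + h (ε1 (q e i j (c • a e (i + 1)))) +
    h (ε2 (q e i j (Γ (i + 2) (j + 1) 0))) + h (ε2 (q e i j (c • a e (i + 2)))) +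
    h (ε3 (q e i j (Γ (i + 1) (j + 1) (Real.pi / 2)))) + h (ε3 (q e i j (c • b e (j + 1)))) +
    h (ε4 (q e i j (Γ (i + 1) (j + 2) (Real.pi / 2)))) + h (ε4 (q e i j (c • b e (j + 2)))) -
    h (segPar p 0 (q e i j (c • a e (i + 1)))) - h (segPar p 0 (q e i j (c • a e (i + 2)))) -
    h (segPar p 0 (q e i j (c • b e (j + 1)))) - h (segPar p 0 (q e i j (c • b e (j + 2))))

/-! ### Fans of triangles -/

/-- The points `N 0, …, N n` of a closed quadrant of the plane follow each other in the order of
their arguments, from one half axis to the other one. -/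
structure IsFan (σ τ : ℝ) (n : ℕ) (N : ℕ → ℂ) : Prop where
  cross_pos : ∀ l l', l < l' → l' ≤ n → 0 < σ * τ * cross (N l) (N l')
  re_nonneg : ∀ l ≤ n, 0 ≤ σ * (N l).re
  im_nonneg : ∀ l ≤ n, 0 ≤ τ * (N l).im
  re_pos : ∀ l < n, 0 < σ * (N l).re
  im_pos : ∀ l, 0 < l → l ≤ n → 0 < τ * (N l).im

namespace IsFan

variable {σ τ : ℝ} {n : ℕ} {N : ℕ → ℂ}

theorem cross_ne (h : IsFan σ τ n N) {l : ℕ} (hl : l < n) : cross (N l) (N (l + 1)) ≠ 0 := by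
  intro h0
  have := h.cross_pos l (l + 1) (by omega) (by omega)
  rw [h0, mul_zero] at this
  exact lt_irrefl _ this

theorem cross_nonneg (h : IsFan σ τ n N) {l l' : ℕ} (hl : l ≤ l') (hl' : l' ≤ n) :
    0 ≤ σ * τ * cross (N l) (N l') := by
  rcases hl.eq_or_lt with rfl | hl
  · simp [cross, mul_comm]
  · exact (h.cross_pos l l' hl hl').le

theorem quadrant_of_mem_tri (h : IsFan σ τ n N) {l : ℕ} (hl : l < n) {p : ℂ}
    (hp : p ∈ tri (N l) (N (l + 1))) : 0 < σ * p.re ∧ 0 < τ * p.im := by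
  obtain ⟨s, t, hs, ht, -, rfl⟩ := hp
  have h1 := mul_pos hs (h.re_pos l hl)
  have h2 := mul_nonneg ht.le (h.re_nonneg (l + 1) (by omega))
  have h3 := mul_nonneg hs.le (h.im_nonneg l hl.le)
  have h4 := mul_pos ht (h.im_pos (l + 1) (by omega) (by omega))
  simp only [Complex.add_re, Complex.add_im, Complex.re_ofReal_mul, Complex.im_ofReal_mul]
  constructor
  · linarith
  · linarith

theorem quadrant_of_mem_closedTri (h : IsFan σ τ n N) {l : ℕ} (hl : l < n) {p : ℂ}
    (hp : p ∈ closedTri (N l) (N (l + 1))) : 0 ≤ σ * p.re ∧ 0 ≤ τ * p.im := by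
  obtain ⟨s, t, hs, ht, -, rfl⟩ := hp
  have h1 := mul_nonneg hs (h.re_nonneg l hl.le)
  have h2 := mul_nonneg ht (h.re_nonneg (l + 1) (by omega))
  have h3 := mul_nonneg hs (h.im_nonneg l hl.le)
  have h4 := mul_nonneg ht (h.im_nonneg (l + 1) (by omega))
  simp only [Complex.add_re, Complex.add_im, Complex.re_ofReal_mul, Complex.im_ofReal_mul]
  constructor
  · linarith
  · linarith

theorem cross_of_mem_tri (h : IsFan σ τ n N) {l l' : ℕ} (hl : l < n) (hl' : l' ≤ n) {p : ℂ}
    (hp : p ∈ tri (N l) (N (l + 1))) :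
    (l' ≤ l → 0 < σ * τ * cross (N l') p) ∧ (l < l' → σ * τ * cross (N l') p < 0) := by
  obtain ⟨s, t, hs, ht, -, rfl⟩ := hp
  have e : σ * τ * cross (N l') (s * N l + t * N (l + 1)) =
      s * (σ * τ * cross (N l') (N l)) + t * (σ * τ * cross (N l') (N (l + 1))) := by
    simp only [cross, Complex.add_re, Complex.add_im, Complex.re_ofReal_mul,
      Complex.im_ofReal_mul]
    ring
  have e' : σ * τ * cross (N l') (s * N l + t * N (l + 1)) =
      -(s * (σ * τ * cross (N l) (N l')) + t * (σ * τ * cross (N (l + 1)) (N l'))) := by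
    simp only [cross, Complex.add_re, Complex.add_im, Complex.re_ofReal_mul,
      Complex.im_ofReal_mul]
    ring
  constructor <;> intro hll
  · rw [e]
    have h1 := h.cross_nonneg hll hl.le
    have h2 := h.cross_pos l' (l + 1) (by omega) (by omega)
    positivity
  · rw [e']
    have h1 := h.cross_pos l l' hll hl'
    have h2 := h.cross_nonneg (l := l + 1) hll hl'
    have := mul_pos hs h1
    have := mul_nonneg ht.le h2
    linarith

theorem cross_of_mem_closedTri (h : IsFan σ τ n N) {l l' : ℕ} (hl : l < n) (hl' : l' ≤ n) {p : ℂ}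
    (hp : p ∈ closedTri (N l) (N (l + 1))) :
    (l' ≤ l → 0 ≤ σ * τ * cross (N l') p) ∧ (l < l' → σ * τ * cross (N l') p ≤ 0) := by
  obtain ⟨s, t, hs, ht, -, rfl⟩ := hp
  have e : σ * τ * cross (N l') (s * N l + t * N (l + 1)) =
      s * (σ * τ * cross (N l') (N l)) + t * (σ * τ * cross (N l') (N (l + 1))) := by
    simp only [cross, Complex.add_re, Complex.add_im, Complex.re_ofReal_mul,
      Complex.im_ofReal_mul]
    ring
  have e' : σ * τ * cross (N l') (s * N l + t * N (l + 1)) =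
      -(s * (σ * τ * cross (N l) (N l')) + t * (σ * τ * cross (N (l + 1)) (N l'))) := by
    simp only [cross, Complex.add_re, Complex.add_im, Complex.re_ofReal_mul,
      Complex.im_ofReal_mul]
    ring
  constructor <;> intro hll
  · rw [e]
    have h1 := h.cross_nonneg hll hl.le
    have h2 := h.cross_nonneg (l := l') (l' := l + 1) (by omega) (by omega)
    positivity
  · rw [e']
    have h1 := h.cross_nonneg hll.le hl'
    have h2 := h.cross_nonneg (l := l + 1) hll hl'
    have := mul_nonneg hs h1
    have := mul_nonneg ht h2
    linarith

theorem notMem_closedTri (h : IsFan σ τ n N) {l l' : ℕ} (hl : l < n) (hl' : l' < n) (hne : l ≠ l')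
    {p : ℂ} (hp : p ∈ tri (N l) (N (l + 1))) : p ∉ closedTri (N l') (N (l' + 1)) := by
  intro hp'
  rcases hne.lt_or_gt with hlt | hlt
  · have h1 := (h.cross_of_mem_tri hl (l' := l') hl'.le hp).2 hlt
    have h2 := (h.cross_of_mem_closedTri hl' (l' := l') hl'.le hp').1 le_rfl
    linarith
  · have h1 := (h.cross_of_mem_tri hl (l' := l) hl.le hp).1 le_rfl
    have h2 := (h.cross_of_mem_closedTri hl' (l' := l) hl.le hp').2 hlt
    linarith

/-- A point of the fan which is not higher than `N 1` lies on the same side of the line through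
`N 0` and `N 1` as the origin. -/
theorem side_of_low (h : IsFan σ τ n N) (hn : 0 < n) (h0 : (N 0).im = 0) {l : ℕ} (hl : l < n)
    {p : ℂ} (hp : p ∈ tri (N l) (N (l + 1))) (hlow : τ * p.im ≤ τ * (N 1).im) :
    0 < σ * τ * cross (N 1 - N 0) (p - N 0) := by
  rcases Nat.eq_zero_or_pos l with rfl | hl0
  · obtain ⟨s, t, hs, ht, hst, rfl⟩ := hp
    have e : σ * τ * cross (N 1 - N 0) (s * N 0 + t * N (0 + 1) - N 0) =
        (1 - s - t) * (σ * τ * cross (N 0) (N 1)) := by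
      simp only [cross, Complex.add_re, Complex.add_im, Complex.sub_re, Complex.sub_im,
        Complex.re_ofReal_mul, Complex.im_ofReal_mul, zero_add]
      ring
    rw [e]
    exact mul_pos (by linarith) (h.cross_pos 0 1 one_pos hn)
  · have h1 := (h.cross_of_mem_tri hl (l' := 1) hn hp).1 hl0
    have h2 := h.re_pos 0 hn
    have e : σ * τ * cross (N 1 - N 0) (p - N 0) =
        σ * τ * cross (N 1) p + σ * (N 0).re * (τ * (N 1).im - τ * p.im) := by
      simp only [cross, Complex.sub_re, Complex.sub_im, h0]
      ring
    rw [e]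
    have := mul_nonneg h2.le (sub_nonneg.2 hlow)
    linarith

end IsFan

namespace SlidingFamily

variable {e : Frame} {c r R δ ν L : ℝ} {Γ ξ : Fin 3 → Fin 3 → ℝ → E4}

theorem abscissa_pos (F : SlidingFamily e c r R δ ν L Γ ξ) {i k : Fin 3} (m : Fin 3)
    (hk : k ≠ i) {θ : ℝ} (hθ : θ ∈ angles c r ν) :
    0 < sg i k * cX e i (graphPt e c r ξ k m θ) := by
  have h := F.flip.height_pos m hk (mem_angles_symm.2 hθ)
  rwa [graphPt_flip, cY_swapFrame] at h

/-- The radii are at least `c`, so that the arguments of the original curves grow at a rate which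
the displacement cannot compensate. -/
theorem det_curv_ge (F : SlidingFamily e c r R δ ν L Γ ξ) {θ θ' : ℝ}
    (h : θ ∈ Icc 0 (Real.pi / 2)) (h' : θ' ∈ Icc 0 (Real.pi / 2)) (hlt : θ ≤ θ') :
    63 / 100 * (c ^ 2 * (θ' - θ)) ≤ curvA c r θ * curvB c r θ' - curvB c r θ * curvA c r θ' := by
  have hc := F.sizes.c_pos
  have e1 : curvA c r θ * curvB c r θ' - curvB c r θ * curvA c r θ' =
      rad c r θ * rad c r θ' * Real.sin (θ' - θ) := by
    rw [Real.sin_sub]; simp only [curvA, curvB]; ring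
  have h1 := le_rad hc F.sizes.c_le_r h
  have h2 := le_rad hc F.sizes.c_le_r h'
  have h3 := Real.mul_le_sin (sub_nonneg.2 hlt) (by linarith [h.1, h'.2])
  have hpi := Real.pi_lt_d2
  -- Jordan's inequality `2 x / π ≤ sin x`
  have h5 : 63 / 100 ≤ 2 / Real.pi := by
    rw [le_div_iff₀ Real.pi_pos]; linarith
  have h6 : 63 / 100 * (θ' - θ) ≤ Real.sin (θ' - θ) :=
    (mul_le_mul_of_nonneg_right h5 (sub_nonneg.2 hlt)).trans h3
  rw [e1]
  have h7 : 0 ≤ 63 / 100 * (θ' - θ) := by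
    have := sub_nonneg.2 hlt
    positivity
  have h8 := hc.le.trans h1
  have h9 := mul_nonneg h8 (hc.le.trans h2)
  calc 63 / 100 * (c ^ 2 * (θ' - θ)) = c * c * (63 / 100 * (θ' - θ)) := by ring
    _ ≤ rad c r θ * rad c r θ' * Real.sin (θ' - θ) := by gcongr

theorem abs_ξ_sub_le (F : SlidingFamily e c r R δ ν L Γ ξ) (k m : Fin 3) {θ θ' : ℝ}
    (hθ : θ ∈ angles c r ν) (hθ' : θ' ∈ angles c r ν) :
    ‖ξ k m θ' - ξ k m θ‖ ≤ 1 / 100 * (c * |θ' - θ|) := by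
  have h1 := F.ξ_lip k m θ' hθ' θ hθ
  have h2 := norm_arcPt_sub_le (e := e) F.sizes k m hθ'.1 hθ.1
  have h3 := F.sizes.L_le
  have h4 := norm_nonneg (arcPt e c r k m θ' - arcPt e c r k m θ)
  have h5 : 0 ≤ c * |θ' - θ| := mul_nonneg F.sizes.c_pos.le (abs_nonneg _)
  have h6 : L * ‖arcPt e c r k m θ' - arcPt e c r k m θ‖ ≤
      1 / 1000 * ‖arcPt e c r k m θ' - arcPt e c r k m θ‖ := by gcongr
  linarith

/-- The arguments of the points of the projected shifted curves are monotone. -/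
theorem cross_graphPt_pos (F : SlidingFamily e c r R δ ν L Γ ξ) {i j k m : Fin 3} (hk : k ≠ i)
    (hm : m ≠ j) {θ θ' : ℝ} (hθ : θ ∈ angles c r ν) (hθ' : θ' ∈ angles c r ν) (hlt : θ < θ') :
    0 < sg i k * sg j m * cross (q e i j (graphPt e c r ξ k m θ))
      (q e i j (graphPt e c r ξ k m θ')) := by
  have hc := F.sizes.c_pos
  have hδ := F.sizes.δ_pos
  have hδc : δ ≤ c / 28 := by
    linarith [F.sizes.δ_lt, F.sizes.gap, F.sizes.R_lt]
  have hΔ : |θ' - θ| = θ' - θ := abs_of_pos (sub_pos.2 hlt)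
  have hs := sqrt_three_bounds
  have hdet := F.det_curv_ge hθ.1 hθ'.1 hlt.le
  obtain ⟨a1, a2⟩ := abs_curv_sub_le hc F.sizes.r_pos F.sizes.r_le hθ'.1 hθ.1
  rw [hΔ] at a1 a2
  have hξ := F.abs_ξ_sub_le k m hθ hθ'
  rw [hΔ] at hξ
  have f1 := (abs_cX_le e k _).trans hξ
  have g1 := (abs_cY_le e m _).trans hξ
  rw [cX_sub] at f1
  rw [cY_sub] at g1
  have f2 := F.abs_ξ_lt k m hθ
  have hA0 := (onCurve hc F.sizes.r_pos hθ.1)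
  rw [cross, q_re, q_im, q_re, q_im, F.graphPt_re m hk hθ, F.graphPt_re m hk hθ',
    F.graphPt_im k hm hθ, F.graphPt_im k hm hθ']
  set A := curvA c r θ
  set B := curvB c r θ
  set A' := curvA c r θ'
  set B' := curvB c r θ'
  set f := cX e k (ξ k m θ)
  set g := cY e m (ξ k m θ)
  set f' := cX e k (ξ k m θ')
  set g' := cY e m (ξ k m θ')
  set Δ := θ' - θ with hΔd
  have hΔ0 : 0 < Δ := sub_pos.2 hlt
  have e1 := sg_mul_self i k
  have e2 := sg_mul_self j m
  have s1 := abs_sg i k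
  have s2 := abs_sg j m
  set σ := sg i k
  set τ := sg j m
  have hh : √(3:ℝ) / 2 * (√3 / 2) = 3 / 4 := by
    have : √(3:ℝ) ^ 2 = 3 := Real.sq_sqrt (by norm_num)
    linear_combination this / 4
  have expand : σ * τ * ((σ * (√3 / 2 * A) - 1 / 2 * f) * (τ * (√3 / 2 * B') - 1 / 2 * g') -
      (τ * (√3 / 2 * B) - 1 / 2 * g) * (σ * (√3 / 2 * A') - 1 / 2 * f')) =
      3 / 4 * (A * B' - B * A') - √3 / 2 / 2 * (τ * (A * (g' - g)) - τ * (g * (A' - A)) +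
        σ * (f * (B' - B)) - σ * (B * (f' - f))) +
      σ * (τ * (f * (g' - g))) / 4 - σ * (τ * (g * (f' - f))) / 4 := by
    have e3 : σ * τ * ((σ * (√3 / 2 * A)) * (τ * (√3 / 2 * B')) -
      (τ * (√3 / 2 * B)) * (σ * (√3 / 2 * A'))) = 3 / 4 * (A * B' - B * A') := by
      linear_combination (τ * τ * (√3 / 2 * (√3 / 2)) * (A * B' - B * A')) * e1 +
        (√3 / 2 * (√3 / 2) * (A * B' - B * A')) * e2 + (A * B' - B * A') * hh
    linear_combination e3 - √3 / 2 / 2 * (τ * (A * g' - g * A')) * e1 -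
      √3 / 2 / 2 * (σ * (f * B' - B * f')) * e2
  rw [expand]
  -- the main term is at least `3/4 * 63/100` times `c² (θ' - θ)`, and the others are at most
  -- `1/8` and `1/1000` times the same quantity
  have bound : ∀ u v x y : ℝ, |u| ≤ x → |v| ≤ y → |u * v| ≤ x * y := fun u v x y hu hv => by
    rw [abs_mul]; exact mul_le_mul hu hv (abs_nonneg _) ((abs_nonneg _).trans hu)
  have b1 : |τ * (A * (g' - g))| ≤ 1 * (c * (1 / 100 * (c * Δ))) :=
    bound _ _ _ _ s2.le (bound _ _ _ _ (abs_le.2 ⟨by linarith [hA0.1], hA0.2.2.1⟩) g1)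
  have b2 : |τ * (g * (A' - A))| ≤ 1 * (c / 28 * (31 / 10 * c * Δ)) :=
    bound _ _ _ _ s2.le (bound _ _ _ _ (f2.2.le.trans hδc) a1)
  have b3 : |σ * (f * (B' - B))| ≤ 1 * (c / 28 * (31 / 10 * c * Δ)) :=
    bound _ _ _ _ s1.le (bound _ _ _ _ (f2.1.le.trans hδc) a2)
  have b4 : |σ * (B * (f' - f))| ≤ 1 * (c * (1 / 100 * (c * Δ))) :=
    bound _ _ _ _ s1.le (bound _ _ _ _
      (abs_le.2 ⟨by linarith [hA0.2.1], hA0.2.2.2.1⟩) f1)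
  have b5 : |σ * (τ * (f * (g' - g)))| ≤ 1 * (1 * (c / 28 * (1 / 100 * (c * Δ)))) :=
    bound _ _ _ _ s1.le (bound _ _ _ _ s2.le (bound _ _ _ _ (f2.1.le.trans hδc) g1))
  have b6 : |σ * (τ * (g * (f' - f)))| ≤ 1 * (1 * (c / 28 * (1 / 100 * (c * Δ)))) :=
    bound _ _ _ _ s1.le (bound _ _ _ _ s2.le (bound _ _ _ _ (f2.2.le.trans hδc) f1))
  rw [abs_le] at b1 b2 b3 b4 b5 b6
  have hcΔ : 0 < c ^ 2 * Δ := by positivity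
  have sum : τ * (A * (g' - g)) - τ * (g * (A' - A)) + σ * (f * (B' - B)) - σ * (B * (f' - f)) ≤
      25 / 100 * (c ^ 2 * Δ) := by
    nlinarith only [b1.2, b2.1, b3.2, b4.1, hcΔ]
  have sum2 : √3 / 2 / 2 * (τ * (A * (g' - g)) - τ * (g * (A' - A)) + σ * (f * (B' - B)) -
      σ * (B * (f' - f))) ≤ √3 / 2 / 2 * (25 / 100 * (c ^ 2 * Δ)) := by gcongr
  have sum3 : √3 / 2 / 2 * (25 / 100 * (c ^ 2 * Δ)) ≤ 1 / 2 * (25 / 100 * (c ^ 2 * Δ)) := by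
    gcongr; linarith [hs.2]
  nlinarith only [b5.1, b6.2, hcΔ, sum2, sum3, hdet]

/-- The vertices of the polygons form fans. -/
theorem isFan (F : SlidingFamily e c r R δ ν L Γ ξ) {i j k m : Fin 3} (hk : k ≠ i) (hm : m ≠ j)
    {n : ℕ} (hn : 0 < n) : IsFan (sg i k) (sg j m) (n + 2)
      (fun l => q e i j (node e c r δ ν ξ n k m l)) := by
  have hc := F.sizes.c_pos
  have hs := sqrt_three_bounds.1
  have e1 := sg_mul_self i k
  have e2 := sg_mul_self j m
  have hcs : 0 < √3 / 2 * c := by positivity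
  have cases : ∀ l ≤ n + 2, l = 0 ∨ l = n + 2 ∨ ∃ l', l' ≤ n ∧ l = l' + 1 := fun l hl => by
    rcases Nat.eq_zero_or_pos l with rfl | h0
    · exact Or.inl rfl
    · rcases hl.eq_or_lt with rfl | h1
      · exact Or.inr (Or.inl rfl)
      · exact Or.inr (Or.inr ⟨l - 1, by omega, by omega⟩)
  have hmem : ∀ l ≤ n, meshAngle c δ ν n l ∈ angles c r ν := fun l hl =>
    F.Icc_subset_angles (F.meshAngle_mem hn hl)
  have hre : ∀ l < n + 2, 0 < sg i k * (q e i j (node e c r δ ν ξ n k m l)).re := by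
    intro l hl
    rcases cases l hl.le with rfl | rfl | ⟨l', hl', rfl⟩
    · rw [node_zero, q_smul_a e j hk]
      show 0 < sg i k * (sg i k * (√3 / 2 * c))
      rw [← mul_assoc, e1, one_mul]; exact hcs
    · exact absurd hl (lt_irrefl _)
    · rw [node_succ _ _ _ _ _ _ _ _ hl', q_re]
      exact F.abscissa_pos m hk (hmem l' hl')
  have him : ∀ l, 0 < l → l ≤ n + 2 → 0 < sg j m * (q e i j (node e c r δ ν ξ n k m l)).im := by
    intro l h0 hl
    rcases cases l hl with rfl | rfl | ⟨l', hl', rfl⟩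
    · exact absurd h0 (lt_irrefl _)
    · rw [node_last, q_smul_b e i hm]
      show 0 < sg j m * (sg j m * (√3 / 2 * c))
      rw [← mul_assoc, e2, one_mul]; exact hcs
    · rw [node_succ _ _ _ _ _ _ _ _ hl', q_im]
      exact F.height_pos k hm (hmem l' hl')
  refine ⟨fun l l' hll hl' => ?_, fun l hl => ?_, fun l hl => ?_, hre, him⟩
  · rcases cases l (hll.le.trans hl') with rfl | rfl | ⟨u, hu, rfl⟩
    · have h1 := him l' hll hl'
      have h2 : sg i k * sg j m * cross (q e i j (node e c r δ ν ξ n k m 0))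
          (q e i j (node e c r δ ν ξ n k m l')) =
          √3 / 2 * c * (sg j m * (q e i j (node e c r δ ν ξ n k m l')).im) := by
        rw [node_zero, q_smul_a e j hk, cross]
        linear_combination (√3 / 2 * c * (sg j m * (q e i j (node e c r δ ν ξ n k m l')).im)) * e1
      rw [h2]
      exact mul_pos hcs h1
    · omega
    · rcases cases l' hl' with rfl | rfl | ⟨u', hu', rfl⟩
      · omega
      · have h1 := hre (u + 1) hll
        have h2 : sg i k * sg j m * cross (q e i j (node e c r δ ν ξ n k m (u + 1)))
            (q e i j (node e c r δ ν ξ n k m (n + 2))) =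
            √3 / 2 * c * (sg i k * (q e i j (node e c r δ ν ξ n k m (u + 1))).re) := by
          rw [node_last, q_smul_b e i hm, cross]
          linear_combination
            (√3 / 2 * c * (sg i k * (q e i j (node e c r δ ν ξ n k m (u + 1))).re)) * e2
        rw [h2]
        exact mul_pos hcs h1
      · rw [node_succ _ _ _ _ _ _ _ _ hu, node_succ _ _ _ _ _ _ _ _ hu']
        exact F.cross_graphPt_pos hk hm (hmem u hu) (hmem u' hu') (F.meshAngle_lt hn (by omega))
  · rcases hl.eq_or_lt with rfl | h
    · rw [node_last, q_smul_b e i hm]; simp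
    · exact (hre l h).le
  · rcases Nat.eq_zero_or_pos l with rfl | h
    · rw [node_zero, q_smul_a e j hk]; simp
    · exact (him l h hl).le

end SlidingFamily

/-! ### The regions covered by the fans -/

/-- The index set of the triangles of the four fans in the plane `Q i j`. -/
def cellIndex (n : ℕ) (i j : Fin 3) : Finset (Fin 3 × Fin 3 × ℕ) :=
  Finset.univ.erase i ×ˢ Finset.univ.erase j ×ˢ Finset.range (n + 2)

/-- The vertices of the projected polygons. -/
noncomputable def qNode (e : Frame) (c r δ ν : ℝ) (ξ : Fin 3 → Fin 3 → ℝ → E4) (n : ℕ)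
    (i j : Fin 3) (k m : Fin 3) (l : ℕ) : ℂ := q e i j (node e c r δ ν ξ n k m l)

/-- The open triangles of the fans. -/
def cell (e : Frame) (c r δ ν : ℝ) (ξ : Fin 3 → Fin 3 → ℝ → E4) (n : ℕ) (i j : Fin 3)
    (x : Fin 3 × Fin 3 × ℕ) : Set ℂ :=
  tri (qNode e c r δ ν ξ n i j x.1 x.2.1 x.2.2) (qNode e c r δ ν ξ n i j x.1 x.2.1 (x.2.2 + 1))

/-- The union of the four fans. -/
def region (e : Frame) (c r δ ν : ℝ) (ξ : Fin 3 → Fin 3 → ℝ → E4) (n : ℕ) (i j : Fin 3) : Set ℂ :=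
  ⋃ x ∈ cellIndex n i j, cell e c r δ ν ξ n i j x

/-- The projections of the shifted curves. -/
def shiftedCurves (e : Frame) (c r ν : ℝ) (ξ : Fin 3 → Fin 3 → ℝ → E4) (i j : Fin 3) : Set ℂ :=
  ⋃ (k) (m), (fun θ => q e i j (graphPt e c r ξ k m θ)) '' angles c r ν

theorem mem_cellIndex {n : ℕ} {i j : Fin 3} {x : Fin 3 × Fin 3 × ℕ} :
    x ∈ cellIndex n i j ↔ x.1 ≠ i ∧ x.2.1 ≠ j ∧ x.2.2 < n + 2 := by
  simp [cellIndex]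

/-- The measurable sets `S i j` contain all points around which the deformed curves have odd winding
parity. -/
structure IsFilling (e : Frame) (Γ : Fin 3 → Fin 3 → ℝ → E4) (S : Fin 3 → Fin 3 → Set ℂ) :
    Prop where
  measurable : ∀ i j, MeasurableSet (S i j)
  mem : ∀ i j p, OffCurves e Γ i j p → sumPar e Γ i j p = 1 → p ∈ S i j

theorem add_one_ne_add_two (i : Fin 3) : i + 1 ≠ i + 2 := by
  revert i; decide

theorem swap_swap (z : ℂ) : swap (swap z) = z := rfl

theorem measurePreserving_swap : MeasurePreserving swap volume volume := by
  have h := (Complex.volume_preserving_equiv_real_prod.symm _).comp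
    (Measure.measurePreserving_swap.comp Complex.volume_preserving_equiv_real_prod)
  exact h

namespace SlidingFamily

variable {e : Frame} {c r R δ ν L : ℝ} {Γ ξ : Fin 3 → Fin 3 → ℝ → E4} {n : ℕ}

theorem volume_not_offCurves (F : SlidingFamily e c r R δ ν L Γ ξ) (i j : Fin 3) :
    volume {p | ¬ OffCurves e Γ i j p} = 0 := by
  have h : {p | ¬ OffCurves e Γ i j p} ⊆
      ⋃ (k) (m), (fun θ => q e i j (Γ k m θ)) '' Icc 0 (Real.pi / 2) := by
    intro p hp
    simp only [OffCurves, mem_ofPred_eq] at hp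
    push Not at hp
    obtain ⟨k, m, θ, hθ, h⟩ := hp
    exact mem_iUnion₂.2 ⟨k, m, θ, hθ, h⟩
  refine measure_mono_null h (measure_iUnion_null fun k => measure_iUnion_null fun m => ?_)
  obtain ⟨K, hK⟩ := F.lip k m
  refine volume_image_lipschitz_curve (K := K)
    (LipschitzOnWith.of_dist_le_mul fun θ hθ θ' hθ' => ?_)
  refine le_trans ?_ (hK.dist_le_mul θ hθ θ' hθ')
  rw [dist_eq_norm, dist_eq_norm]
  exact norm_q_sub_le e i j _ _

theorem isCompact_shiftedCurves (F : SlidingFamily e c r R δ ν L Γ ξ) (i j : Fin 3) :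
    IsCompact (shiftedCurves e c r ν ξ i j) := by
  refine isCompact_iUnion fun k => isCompact_iUnion fun m => ?_
  refine IsCompact.image_of_continuousOn ?_ (F.lipschitzOnWith_q_graphPt i j k m).continuousOn
  rw [angles_eq F.sizes (by linarith [F.sizes.δ_pos, F.sizes.δ_lt])
    (by linarith [F.sizes.δ_pos, F.sizes.gap])]
  exact isCompact_Icc

theorem volume_shiftedCurves (F : SlidingFamily e c r R δ ν L Γ ξ) (i j : Fin 3) :
    volume (shiftedCurves e c r ν ξ i j) = 0 :=
  measure_iUnion_null fun k => measure_iUnion_null fun m =>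
    volume_image_lipschitz_curve (F.lipschitzOnWith_q_graphPt i j k m)

/-- The triangles do not overlap: within a quadrant by the order of the arguments, and otherwise by
the signs of the coordinates. -/
theorem notMem_closedTri_of_mem_cell (F : SlidingFamily e c r R δ ν L Γ ξ) (hn : 0 < n)
    {i j : Fin 3} {x x' : Fin 3 × Fin 3 × ℕ} (hx : x ∈ cellIndex n i j) (hx' : x' ∈ cellIndex n i j)
    (hne : x ≠ x') {p : ℂ} (hp : p ∈ cell e c r δ ν ξ n i j x) :
    p ∉ closedTri (qNode e c r δ ν ξ n i j x'.1 x'.2.1 x'.2.2)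
      (qNode e c r δ ν ξ n i j x'.1 x'.2.1 (x'.2.2 + 1)) := by
  obtain ⟨k, m, l⟩ := x
  obtain ⟨k', m', l'⟩ := x'
  obtain ⟨hk, hm, hl⟩ := mem_cellIndex.1 hx
  obtain ⟨hk', hm', hl'⟩ := mem_cellIndex.1 hx'
  dsimp only at hk hm hl hk' hm' hl'
  have hf := F.isFan hk hm hn
  have hf' := F.isFan hk' hm' hn
  intro hp'
  obtain ⟨h1, h2⟩ := hf.quadrant_of_mem_tri hl hp
  obtain ⟨h3, h4⟩ := hf'.quadrant_of_mem_closedTri hl' hp'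
  by_cases hkk : k = k'
  · by_cases hmm : m = m'
    · subst hkk hmm
      exact hf.notMem_closedTri hl hl' (fun h => hne (by rw [h])) hp hp'
    · rw [sg_of_ne hm hm' hmm] at h4; linarith
  · rw [sg_of_ne hk hk' hkk] at h3; linarith

theorem _root_.YProd.tri_subset_closedTri (P Q : ℂ) : tri P Q ⊆ closedTri P Q :=
  fun _ ⟨s, t, hs, ht, hst, h⟩ => ⟨s, t, hs.le, ht.le, hst.le, h⟩

theorem cross_qNode_ne (F : SlidingFamily e c r R δ ν L Γ ξ) (hn : 0 < n) {i j : Fin 3}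
    {x : Fin 3 × Fin 3 × ℕ} (hx : x ∈ cellIndex n i j) :
    cross (qNode e c r δ ν ξ n i j x.1 x.2.1 x.2.2)
      (qNode e c r δ ν ξ n i j x.1 x.2.1 (x.2.2 + 1)) ≠ 0 := by
  obtain ⟨hk, hm, hl⟩ := mem_cellIndex.1 hx
  exact (F.isFan hk hm hn).cross_ne hl

theorem measurableSet_region (F : SlidingFamily e c r R δ ν L Γ ξ) (hn : 0 < n) (i j : Fin 3) :
    MeasurableSet (region e c r δ ν ξ n i j) :=
  Finset.measurableSet_biUnion _ fun _ hx => measurableSet_tri (F.cross_qNode_ne hn hx)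

theorem volume_region (F : SlidingFamily e c r R δ ν L Γ ξ) (hn : 0 < n) (i j : Fin 3) :
    volume (region e c r δ ν ξ n i j) =
      ∑ x ∈ cellIndex n i j, volume (cell e c r δ ν ξ n i j x) := by
  refine measure_biUnion_finset (fun x hx x' hx' hne => ?_) fun _ hx =>
    measurableSet_tri (F.cross_qNode_ne hn hx)
  refine disjoint_left.2 fun p hp hp' => ?_
  exact F.notMem_closedTri_of_mem_cell hn hx hx' hne hp (tri_subset_closedTri _ _ hp')

/-- Off the boxes and off a neighbourhood of the shifted curves, the region is filled. -/
theorem volume_region_diff_le (F : SlidingFamily e c r R δ ν L Γ ξ) (hn : 0 < n) {ρ : ℝ}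
    (hρ : 7 * c * (Real.pi / 2) < n * ρ) {S : Fin 3 → Fin 3 → Set ℂ} (hS : IsFilling e Γ S)
    {i j : Fin 3} {X : Set ℂ} (hA : ∀ k, k ≠ i → box e c r δ ν ξ i j k ⊆ X)
    (hB : ∀ m, m ≠ j → boxB e c r δ ν ξ i j m ⊆ X) :
    volume (region e c r δ ν ξ n i j \ X) ≤ volume (S i j \ X) +
      volume (Metric.cthickening ρ (shiftedCurves e c r ν ξ i j)) := by
  -- the points on the level of a vertex, where the parity of a triangle is not determined
  set V : Set ℂ := ⋃ x ∈ cellIndex n i j,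
    ({z : ℂ | z.im = (qNode e c r δ ν ξ n i j x.1 x.2.1 x.2.2).im} ∪
      {z : ℂ | z.im = (qNode e c r δ ν ξ n i j x.1 x.2.1 (x.2.2 + 1)).im}) with hV
  have hV0 : volume V = 0 := by
    refine (measure_biUnion_null_iff (Finset.countable_toSet _)).2 fun x _ => ?_
    exact measure_union_null (volume_im_eq _) (volume_im_eq _)
  have hsub : region e c r δ ν ξ n i j \ X ⊆ (S i j \ X ∪
      Metric.cthickening ρ (shiftedCurves e c r ν ξ i j)) ∪
        ({p | ¬ OffCurves e Γ i j p} ∪ V) := by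
    rintro p ⟨hpT, hpX⟩
    by_cases hoff : OffCurves e Γ i j p
    swap
    · exact Or.inr (Or.inl hoff)
    by_cases hpV : p ∈ V
    · exact Or.inr (Or.inr hpV)
    by_cases hpC : p ∈ Metric.cthickening ρ (shiftedCurves e c r ν ξ i j)
    · exact Or.inl (Or.inr hpC)
    refine Or.inl (Or.inl ⟨hS.mem i j p hoff ?_, hpX⟩)
    rw [F.sumPar_eq_triPar hn hρ hoff (fun k m θ hθ => ?_) (fun k hk h => hpX (hA k hk h))
      (fun m hm h => hpX (hB m hm h))]
    · obtain ⟨x, hx, hpx⟩ := mem_iUnion₂.1 hpT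
      have h1 : ∀ f : Fin 3 × Fin 3 × ℕ → ZMod 2, ∑ k ∈ Finset.univ.erase i,
          ∑ m ∈ Finset.univ.erase j, ∑ l ∈ Finset.range (n + 2), f (k, m, l) =
          ∑ x ∈ cellIndex n i j, f x := fun f => by
        rw [cellIndex, Finset.sum_product]
        exact Finset.sum_congr rfl fun k _ => (Finset.sum_product _ _ fun y => f (k, y)).symm
      rw [h1 (fun x => triPar p (q e i j (node e c r δ ν ξ n x.1 x.2.1 x.2.2))
        (q e i j (node e c r δ ν ξ n x.1 x.2.1 (x.2.2 + 1)))),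
        Finset.sum_eq_single_of_mem x hx]
      · obtain ⟨hk, hm, hl⟩ := mem_cellIndex.1 hx
        have h2 := ((F.isFan hk hm hn).quadrant_of_mem_tri hl hpx).2
        refine triPar_of_mem hpx (F.cross_qNode_ne hn hx) (fun h => ?_) (fun h => hpV ?_)
          (fun h => hpV ?_)
        · rw [h, mul_zero] at h2; exact lt_irrefl _ h2
        · exact mem_iUnion₂.2 ⟨x, hx, Or.inl h⟩
        · exact mem_iUnion₂.2 ⟨x, hx, Or.inr h⟩
      · exact fun x' hx' hne => triPar_of_notMem
          (F.notMem_closedTri_of_mem_cell hn hx hx' hne.symm hpx)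
    · by_contra h
      push Not at h
      exact hpC (Metric.mem_cthickening_of_dist_le p _ ρ _
        (mem_iUnion₂.2 ⟨k, m, θ, hθ, rfl⟩) h.le)
  calc volume (region e c r δ ν ξ n i j \ X) ≤ _ := measure_mono hsub
    _ ≤ volume (S i j \ X ∪ Metric.cthickening ρ (shiftedCurves e c r ν ξ i j)) +
        volume ({p | ¬ OffCurves e Γ i j p} ∪ V) := measure_union_le _ _
    _ = volume (S i j \ X ∪ Metric.cthickening ρ (shiftedCurves e c r ν ξ i j)) := by
        rw [measure_union_null (F.volume_not_offCurves i j) hV0, add_zero]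
    _ ≤ _ := measure_union_le _ _

/-! ### The areas in the boxes -/

/-- In a box, the region lies on one side of the line through the first two vertices of the
polygon. -/
theorem side_of_mem_box (F : SlidingFamily e c r R δ ν L Γ ξ) (hn : 0 < n) {i j k : Fin 3}
    (hk : k ≠ i) {p : ℂ} (hp : p ∈ region e c r δ ν ξ n i j) (hb : p ∈ box e c r δ ν ξ i j k) :
    ∃ m, m ≠ j ∧ 0 < sg j m * p.im ∧ 0 < sg i k * sg j m *
      cross (q e i j (graphPt e c r ξ k m (cutAngle c δ ν) - c • a e k))
        (p - q e i j (c • a e k)) := by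
  obtain ⟨⟨k', m, l⟩, hx, hpx⟩ := mem_iUnion₂.1 hp
  obtain ⟨hk', hm, hl⟩ := mem_cellIndex.1 hx
  dsimp only at hk' hm hl
  have hf := F.isFan hk' hm hn
  obtain ⟨h1, h2⟩ := hf.quadrant_of_mem_tri hl hpx
  obtain rfl : k = k' := by
    by_contra hne
    rw [sg_of_ne hk hk' hne] at h1
    have h3 := hb.1
    have h4 := sg_mul_self i k
    have h5 : |sg i k * p.re - √3 / 2 * c| ≤ δ := by
      rw [← one_mul |_|, ← abs_sg i k, ← abs_mul] at h3
      have : sg i k * (p.re - sg i k * (√3 / 2 * c)) = sg i k * p.re - √3 / 2 * c := by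
        linear_combination -(√3 / 2 * c) * h4
      rwa [this] at h3
    have h6 := (abs_le.1 h5).1
    have := F.sizes.R_lt; have := F.sizes.gap; have := F.sizes.δ_pos; have := F.sizes.δ_lt
    have := F.sizes.c_pos
    nlinarith [sqrt_three_bounds.1]
  have e1 : q e i j (node e c r δ ν ξ n k m 1) =
      q e i j (graphPt e c r ξ k m (cutAngle c δ ν)) := by
    rw [node_succ _ _ _ _ _ _ _ _ (Nat.zero_le n), meshAngle_zero]
  have h3 := hf.side_of_low (by omega) (by rw [node_zero, q_smul_a e j hk]) hl hpx
    (by rw [e1]; exact hb.2 m hm)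
  refine ⟨m, hm, h2, ?_⟩
  have e2 : q e i j (graphPt e c r ξ k m (cutAngle c δ ν) - c • a e k) =
      q e i j (node e c r δ ν ξ n k m 1) - q e i j (node e c r δ ν ξ n k m 0) := by
    rw [e1, node_zero]
    apply Complex.ext
    · simp only [q_re, Complex.sub_re, cX_sub]
    · simp only [q_im, Complex.sub_im, cY_sub]
  rw [e2, ← node_zero e c r δ ν ξ n k m]
  exact h3

theorem _root_.YProd.mem_box_translate {e : Frame} {c r δ ν : ℝ} {ξ : Fin 3 → Fin 3 → ℝ → E4} {i j : Fin 3}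
    {p : ℂ} : p - (√3 * c : ℝ) ∈ box e c r δ ν ξ (i + 2) j (i + 1) ↔
      p ∈ box e c r δ ν ξ i j (i + 1) := by
  have h : sg (i + 2) (i + 1) = -1 := by
    rw [← (fin3_add i).2.2.2]; exact sg_two _
  simp only [box, mem_ofPred_eq, Complex.sub_re, Complex.sub_im, Complex.ofReal_re,
    Complex.ofReal_im, sub_zero, h, sg_one]
  rw [show p.re - √3 * c - -1 * (√3 / 2 * c) = p.re - 1 * (√3 / 2 * c) by ring]

/-- The parts, in the boxes around the two images of a face, of the regions in the two planes are
disjoint after a translation. -/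
theorem region_disjoint (F : SlidingFamily e c r R δ ν L Γ ξ) (hn : 0 < n) {i j : Fin 3} {p : ℂ}
    (hp : p ∈ region e c r δ ν ξ n i j) (hb : p ∈ box e c r δ ν ξ i j (i + 1)) :
    p - (√3 * c : ℝ) ∉ region e c r δ ν ξ n (i + 2) j := by
  intro hp'
  have hb' := mem_box_translate.2 hb
  have hk : i + 1 ≠ i := add_one_ne i
  have hk' : i + 1 ≠ i + 2 := add_one_ne_add_two i
  have s2 : sg (i + 2) (i + 1) = -1 := by
    rw [← (fin3_add i).2.2.2]; exact sg_two _
  obtain ⟨m, hm, h1, h2⟩ := F.side_of_mem_box hn hk hp hb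
  obtain ⟨m', hm', h3, h4⟩ := F.side_of_mem_box hn hk' hp' hb'
  obtain rfl : m = m' := by
    by_contra hne
    rw [sg_of_ne hm hm' hne] at h3
    simp only [Complex.sub_im, Complex.ofReal_im] at h3
    linarith
  have e1 : q e (i + 2) j (graphPt e c r ξ (i + 1) m (cutAngle c δ ν) - c • a e (i + 1)) =
      q e i j (graphPt e c r ξ (i + 1) m (cutAngle c δ ν) - c • a e (i + 1)) := by
    have hA : cA e (i + 1) (graphPt e c r ξ (i + 1) m (cutAngle c δ ν) - c • a e (i + 1)) = 0 := by
      have h5 := (coord_quadPt e (i + 1) m c 0).1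
      rw [quadPt, zero_smul, add_zero] at h5
      rw [cA_sub, (F.coord_graphPt (i + 1) m F.cutAngle_mem).1, F.cutAngle_spec.2.1, h5, sub_self]
    rw [q_eq, q_eq, cX_eq_sg e hk', cX_eq_sg e hk, hA]; simp
  have e2 : p - (√3 * c : ℝ) - q e (i + 2) j (c • a e (i + 1)) =
      p - q e i j (c • a e (i + 1)) := by
    rw [q_smul_a e j hk', q_smul_a e j hk, s2, sg_one]
    apply Complex.ext
    · simp only [Complex.sub_re, Complex.ofReal_re]; ring
    · simp only [Complex.sub_im, Complex.ofReal_im]; ring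
  rw [e1, e2, s2] at h4
  rw [sg_one] at h2
  linarith

/-- In the two boxes around the images of a face, the regions have at most the area of one box, and
the fillings at least this area. -/
theorem volume_box_pair_le (F : SlidingFamily e c r R δ ν L Γ ξ) (hn : 0 < n)
    {S : Fin 3 → Fin 3 → Set ℂ} (hS : IsFilling e Γ S) (i j : Fin 3) :
    volume (region e c r δ ν ξ n i j ∩ box e c r δ ν ξ i j (i + 1)) +
      volume (region e c r δ ν ξ n (i + 2) j ∩ box e c r δ ν ξ (i + 2) j (i + 1)) ≤
    volume (S i j ∩ box e c r δ ν ξ i j (i + 1)) +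
      volume (S (i + 2) j ∩ box e c r δ ν ξ (i + 2) j (i + 1)) := by
  have htr : ∀ A : Set ℂ, volume {p | p - ((√3 * c : ℝ) : ℂ) ∈ A} = volume A := fun A => by
    simp only [sub_eq_add_neg]
    exact measure_preimage_add_right volume _ A
  have hmeas : ∀ A : Set ℂ, MeasurableSet A → MeasurableSet {p | p - ((√3 * c : ℝ) : ℂ) ∈ A} :=
    fun A hA => (measurable_id.sub_const _) hA
  rw [← htr (region e c r δ ν ξ n (i + 2) j ∩ _), ← htr (S (i + 2) j ∩ _), ← measure_union]
  · have h1 : region e c r δ ν ξ n i j ∩ box e c r δ ν ξ i j (i + 1) ∪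
        {p | p - (√3 * c : ℝ) ∈ region e c r δ ν ξ n (i + 2) j ∩
          box e c r δ ν ξ (i + 2) j (i + 1)} ⊆ box e c r δ ν ξ i j (i + 1) := by
      rintro p (hp | hp)
      · exact hp.2
      · exact mem_box_translate.1 hp.2
    have h2 : box e c r δ ν ξ i j (i + 1) ⊆ (S i j ∩ box e c r δ ν ξ i j (i + 1) ∪
        {p | p - (√3 * c : ℝ) ∈ S (i + 2) j ∩ box e c r δ ν ξ (i + 2) j (i + 1)}) ∪
        ({p | ¬ OffCurves e Γ i j p} ∪
          {p | p - (√3 * c : ℝ) ∈ {p | ¬ OffCurves e Γ (i + 2) j p}}) := by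
      intro p hp
      by_cases hoff : OffCurves e Γ i j p
      swap
      · exact Or.inr (Or.inl hoff)
      by_cases hoff' : OffCurves e Γ (i + 2) j (p - (√3 * c : ℝ))
      swap
      · exact Or.inr (Or.inr hoff')
      have hre := hp.1
      rw [sg_one, one_mul] at hre
      have h3 := F.sumPar_add i j hre (F.im_of_mem_box hp) hoff
      have h4 : ∀ u v : ZMod 2, u + v = 1 → u = 1 ∨ v = 1 := by decide
      rcases h4 _ _ h3 with h5 | h5
      · exact Or.inl (Or.inl ⟨hS.mem i j p hoff h5, hp⟩)
      · exact Or.inl (Or.inr ⟨hS.mem (i + 2) j _ hoff' h5, mem_box_translate.2 hp⟩)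
    calc _ ≤ volume (box e c r δ ν ξ i j (i + 1)) := measure_mono h1
      _ ≤ _ := measure_mono h2
      _ ≤ _ := measure_union_le _ _
      _ ≤ _ + 0 := by
        refine add_le_add (measure_union_le _ _) (le_of_eq ?_)
        refine measure_union_null (F.volume_not_offCurves i j) ?_
        rw [htr]; exact F.volume_not_offCurves (i + 2) j
      _ = _ := add_zero _
  · refine disjoint_left.2 fun p hp hp' => ?_
    exact F.region_disjoint hn hp.1 hp.2 hp'.1
  · exact hmeas _ ((F.measurableSet_region hn _ _).inter
      (isClosed_box _ _ _ _ _ _ _ _ _).measurableSet)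

/-- The area of a set in the two boxes around the images of the faces of the `a k`. -/
noncomputable def _root_.YProd.boxArea (e : Frame) (c r δ ν : ℝ) (ξ : Fin 3 → Fin 3 → ℝ → E4) (i j : Fin 3)
    (A : Set ℂ) : ENNReal :=
  volume (A ∩ box e c r δ ν ξ i j (i + 1)) + volume (A ∩ box e c r δ ν ξ i j (i + 2))

theorem sum_boxArea_le (F : SlidingFamily e c r R δ ν L Γ ξ) (hn : 0 < n)
    {S : Fin 3 → Fin 3 → Set ℂ} (hS : IsFilling e Γ S) (j : Fin 3) :
    ∑ i, boxArea e c r δ ν ξ i j (region e c r δ ν ξ n i j) ≤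
      ∑ i, boxArea e c r δ ν ξ i j (S i j) := by
  have key : ∀ A : Fin 3 → Set ℂ, ∑ i, boxArea e c r δ ν ξ i j (A i) =
      ∑ i, (volume (A i ∩ box e c r δ ν ξ i j (i + 1)) +
        volume (A (i + 2) ∩ box e c r δ ν ξ (i + 2) j (i + 1))) := by
    intro A
    have h := Equiv.sum_comp (Equiv.addRight (2 : Fin 3))
      (fun i => volume (A i ∩ box e c r δ ν ξ i j (i + 2)))
    simp only [Equiv.coe_addRight, (fin3_add _).2.2.2] at h
    simp only [boxArea, Finset.sum_add_distrib, h]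
  rw [key, key]
  exact Finset.sum_le_sum fun i _ => F.volume_box_pair_le hn hS i j

end SlidingFamily

/-! ### The exchange of the two planes -/

theorem tri_comm (P Q : ℂ) : tri P Q = tri Q P := by
  ext p
  constructor <;> rintro ⟨s, t, hs, ht, hst, h⟩ <;>
    exact ⟨t, s, ht, hs, by rwa [add_comm], by rw [h, add_comm]⟩

theorem mem_tri_swap {p P Q : ℂ} : p ∈ tri (swap P) (swap Q) ↔ swap p ∈ tri P Q := by
  have h : ∀ s t : ℝ, p = s * swap P + t * swap Q ↔ swap p = s * P + t * Q := by
    intro s t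
    rw [Complex.ext_iff, Complex.ext_iff, and_comm]
    simp [swap]
  simp only [tri, mem_ofPred_eq, h]

namespace SlidingFamily

variable {e : Frame} {c r R δ ν L : ℝ} {Γ ξ : Fin 3 → Fin 3 → ℝ → E4} {n : ℕ}

theorem _root_.YProd.node_flip (hn : 0 < n) (k m : Fin 3) {l : ℕ} (hl : l ≤ n + 2) :
    node (swapFrame e) c r δ ν (YProd.flip ξ) n m k l = node e c r δ ν ξ n k m (n + 2 - l) := by
  have hn' : (0:ℝ) < n := Nat.cast_pos.2 hn
  rcases Nat.eq_zero_or_pos l with rfl | h0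
  · rw [node_zero, Nat.sub_zero, node_last, a_swapFrame]
  · rcases hl.eq_or_lt with rfl | h1
    · rw [node_last, Nat.sub_self, node_zero, b_swapFrame]
    · obtain ⟨u, rfl⟩ : ∃ u, l = u + 1 := ⟨l - 1, by omega⟩
      have e1 : n + 2 - (u + 1) = (n - u) + 1 := by omega
      have hu : u ≤ n := by omega
      rw [e1, node_succ _ _ _ _ _ _ _ _ hu, node_succ _ _ _ _ _ _ _ _ (Nat.sub_le n u)]
      have e2 : meshAngle c δ ν n u = Real.pi / 2 - meshAngle c δ ν n (n - u) := by
        rw [meshAngle, meshAngle, Nat.cast_sub hu]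
        field_simp; ring
      rw [e2, graphPt_flip]

theorem _root_.YProd.region_flip (hn : 0 < n) (i j : Fin 3) :
    region (swapFrame e) c r δ ν (YProd.flip ξ) n j i = swap ⁻¹' region e c r δ ν ξ n i j := by
  have key : ∀ k m l, l < n + 2 →
      ∀ p, p ∈ cell (swapFrame e) c r δ ν (YProd.flip ξ) n j i (m, k, l) ↔
        swap p ∈ cell e c r δ ν ξ n i j (k, m, n + 1 - l) := by
    intro k m l hl p
    rw [cell, cell, qNode, qNode, qNode, qNode, node_flip hn k m hl.le, node_flip hn k m hl,
      q_swapFrame, q_swapFrame, mem_tri_swap, tri_comm]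
    rw [show n + 2 - (l + 1) = n + 1 - l by omega, show n + 2 - l = n + 1 - l + 1 by omega]
  ext p
  simp only [region, mem_iUnion₂, mem_preimage]
  constructor
  · rintro ⟨⟨m, k, l⟩, hx, hp⟩
    obtain ⟨hm, hk, hl⟩ := mem_cellIndex.1 hx
    exact ⟨(k, m, n + 1 - l), mem_cellIndex.2 ⟨hk, hm, by simp only; omega⟩,
      (key k m l hl p).1 hp⟩
  · rintro ⟨⟨k, m, l⟩, hx, hp⟩
    obtain ⟨hk, hm, hl⟩ := mem_cellIndex.1 hx
    dsimp only at hl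
    refine ⟨(m, k, n + 1 - l), mem_cellIndex.2 ⟨hm, hk, by simp only; omega⟩,
      (key k m (n + 1 - l) (by omega) p).2 ?_⟩
    rwa [show n + 1 - (n + 1 - l) = l by omega]

theorem isFilling_flip (F : SlidingFamily e c r R δ ν L Γ ξ) {S : Fin 3 → Fin 3 → Set ℂ}
    (hS : IsFilling e Γ S) :
    IsFilling (swapFrame e) (YProd.flip Γ) (fun j i => swap ⁻¹' S i j) where
  measurable j i := measurePreserving_swap.measurable (hS.measurable i j)
  mem j i p hoff hp := by
    have h : OffCurves e Γ i j (swap p) := by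
      intro k m θ hθ h
      refine hoff m k _ (mem_symm_iff.2 hθ) ?_
      rw [YProd.flip, sub_sub_cancel, q_swapFrame, h, swap_swap]
    refine hS.mem i j _ h ?_
    rw [← F.sumPar_flip i j h, swap_swap]
    exact hp

/-- The area of a set in the two boxes around the images of the faces of the `b m`. -/
noncomputable def _root_.YProd.boxAreaB (e : Frame) (c r δ ν : ℝ) (ξ : Fin 3 → Fin 3 → ℝ → E4) (i j : Fin 3)
    (A : Set ℂ) : ENNReal :=
  volume (A ∩ boxB e c r δ ν ξ i j (j + 1)) + volume (A ∩ boxB e c r δ ν ξ i j (j + 2))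

theorem _root_.YProd.measurableSet_boxB (e : Frame) (c r δ ν : ℝ) (ξ : Fin 3 → Fin 3 → ℝ → E4)
    (i j m : Fin 3) : MeasurableSet (boxB e c r δ ν ξ i j m) :=
  measurePreserving_swap.measurable (isClosed_box _ _ _ _ _ _ _ _ _).measurableSet

theorem _root_.YProd.boxArea_flip {i j : Fin 3} {A : Set ℂ} (hA : MeasurableSet A) :
    boxArea (swapFrame e) c r δ ν (YProd.flip ξ) j i (swap ⁻¹' A) =
      boxAreaB e c r δ ν ξ i j A := by
  have key : ∀ m, volume (swap ⁻¹' A ∩ box (swapFrame e) c r δ ν (YProd.flip ξ) j i m) =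
      volume (A ∩ boxB e c r δ ν ξ i j m) := by
    intro m
    rw [← measurePreserving_swap.measure_preimage
      (hA.inter (measurableSet_boxB e c r δ ν ξ i j m)).nullMeasurableSet]
    rfl
  rw [boxArea, boxAreaB, key, key]

theorem sum_boxAreaB_le (F : SlidingFamily e c r R δ ν L Γ ξ) (hn : 0 < n)
    {S : Fin 3 → Fin 3 → Set ℂ} (hS : IsFilling e Γ S) (i : Fin 3) :
    ∑ j, boxAreaB e c r δ ν ξ i j (region e c r δ ν ξ n i j) ≤
      ∑ j, boxAreaB e c r δ ν ξ i j (S i j) := by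
  have h := F.flip.sum_boxArea_le hn (F.isFilling_flip hS) i
  simp only [region_flip hn] at h
  simpa only [boxArea_flip (F.measurableSet_region hn _ _),
    boxArea_flip (hS.measurable _ _)] using h

/-! ### The area of the regions -/

/-- The union of the four boxes in the plane `Q i j`. -/
def _root_.YProd.boxes (e : Frame) (c r δ ν : ℝ) (ξ : Fin 3 → Fin 3 → ℝ → E4) (i j : Fin 3) : Set ℂ :=
  box e c r δ ν ξ i j (i + 1) ∪ box e c r δ ν ξ i j (i + 2) ∪ boxB e c r δ ν ξ i j (j + 1) ∪
    boxB e c r δ ν ξ i j (j + 2)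

theorem bounds_of_mem_box (F : SlidingFamily e c r R δ ν L Γ ξ) {i j k : Fin 3} {z : ℂ}
    (hz : z ∈ box e c r δ ν ξ i j k) : c / 2 < sg i k * z.re ∧ |z.im| < c / 2 := by
  have := F.sizes.R_lt; have := F.sizes.gap; have := F.sizes.δ_pos; have := F.sizes.δ_lt
  have := F.sizes.c_pos
  have hs := sqrt_three_bounds
  constructor
  · have h3 := hz.1
    have h4 := sg_mul_self i k
    rw [← one_mul |_|, ← abs_sg i k, ← abs_mul] at h3
    have h5 : sg i k * (z.re - sg i k * (√3 / 2 * c)) = sg i k * z.re - √3 / 2 * c := by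
      linear_combination -(√3 / 2 * c) * h4
    rw [h5] at h3
    have h6 := (abs_le.1 h3).1
    nlinarith
  · have := F.im_of_mem_box hz
    nlinarith

theorem bounds_of_mem_boxB (F : SlidingFamily e c r R δ ν L Γ ξ) {i j m : Fin 3} {z : ℂ}
    (hz : z ∈ boxB e c r δ ν ξ i j m) : c / 2 < sg j m * z.im ∧ |z.re| < c / 2 :=
  F.flip.bounds_of_mem_box (z := swap z) hz

theorem _root_.YProd.measure_inter_union (A : Set ℂ) {X Y : Set ℂ} (hY : MeasurableSet Y) (h : Disjoint X Y) :
    volume (A ∩ (X ∪ Y)) = volume (A ∩ X) + volume (A ∩ Y) := by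
  rw [← measure_inter_add_sdiff (A ∩ (X ∪ Y)) hY, add_comm]
  congr 2
  · ext z
    have := fun hz : z ∈ X => disjoint_left.1 h hz
    simp only [mem_sdiff, mem_inter_iff, mem_union]; tauto
  · ext z; simp only [mem_inter_iff, mem_union]; tauto

theorem volume_eq_boxes (F : SlidingFamily e c r R δ ν L Γ ξ) (i j : Fin 3) (A : Set ℂ) :
    volume A = boxArea e c r δ ν ξ i j A + boxAreaB e c r δ ν ξ i j A +
      volume (A \ boxes e c r δ ν ξ i j) := by
  have hc := F.sizes.c_pos
  have m1 := fun k => (isClosed_box e c r δ ν ξ i j k).measurableSet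
  have m2 := measurableSet_boxB e c r δ ν ξ i j
  have d12 : Disjoint (box e c r δ ν ξ i j (i + 1)) (box e c r δ ν ξ i j (i + 2)) :=
    disjoint_left.2 fun z h h' => by
      have h1 := (F.bounds_of_mem_box h).1
      have h2 := (F.bounds_of_mem_box h').1
      rw [sg_one] at h1
      rw [sg_two] at h2
      linarith
  have d34 : Disjoint (boxB e c r δ ν ξ i j (j + 1)) (boxB e c r δ ν ξ i j (j + 2)) :=
    disjoint_left.2 fun z h h' => by
      have h1 := (F.bounds_of_mem_boxB h).1
      have h2 := (F.bounds_of_mem_boxB h').1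
      rw [sg_one] at h1
      rw [sg_two] at h2
      linarith
  have d : ∀ k m, Disjoint (box e c r δ ν ξ i j k) (boxB e c r δ ν ξ i j m) := fun k m =>
    disjoint_left.2 fun z h h' => by
      have h1 := (F.bounds_of_mem_box h).2
      have h2 := (F.bounds_of_mem_boxB h').1
      have h3 : sg j m * z.im ≤ |z.im| :=
        (le_abs_self _).trans_eq (by rw [abs_mul, abs_sg, one_mul])
      linarith
  have h1 := measure_inter_add_sdiff (μ := volume) A
    ((((m1 (i + 1)).union (m1 (i + 2))).union (m2 (j + 1))).union (m2 (j + 2)))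
  rw [← h1, boxes]
  congr 1
  rw [measure_inter_union A (m2 (j + 2)), measure_inter_union A (m2 (j + 1)),
    measure_inter_union A (m1 (i + 2)) d12, add_assoc]
  · rfl
  · exact disjoint_union_left.2 ⟨d _ _, d _ _⟩
  · exact disjoint_union_left.2 ⟨disjoint_union_left.2 ⟨d _ _, d _ _⟩, d34⟩

/-- The total area of the regions is at most that of the fillings, up to the area of a
neighbourhood of the shifted curves. -/
theorem sum_volume_region_le (F : SlidingFamily e c r R δ ν L Γ ξ) (hn : 0 < n) {ρ : ℝ}
    (hρ : 7 * c * (Real.pi / 2) < n * ρ) {S : Fin 3 → Fin 3 → Set ℂ} (hS : IsFilling e Γ S) :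
    ∑ i, ∑ j, volume (region e c r δ ν ξ n i j) ≤ ∑ i, ∑ j, volume (S i j) +
      ∑ i, ∑ j, volume (Metric.cthickening ρ (shiftedCurves e c r ν ξ i j)) := by
  have h1 : ∑ i, ∑ j, boxArea e c r δ ν ξ i j (region e c r δ ν ξ n i j) ≤
      ∑ i, ∑ j, boxArea e c r δ ν ξ i j (S i j) := by
    rw [Finset.sum_comm, Finset.sum_comm (f := fun i j => boxArea e c r δ ν ξ i j (S i j))]
    exact Finset.sum_le_sum fun j _ => F.sum_boxArea_le hn hS j
  have h2 : ∑ i, ∑ j, boxAreaB e c r δ ν ξ i j (region e c r δ ν ξ n i j) ≤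
      ∑ i, ∑ j, boxAreaB e c r δ ν ξ i j (S i j) :=
    Finset.sum_le_sum fun i _ => F.sum_boxAreaB_le hn hS i
  have h3 : ∑ i, ∑ j, volume (region e c r δ ν ξ n i j \ boxes e c r δ ν ξ i j) ≤
      ∑ i, ∑ j, (volume (S i j \ boxes e c r δ ν ξ i j) +
        volume (Metric.cthickening ρ (shiftedCurves e c r ν ξ i j))) := by
    refine Finset.sum_le_sum fun i _ => Finset.sum_le_sum fun j _ =>
      F.volume_region_diff_le hn hρ hS (fun k hk => ?_) (fun m hm => ?_)
    · rcases eq_of_ne hk with rfl | rfl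
      · exact fun z hz => Or.inl (Or.inl (Or.inl hz))
      · exact fun z hz => Or.inl (Or.inl (Or.inr hz))
    · rcases eq_of_ne hm with rfl | rfl
      · exact fun z hz => Or.inl (Or.inr hz)
      · exact fun z hz => Or.inr hz
  have e1 : ∀ A : Fin 3 → Fin 3 → Set ℂ, ∑ i, ∑ j, volume (A i j) =
      ∑ i, ∑ j, boxArea e c r δ ν ξ i j (A i j) + ∑ i, ∑ j, boxAreaB e c r δ ν ξ i j (A i j) +
        ∑ i, ∑ j, volume (A i j \ boxes e c r δ ν ξ i j) := by
    intro A
    simp only [← Finset.sum_add_distrib]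
    exact Finset.sum_congr rfl fun i _ => Finset.sum_congr rfl fun j _ =>
      F.volume_eq_boxes i j (A i j)
  rw [e1 fun i j => region e c r δ ν ξ n i j, e1 S, add_assoc (_ + _)]
  refine add_le_add (add_le_add h1 h2) (h3.trans_eq ?_)
  simp only [Finset.sum_add_distrib]

theorem _root_.YProd.sum_sum_erase {M : Type*} [AddCommMonoid M] (f : Fin 3 → Fin 3 → M) :
    ∑ i, ∑ k ∈ Finset.univ.erase i, f i k = ∑ k, ∑ i ∈ Finset.univ.erase k, f i k :=
  Finset.sum_comm' (by simp [ne_comm])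

/-- The area of the parallelogram spanned by two points of the quadrant `k m` after projection to
that quadrant. -/
noncomputable def _root_.YProd.quadDet (e : Frame) (k m : Fin 3) (P P' : E4) : ℝ :=
  cA e k P * cB e m P' - cA e k P' * cB e m P

/-- The terms which are not in the plane of the quadrant cancel in the sum over the four planes
onto which the quadrant is projected. -/
theorem _root_.YProd.sum_cross_q (e : Frame) (k m : Fin 3) (P P' : E4) :
    ∑ i ∈ Finset.univ.erase k, ∑ j ∈ Finset.univ.erase m,
      sg i k * sg j m * cross (q e i j P) (q e i j P') = 3 * quadDet e k m P P' := by
  have hk1 : k ≠ k + 1 := (add_one_ne k).symm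
  have hk2 : k ≠ k + 2 := (add_two_ne k).symm
  have hm1 : m ≠ m + 1 := (add_one_ne m).symm
  have hm2 : m ≠ m + 2 := (add_two_ne m).symm
  have s1 : ∀ k : Fin 3, sg (k + 1) k = -1 := by
    intro k; rw [← sg_two (k + 1), (fin3_add k).2.1]
  have s2 : ∀ k : Fin 3, sg (k + 2) k = 1 := by
    intro k; rw [← sg_one (k + 2), (fin3_add k).2.2.1]
  simp only [sum_erase, cross, q_re, q_im, cX_eq_sg e hk1, cX_eq_sg e hk2, cY_eq_sg e hm1,
    cY_eq_sg e hm2, s1, s2, quadDet]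
  have : √(3:ℝ) ^ 2 = 3 := Real.sq_sqrt (by norm_num)
  linear_combination (cA e k P * cB e m P' - cA e k P' * cB e m P) * this

/-- The total area of the regions depends only on the projections of the vertices to the
quadrants. -/
theorem sum_volume_region_eq (F : SlidingFamily e c r R δ ν L Γ ξ) (hn : 0 < n) :
    ∑ i, ∑ j, volume (region e c r δ ν ξ n i j) =
      ENNReal.ofReal (∑ k, ∑ m, ∑ l ∈ Finset.range (n + 2), 3 * quadDet e k m
        (node e c r δ ν ξ n k m l) (node e c r δ ν ξ n k m (l + 1))) *
        volume (tri 1 Complex.I) := by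
  set D : Fin 3 → Fin 3 → Fin 3 → Fin 3 → ℕ → ℝ := fun i j k m l =>
    sg i k * sg j m * cross (qNode e c r δ ν ξ n i j k m l) (qNode e c r δ ν ξ n i j k m (l + 1))
    with hD
  have hpos : ∀ i j, ∀ x ∈ cellIndex n i j, 0 < D i j x.1 x.2.1 x.2.2 := fun i j x hx => by
    obtain ⟨hk, hm, hl⟩ := mem_cellIndex.1 hx
    exact (F.isFan hk hm hn).cross_pos _ _ (Nat.lt_succ_self _) hl
  have h1 : ∀ i j, volume (region e c r δ ν ξ n i j) =
      ENNReal.ofReal (∑ x ∈ cellIndex n i j, D i j x.1 x.2.1 x.2.2) *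
        volume (tri 1 Complex.I) := by
    intro i j
    rw [F.volume_region hn, ENNReal.ofReal_sum_of_nonneg fun x hx => (hpos i j x hx).le,
      Finset.sum_mul]
    refine Finset.sum_congr rfl fun x hx => ?_
    rw [cell, volume_tri, ← abs_of_pos (hpos i j x hx), hD, abs_mul, abs_mul, abs_sg, abs_sg,
      one_mul, one_mul]
  have h2 : ∀ i j, 0 ≤ ∑ x ∈ cellIndex n i j, D i j x.1 x.2.1 x.2.2 := fun i j =>
    Finset.sum_nonneg fun x hx => (hpos i j x hx).le
  simp only [h1, ← Finset.sum_mul]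
  congr 1
  simp only [← ENNReal.ofReal_sum_of_nonneg fun j _ => h2 _ j]
  rw [← ENNReal.ofReal_sum_of_nonneg fun i _ => Finset.sum_nonneg fun j _ => h2 i j]
  congr 1
  simp only [cellIndex, Finset.sum_product]
  calc ∑ i, ∑ j, ∑ k ∈ Finset.univ.erase i, ∑ m ∈ Finset.univ.erase j,
        ∑ l ∈ Finset.range (n + 2), D i j k m l
      = ∑ i, ∑ k ∈ Finset.univ.erase i, ∑ j, ∑ m ∈ Finset.univ.erase j,
        ∑ l ∈ Finset.range (n + 2), D i j k m l :=
        Finset.sum_congr rfl fun i _ => Finset.sum_comm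
    _ = ∑ k, ∑ i ∈ Finset.univ.erase k, ∑ m, ∑ j ∈ Finset.univ.erase m,
        ∑ l ∈ Finset.range (n + 2), D i j k m l := by
        rw [sum_sum_erase]
        exact Finset.sum_congr rfl fun k _ => Finset.sum_congr rfl fun i _ => sum_sum_erase _
    _ = ∑ k, ∑ m, ∑ l ∈ Finset.range (n + 2), ∑ i ∈ Finset.univ.erase k,
        ∑ j ∈ Finset.univ.erase m, D i j k m l := by
        refine Finset.sum_congr rfl fun k _ => ?_
        rw [Finset.sum_comm]
        refine Finset.sum_congr rfl fun m _ => ?_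
        rw [Finset.sum_comm' (s' := fun _ => Finset.univ.erase k) (t' := Finset.range (n + 2))
          (s := Finset.univ.erase k) (t := fun _ => Finset.range (n + 2))
          (f := fun i l => ∑ j ∈ Finset.univ.erase m, D i j k m l) (by simp) |>.symm]
        exact Finset.sum_congr rfl fun i _ => Finset.sum_comm
    _ = _ := Finset.sum_congr rfl fun k _ => Finset.sum_congr rfl fun m _ =>
        Finset.sum_congr rfl fun l _ => sum_cross_q e k m _ _

theorem coord_node_congr (F : SlidingFamily e c r R δ ν L Γ ξ) {Γ' ξ' : Fin 3 → Fin 3 → ℝ → E4}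
    (F' : SlidingFamily e c r R δ ν L Γ' ξ') (hn : 0 < n) (k m : Fin 3) {l : ℕ} (hl : l ≤ n + 2) :
    cA e k (node e c r δ ν ξ n k m l) = cA e k (node e c r δ ν ξ' n k m l) ∧
      cB e m (node e c r δ ν ξ n k m l) = cB e m (node e c r δ ν ξ' n k m l) := by
  rcases Nat.eq_zero_or_pos l with rfl | h0
  · rw [node_zero, node_zero]; exact ⟨rfl, rfl⟩
  · rcases hl.eq_or_lt with rfl | h1
    · rw [node_last, node_last]; exact ⟨rfl, rfl⟩
    · obtain ⟨u, rfl⟩ : ∃ u, l = u + 1 := ⟨l - 1, by omega⟩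
      have hu : u ≤ n := by omega
      have hmem := F.Icc_subset_angles (F.meshAngle_mem hn hu)
      rw [node_succ _ _ _ _ _ _ _ _ hu, node_succ _ _ _ _ _ _ _ _ hu]
      obtain ⟨h2, h3, -⟩ := F.coord_graphPt k m hmem
      obtain ⟨h4, h5, -⟩ := F'.coord_graphPt k m hmem
      exact ⟨h2.trans h4.symm, h3.trans h5.symm⟩

theorem sum_volume_region_congr (F : SlidingFamily e c r R δ ν L Γ ξ)
    {Γ' ξ' : Fin 3 → Fin 3 → ℝ → E4} (F' : SlidingFamily e c r R δ ν L Γ' ξ') (hn : 0 < n) :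
    ∑ i, ∑ j, volume (region e c r δ ν ξ n i j) = ∑ i, ∑ j, volume (region e c r δ ν ξ' n i j) := by
  rw [F.sum_volume_region_eq hn, F'.sum_volume_region_eq hn]
  congr 2
  refine Finset.sum_congr rfl fun k _ => Finset.sum_congr rfl fun m _ =>
    Finset.sum_congr rfl fun l hl => ?_
  have hl' := Finset.mem_range.1 hl
  obtain ⟨h1, h2⟩ := F.coord_node_congr F' hn k m hl'.le
  obtain ⟨h3, h4⟩ := F.coord_node_congr F' hn k m (l := l + 1) hl'
  rw [quadDet, quadDet, h1, h2, h3, h4]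

end SlidingFamily

/-! ### The original and the deformed cycles -/

/-- The undeformed curves. -/
theorem slidingFamily_arcPt (e : Frame) {c r R δ ν L : ℝ} (S : Sizes c r R δ ν L) :
    SlidingFamily e c r R δ ν L (arcPt e c r) (fun _ _ _ => 0) where
  sizes := S
  lip k m := ⟨_, lipschitzOnWith_arcPt S k m⟩
  start k m m' := by
    have h := (onCurve_arctan S.c_pos S.r_pos S.r_sq (by linarith [S.R_lt, S.R_pos]) le_rfl
      S.R_pos.le).2.2
    rw [zero_div, Real.arctan_zero] at h
    rw [arcPt, arcPt, h, quadPt, quadPt, zero_smul, zero_smul]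
  finish k k' m := by
    have h := (onCurve_arctan S.c_pos S.r_pos S.r_sq (by linarith [S.R_lt, S.R_pos]) le_rfl
      S.R_pos.le).2.2
    rw [zero_div, Real.arctan_zero, ← curvA_symm, sub_zero] at h
    rw [arcPt, arcPt, h, quadPt, quadPt, zero_smul, zero_smul]
  close k m θ _ := by rw [sub_self, norm_zero]; exact S.δ_pos
  faceA k m θ hθ hB := by
    rw [arcPt, (coord_quadPt e k m _ _).1]
    exact curvA_eq_of_curvB_le S.c_pos S.r_sq (by linarith [S.R_lt, S.R_pos])
      (onCurve S.c_pos S.r_pos hθ) (by linarith [S.δ_pos])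
  faceB k m θ hθ hA := by
    rw [arcPt, (coord_quadPt e k m _ _).2.2.1, ← curvA_symm]
    refine curvA_eq_of_curvB_le S.c_pos S.r_sq (by linarith [S.R_lt, S.R_pos])
      (onCurve S.c_pos S.r_pos (mem_symm_iff.2 hθ)) ?_
    rw [curvB_symm]; linarith [S.δ_pos]
  graph k m := ⟨id, continuousOn_id, fun θ hθ =>
    ⟨⟨hθ.1, (le_add_of_nonneg_right S.δ_pos.le).trans hθ.2.1,
      (le_add_of_nonneg_right S.δ_pos.le).trans hθ.2.2⟩, by
      rw [graphPt, add_zero]; rfl⟩⟩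
  ξ_coord k m θ _ := by simp [cA, cB]
  ξ_lt k m θ _ := by rw [norm_zero]; exact S.δ_pos
  ξ_lip k m θ _ θ' _ := by
    rw [sub_self, norm_zero]; exact mul_nonneg S.L_nonneg (norm_nonneg _)

theorem arcPt_zero (e : Frame) {c r R δ ν L : ℝ} (S : Sizes c r R δ ν L) (k m : Fin 3) :
    arcPt e c r k m 0 = c • a e k := by
  obtain ⟨-, h1, h2⟩ := onCurve_arctan S.c_pos S.r_pos S.r_sq (by linarith [S.R_lt, S.R_pos]) le_rfl
      S.R_pos.le
  rw [zero_div, Real.arctan_zero] at h1 h2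
  rw [arcPt, h1, h2, quadPt, zero_smul, add_zero]

theorem arcPt_end (e : Frame) {c r R δ ν L : ℝ} (S : Sizes c r R δ ν L) (k m : Fin 3) :
    arcPt e c r k m (Real.pi / 2) = c • b e m := by
  have h := arcPt_zero (swapFrame e) S m k
  rwa [arcPt_flip, sub_zero, a_swapFrame] at h

theorem pi_half_mul_mem {t : ℝ} (ht : t ∈ Icc (0:ℝ) 1) :
    Real.pi / 2 * t ∈ Icc 0 (Real.pi / 2) := by
  have := Real.pi_pos
  exact ⟨mul_nonneg (by positivity) ht.1, mul_le_of_le_one_right (by positivity) ht.2⟩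

theorem push_z (e : Frame) (η : ℝ) {Y : Type*} (f : E4 → Y) (i j : Fin 3) :
    push f (z e η i j) = ∑ k ∈ Finset.univ.erase i, ∑ m ∈ Finset.univ.erase j,
      Finsupp.single (fun t => f (arc e η k m t)) 1 := by
  rw [push, z, Finsupp.mapDomain_finsetSum]
  refine Finset.sum_congr rfl fun k _ => ?_
  rw [Finsupp.mapDomain_finsetSum]
  exact Finset.sum_congr rfl fun m _ => Finsupp.mapDomain_single

/-- The points around which the deformed cycle has odd winding parity belong to its filling. -/
theorem isFilling_fillSupport {e : Frame} {η R δ ν L : ℝ} {φ : E4 → E4}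
    {ξ : Fin 3 → Fin 3 → ℝ → E4} (F : SlidingFamily e (1 - √η) (1 - η) R δ ν L
      (fun k m θ => φ (arcPt e (1 - √η) (1 - η) k m θ)) ξ) :
    IsFilling e (fun k m θ => φ (arcPt e (1 - √η) (1 - η) k m θ))
      (fun i j => fillSupport (push (q e i j) (push φ (z e η i j)))) where
  measurable i j := (isClosed_fillSupport _).measurableSet
  mem i j p hoff hsum := by
    refine mem_fillSupport_of_winding ?_
    have h1 : push (q e i j) (push φ (z e η i j)) = push (fun v => q e i j (φ v)) (z e η i j) := by
      rw [push, push, push, ← Finsupp.mapDomain_comp]; rfl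
    have h2 : ∀ k m, unitPar p (fun t => q e i j (φ (arc e η k m t))) =
        par p (fun θ => q e i j (φ (arcPt e (1 - √η) (1 - η) k m θ))) 0 (Real.pi / 2) := by
      intro k m
      have h3 := par_comp (p := p)
        (γ := fun θ => q e i j (φ (arcPt e (1 - √η) (1 - η) k m θ)))
        (f := fun t => Real.pi / 2 * t) (a := 0) (b := 1) (by fun_prop)
        (by rw [uIcc_of_le zero_le_one]; exact fun t ht => pi_half_mul_mem ht)
        (F.continuousOn_q i j k m) (hoff k m)
      rw [mul_zero, mul_one] at h3
      rw [← h3, unitPar]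
      refine par_congr fun t ht => ?_
      rw [uIcc_of_le zero_le_one] at ht
      simp only [arc_eq, projIcc_of_mem _ ht]
    rw [h1, push_z]
    simp only [sum_erase, map_add, winding_single, one_mul, h2]
    rw [sumPar] at hsum
    rw [hsum]
    exact one_ne_zero

theorem exists_step (t : ℕ → ℝ) {n : ℕ} (hn : 0 < n) {θ : ℝ} (h0 : t 0 ≤ θ) (h1 : θ ≤ t n) :
    ∃ l < n, θ ∈ Icc (t l) (t (l + 1)) := by
  induction n with
  | zero => exact absurd hn (lt_irrefl 0)
  | succ n ih =>
    rcases Nat.eq_zero_or_pos n with rfl | hn0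
    · exact ⟨0, hn, h0, h1⟩
    · rcases le_total θ (t n) with h | h
      · obtain ⟨l, hl, hl'⟩ := ih hn0 h
        exact ⟨l, by omega, hl'⟩
      · exact ⟨n, Nat.lt_succ_self n, h, h1⟩

theorem q_quadPt (e : Frame) {i j k m : Fin 3} (hk : k ≠ i) (hm : m ≠ j) (s t : ℝ) :
    q e i j (quadPt e k m s t) = ⟨sg i k * (√3 / 2 * s), sg j m * (√3 / 2 * t)⟩ := by
  obtain ⟨h1, h2, h3, h4⟩ := coord_quadPt e k m s t
  rw [q_eq, cX_eq_sg e hk, cY_eq_sg e hm, h1, h2, h3, h4, mul_zero, sub_zero, sub_zero]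

/-- A point between `0` and a point `w` which has nonnegative coordinates with respect to `P` and
`Q` and is close to both lies in the triangle spanned by `P` and `Q`, or close to `w`. -/
theorem mem_closedTri_or_dist_lt {P Q w : ℂ} {s t r ρ : ℝ} (hs : 0 ≤ s) (ht : 0 ≤ t)
    (hw : w = s * P + t * Q) (hP : dist P w < ρ) (hQ : dist Q w < ρ) (hr : r ∈ Icc (0:ℝ) 1) :
    (r : ℂ) * w ∈ closedTri P Q ∨ dist ((r : ℂ) * w) w < ρ := by
  by_cases h : r * (s + t) ≤ 1
  · refine Or.inl ⟨r * s, r * t, mul_nonneg hr.1 hs, mul_nonneg hr.1 ht, by linarith, ?_⟩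
    rw [hw]; push_cast; ring
  · push Not at h
    have hst : 0 < s + t := by
      by_contra hle
      have := mul_nonpos_of_nonneg_of_nonpos hr.1 (not_lt.1 hle)
      linarith
    have h1 := convex_ball w ρ (Metric.mem_ball.2 hP) (Metric.mem_ball.2 hQ)
      (div_nonneg hs hst.le) (div_nonneg ht hst.le) (by field_simp)
    have h2 : (s / (s + t)) • P + (t / (s + t)) • Q = ((1 / (s + t) : ℝ) : ℂ) * w := by
      have : ((s + t : ℝ) : ℂ) ≠ 0 := Complex.ofReal_ne_zero.2 hst.ne'
      rw [hw, Complex.real_smul, Complex.real_smul]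
      push_cast at this ⊢
      field_simp
    have h3 : 1 / (s + t) < r := by rw [div_lt_iff₀ hst]; exact h
    have h4 : ∀ u : ℝ, u ≤ 1 → dist ((u : ℂ) * w) w = (1 - u) * ‖w‖ := fun u hu => by
      rw [dist_eq_norm, show (u : ℂ) * w - w = ((u - 1 : ℝ) : ℂ) * w by push_cast; ring, norm_mul,
        Complex.norm_real, Real.norm_eq_abs, abs_of_nonpos (by linarith), neg_sub]
    rw [h2, Metric.mem_ball, h4 _ (h3.le.trans hr.2)] at h1
    refine Or.inr ?_
    rw [h4 r hr.2]
    refine lt_of_le_of_lt ?_ h1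
    gcongr

theorem eq_smul_add_smul {P Q : ℂ} (w : ℂ) (h : cross P Q ≠ 0) :
    w = (cross w Q / cross P Q : ℝ) * P + (cross P w / cross P Q : ℝ) * Q := by
  apply Complex.ext
  · simp only [Complex.add_re, Complex.re_ofReal_mul]
    field_simp; simp only [cross]; ring
  · simp only [Complex.add_im, Complex.im_ofReal_mul]
    field_simp; simp only [cross]; ring

/-- The filling of the projection of the original cycle is contained in the union of the triangles
with vertices on the original curves, up to a neighbourhood of the curves. -/
theorem cone_subset (e : Frame) {c r R δ ν L : ℝ} (S : Sizes c r R δ ν L) {n : ℕ} (hn : 0 < n)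
    {ρ : ℝ} (hρ : 7 * c * (Real.pi / 2) < n * ρ) {i j k m : Fin 3} (hk : k ≠ i) (hm : m ≠ j)
    {θ : ℝ} (hθ : θ ∈ Icc 0 (Real.pi / 2)) {u : ℝ} (hu : u ∈ Icc (0:ℝ) 1) :
    (∃ l < n + 2, (u : ℂ) * q e i j (arcPt e c r k m θ) ∈ closedTri
      (qNode e c r δ ν (fun _ _ _ => 0) n i j k m l)
      (qNode e c r δ ν (fun _ _ _ => 0) n i j k m (l + 1))) ∨
    (u : ℂ) * q e i j (arcPt e c r k m θ) ∈
      Metric.cthickening ρ (shiftedCurves e c r ν (fun _ _ _ => 0) i j) := by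
  have F := slidingFamily_arcPt e S
  obtain ⟨c1, c2, c3⟩ := F.cutAngle_spec
  have hδ := S.δ_pos; have hν := S.δ_lt; have hg := S.gap; have hRc := S.R_lt
  have hR := S.R_pos
  have hgr : ∀ θ, graphPt e c r (fun _ _ _ => 0) k m θ = arcPt e c r k m θ := fun θ => by
    rw [graphPt, add_zero]
  have hb : 0 < ν + 3 * δ := by linarith
  rcases le_total θ (cutAngle c δ ν) with h1 | h1
  · -- the curve is a segment
    refine Or.inl ⟨0, by omega, ?_⟩
    have hB := (onCurve S.c_pos S.r_pos hθ).2.1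
    have hB' := (curvB_mono S.c_pos S.r_pos hθ c1 h1).trans c3.le
    have hA : curvA c r θ = c := curvA_eq_of_curvB_le S.c_pos S.r_sq
      (by linarith) (onCurve S.c_pos S.r_pos hθ) (by linarith)
    have hv0 := div_nonneg hB hb.le
    have hv1 : curvB c r θ / (ν + 3 * δ) ≤ 1 := (div_le_one hb).2 hB'
    have hv : curvB c r θ = curvB c r θ / (ν + 3 * δ) * (ν + 3 * δ) := by field_simp
    set v := curvB c r θ / (ν + 3 * δ)
    refine ⟨u * (1 - v), u * v, mul_nonneg hu.1 (by linarith), mul_nonneg hu.1 hv0,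
      by linarith [hu.2], ?_⟩
    rw [qNode, qNode, node_zero, node_succ _ _ _ _ _ _ _ _ (Nat.zero_le n),
      meshAngle_zero, hgr, q_smul_a e j hk, arcPt, arcPt, q_quadPt e hk hm,
      q_quadPt e hk hm, c2, c3, hA, hv]
    apply Complex.ext <;> simp [Complex.mul_re, Complex.mul_im] <;> ring
  rcases le_total (Real.pi / 2 - cutAngle c δ ν) θ with h2 | h2
  · refine Or.inl ⟨n + 1, by omega, ?_⟩
    have hA := (onCurve S.c_pos S.r_pos hθ).1
    have hA' := curvA_anti S.c_pos S.r_pos (mem_symm_iff.2 c1) hθ h2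
    rw [curvA_symm, c3] at hA'
    have hB : curvB c r θ = c := by
      rw [← curvA_symm]
      refine curvA_eq_of_curvB_le S.c_pos S.r_sq
        (by linarith) (onCurve S.c_pos S.r_pos (mem_symm_iff.2 hθ)) ?_
      rw [curvB_symm]; linarith
    have hv0 := div_nonneg hA hb.le
    have hv1 : curvA c r θ / (ν + 3 * δ) ≤ 1 := (div_le_one hb).2 hA'
    have hv : curvA c r θ = curvA c r θ / (ν + 3 * δ) * (ν + 3 * δ) := by field_simp
    set v := curvA c r θ / (ν + 3 * δ)
    refine ⟨u * v, u * (1 - v), mul_nonneg hu.1 hv0, mul_nonneg hu.1 (by linarith),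
      by linarith [hu.2], ?_⟩
    rw [qNode, qNode, node_last, node_succ _ _ _ _ _ _ _ _ le_rfl,
      meshAngle_last _ _ _ hn, hgr, q_smul_b e i hm, arcPt, arcPt, q_quadPt e hk hm,
      q_quadPt e hk hm, curvA_symm, curvB_symm, c2, c3, hB, hv]
    apply Complex.ext <;> simp [Complex.mul_re, Complex.mul_im] <;> ring
  · obtain ⟨l, hl, hθl⟩ := exists_step (meshAngle c δ ν n) hn (θ := θ) (by
      rwa [meshAngle_zero]) (by rwa [meshAngle_last _ _ _ hn])
    have hlt := F.meshAngle_lt hn (Nat.lt_succ_self l)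
    have ml := F.Icc_subset_angles (F.meshAngle_mem hn hl.le)
    have ml' := F.Icc_subset_angles (F.meshAngle_mem hn (Nat.succ_le_of_lt hl))
    have mθ := F.Icc_subset_angles ⟨h1, h2⟩
    have d1 := F.dist_q_graphPt_lt i j k m hn hl hρ (left_mem_Icc.2 hlt.le) hθl
    have d2 := F.dist_q_graphPt_lt i j k m hn hl hρ (right_mem_Icc.2 hlt.le) hθl
    have p1 := F.cross_graphPt_pos hk hm ml ml' hlt
    have p2 : 0 ≤ sg i k * sg j m * cross
        (q e i j (graphPt e c r (fun _ _ _ => 0) k m (meshAngle c δ ν n l)))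
        (q e i j (graphPt e c r (fun _ _ _ => 0) k m θ)) := by
      rcases hθl.1.eq_or_lt with h | h
      · rw [h]; simp [cross, mul_comm]
      · exact (F.cross_graphPt_pos hk hm ml mθ h).le
    have p3 : 0 ≤ sg i k * sg j m * cross
        (q e i j (graphPt e c r (fun _ _ _ => 0) k m θ))
        (q e i j (graphPt e c r (fun _ _ _ => 0) k m (meshAngle c δ ν n (l + 1)))) := by
      rcases hθl.2.eq_or_lt with h | h
      · rw [h]; simp [cross, mul_comm]
      · exact (F.cross_graphPt_pos hk hm mθ ml' h).le
    have e1 : (sg i k * sg j m) * (sg i k * sg j m) = 1 := by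
      linear_combination (sg j m * sg j m) * sg_mul_self i k + sg_mul_self j m
    rw [← hgr θ]
    set P := q e i j (graphPt e c r (fun _ _ _ => 0) k m (meshAngle c δ ν n l)) with hP
    set Q := q e i j (graphPt e c r (fun _ _ _ => 0) k m (meshAngle c δ ν n (l + 1))) with hQ
    set w := q e i j (graphPt e c r (fun _ _ _ => 0) k m θ) with hw
    have hne : cross P Q ≠ 0 := fun h => by rw [h, mul_zero] at p1; exact lt_irrefl _ p1
    have hdiv : ∀ x, 0 ≤ sg i k * sg j m * x → 0 ≤ x / cross P Q := fun x hx => by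
      have h3 := div_nonneg hx p1.le
      rwa [mul_div_mul_left] at h3
      intro h0; rw [h0, mul_zero] at e1; exact zero_ne_one e1
    rcases mem_closedTri_or_dist_lt (hdiv _ p3) (hdiv _ p2) (eq_smul_add_smul w hne) d1 d2 hu with
      h3 | h3
    · refine Or.inl ⟨l + 1, by omega, ?_⟩
      rw [qNode, qNode, node_succ _ _ _ _ _ _ _ _ hl.le, node_succ _ _ _ _ _ _ _ _ hl]
      exact h3
    · exact Or.inr (Metric.mem_cthickening_of_dist_le _ w ρ _
        (mem_iUnion₂.2 ⟨k, m, θ, mθ, rfl⟩) h3.le)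

/-- The area of the original cycle is at most the area of the regions with vertices on the original
curves, up to the area of a neighbourhood of the curves. -/
theorem enclosedArea_le {e : Frame} {η R δ ν L : ℝ} (S : Sizes (1 - √η) (1 - η) R δ ν L) {n : ℕ}
    (hn : 0 < n) {ρ : ℝ} (hρ : 7 * (1 - √η) * (Real.pi / 2) < n * ρ) (i j : Fin 3) :
    enclosedArea (push (q e i j) (z e η i j)) ≤
      volume (region e (1 - √η) (1 - η) δ ν (fun _ _ _ => 0) n i j) +
        volume (Metric.cthickening ρ
          (shiftedCurves e (1 - √η) (1 - η) ν (fun _ _ _ => 0) i j)) := by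
  have F := slidingFamily_arcPt e S
  have hcard : ∀ i : Fin 3, Even (Finset.univ.erase i).card := fun i => by
    rw [Finset.card_erase_of_mem (Finset.mem_univ i)]; decide
  have hsub := fillSupport_subset_cone (hcard i) (hcard j)
    (γ := fun k m t => q e i j (arc e η k m t)) (A := fun k => q e i j ((1 - √η) • a e k))
    (B := fun m => q e i j ((1 - √η) • b e m)) (fun k m => by
      simp only [arc_eq]
      exact (F.continuousOn_q i j k m).comp_continuous (f := fun t : unitInterval =>
        Real.pi / 2 * (t : ℝ)) (by fun_prop) fun t => pi_half_mul_mem t.2)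
    (fun k m => by simp only [arc_eq]; rw [Icc.coe_zero, mul_zero, arcPt_zero e S])
    (fun k m => by simp only [arc_eq]; rw [Icc.coe_one, mul_one, arcPt_end e S])
  rw [← push_z e η (q e i j)] at hsub
  have hsub2 : fillSupport (push (q e i j) (z e η i j)) ⊆ (⋃ x ∈ cellIndex n i j, closedTri
      (qNode e (1 - √η) (1 - η) δ ν (fun _ _ _ => 0) n i j x.1 x.2.1 x.2.2)
      (qNode e (1 - √η) (1 - η) δ ν (fun _ _ _ => 0) n i j x.1 x.2.1 (x.2.2 + 1))) ∪
      Metric.cthickening ρ (shiftedCurves e (1 - √η) (1 - η) ν (fun _ _ _ => 0) i j) := by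
    intro p hp
    obtain ⟨k, hk, m, hm, u, hu, t, rfl⟩ := hsub hp
    have hk' := Finset.ne_of_mem_erase hk
    have hm' := Finset.ne_of_mem_erase hm
    rw [arc_eq]
    rcases cone_subset e S hn hρ hk' hm' (pi_half_mul_mem t.2) hu with ⟨l, hl, h⟩ | h
    · exact Or.inl (mem_iUnion₂.2 ⟨(k, m, l), mem_cellIndex.2 ⟨hk', hm', hl⟩, h⟩)
    · exact Or.inr h
  refine (measure_mono hsub2).trans ((measure_union_le _ _).trans ?_)
  refine add_le_add_left ?_ _
  rw [F.volume_region hn]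
  exact (measure_biUnion_finset_le _ _).trans
    (Finset.sum_le_sum fun x _ => volume_closedTri_le _ _)

end YProd

theorem theorem6p1 (e : YProd.Frame) (η δ ν L : ℝ)
    (hη₀ : 0 < η) (hη₁ : η < 1)
    (hδ₀ : 0 < δ) (hδ₁ : δ < YProd.R1 η)
    (hν₀ : 0 < ν) (hν₁ : ν < YProd.R3 η) (hL₀ : 0 < L)
    (hangle : Real.arctan (YProd.R3 η / (1 - √η)) < Real.pi / 16)
    (hδ₂ : δ < min ν ((YProd.R3 η - ν) / 6))
    (hL₁ : L < δ ^ 2 * YProd.R3 η / ((1 - √η) * (1 - η) ^ 2))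
    (G : Set YProd.E4) (hG : YProd.IsSlidingBoundary e η δ ν L G)
    (φ : ℝ → YProd.E4 → YProd.E4)
    (hφ : YProd.IsSlidingDeformation (YProd.U e η) (frontier (YProd.U e η) ∩ YProd.Z e) δ φ)
    (hφG : φ 1 '' (frontier (YProd.U e η) ∩ YProd.Z e) = G) :
    ∑ i : Fin 3, ∑ j : Fin 3, YProd.enclosedArea (YProd.push (YProd.q e i j) (YProd.z e η i j)) ≤
      ∑ i : Fin 3, ∑ j : Fin 3,
        YProd.enclosedArea
          (YProd.push (YProd.q e i j) (YProd.push (φ 1) (YProd.z e η i j))) := by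
  have S := YProd.sizes_of_hyps hη₀ hη₁ hδ₀ hδ₁ hL₀ hangle hδ₂ hL₁
  obtain ⟨ξ, F⟩ := YProd.exists_slidingFamily hη₀ hη₁ hδ₁ S hG hφ hφG
  have hS := YProd.isFilling_fillSupport F
  have F₀ := YProd.slidingFamily_arcPt e S
  set C := fun i j => YProd.shiftedCurves e (1 - √η) (1 - η) ν ξ i j with hC
  set C₀ := fun i j => YProd.shiftedCurves e (1 - √η) (1 - η) ν (fun _ _ _ => 0) i j with hC₀
  have key : ∀ ρ : ℝ, 0 < ρ →
      ∑ i : Fin 3, ∑ j : Fin 3,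
        YProd.enclosedArea (YProd.push (YProd.q e i j) (YProd.z e η i j)) ≤
      ∑ i : Fin 3, ∑ j : Fin 3, YProd.enclosedArea
          (YProd.push (YProd.q e i j) (YProd.push (φ 1) (YProd.z e η i j))) +
        (∑ i : Fin 3, ∑ j : Fin 3, MeasureTheory.volume (Metric.cthickening ρ (C i j)) +
          ∑ i : Fin 3, ∑ j : Fin 3, MeasureTheory.volume (Metric.cthickening ρ (C₀ i j))) := by
    intro ρ hρ
    -- `n` edges are enough for the polygons to stay within `ρ` of the curves
    obtain ⟨n, hn⟩ := exists_nat_gt (7 * (1 - √η) * (Real.pi / 2) / ρ)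
    rw [div_lt_iff₀ hρ] at hn
    have hn0 : 0 < n := by
      have h1 : 0 < 7 * (1 - √η) * (Real.pi / 2) := by
        have := S.c_pos; have := Real.pi_pos; positivity
      have h2 : (0:ℝ) < n := (mul_pos_iff_of_pos_right hρ).1 (h1.trans hn)
      exact_mod_cast h2
    have h1 := F.sum_volume_region_le hn0 hn hS
    rw [F.sum_volume_region_congr F₀ hn0] at h1
    have h2 := Finset.sum_le_sum fun i (_ : i ∈ (Finset.univ : Finset (Fin 3))) =>
      Finset.sum_le_sum fun j (_ : j ∈ (Finset.univ : Finset (Fin 3))) =>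
        YProd.enclosedArea_le (e := e) S hn0 hn i j
    simp only [Finset.sum_add_distrib] at h2
    refine h2.trans ((add_le_add_left h1 _).trans_eq ?_)
    rw [add_assoc]
    rfl
  have lim : ∀ D : Fin 3 → Fin 3 → Set ℂ, (∀ i j, IsCompact (D i j)) →
      (∀ i j, MeasureTheory.volume (D i j) = 0) → Filter.Tendsto
      (fun ρ => ∑ i : Fin 3, ∑ j : Fin 3, MeasureTheory.volume (Metric.cthickening ρ (D i j)))
      (nhds 0) (nhds 0) := by
    intro D hD hD0
    have h : (0 : ENNReal) = ∑ i : Fin 3, ∑ j : Fin 3, MeasureTheory.volume (D i j) := by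
      simp only [hD0, Finset.sum_const_zero]
    rw [h]
    exact tendsto_finsetSum _ fun i _ => tendsto_finsetSum _ fun j _ =>
      tendsto_measure_cthickening_of_isCompact (hD i j)
  have h1 := (lim C F.isCompact_shiftedCurves F.volume_shiftedCurves).add
    (lim C₀ F₀.isCompact_shiftedCurves F₀.volume_shiftedCurves)
  have h2 := (tendsto_const_nhds (x := ∑ i : Fin 3, ∑ j : Fin 3, YProd.enclosedArea
    (YProd.push (YProd.q e i j) (YProd.push (φ 1) (YProd.z e η i j))))).add h1
  rw [add_zero, add_zero] at h2
  exact ge_of_tendsto (h2.mono_left (nhdsWithin_le_nhds (s := Set.Ioi 0)))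
    (Filter.eventually_of_mem self_mem_nhdsWithin key)
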